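/- Assume the Riemann Hypothesis. For real $T\ge 0$ let $N(T)$ denote the number of non-trivial zeros $\rho=\beta+i\gamma$ (those with $0<\beta<1$) of the Riemann zeta function with ordinate $\gamma\in[0,T]$, counted with multiplicity. There are absolute constants $C>0$ and $T_0$ such that the following holds for all real $T\ge T_0$, all real $h$ with $0\le h\le\sqrt{T}$ and all real $V$ with $(\log\log T)^2\le V\le \log T/\log\log T$. If $T\le t_1<t_2<\dots<t_R\le 2T$ are real numbers with $t_{j+1}-t_j\ge 1$ for $1\le j<R$ and $$\Big|N(t_j+h)-N(t_j-h)-\frac{h}{\pi}\log\frac{t_j}{2\pi}\Big|>V\qquad(1\le j\le R),$$ then $$R\le C\,T\exp\Big(-V\log\frac{V}{\log\log T}+3V\log\log V\Big).$$ -/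

import Mathlib

/-- The non-trivial zeros `ρ = β + iγ` of the Riemann zeta function (the zeros in the critical
strip `0 < β < 1`) whose ordinate `γ` lies in `[0, T]`. -/
def nontrivialZerosUpTo (T : ℝ) : Set ℂ :=
  {ρ : ℂ | riemannZeta ρ = 0 ∧ 0 < ρ.re ∧ ρ.re < 1 ∧ 0 ≤ ρ.im ∧ ρ.im ≤ T}

theorem nontrivialZerosUpTo_finite (T : ℝ) : (nontrivialZerosUpTo T).Finite := by
  have hK : IsCompact (Set.Icc (0 : ℝ) 1 ×ℂ Set.Icc (0 : ℝ) T) :=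
    isCompact_Icc.reProdIm isCompact_Icc
  refine hK.inter_riemannZetaZeros_finite.subset ?_
  rintro ρ ⟨h0, h1, h2, h3, h4⟩
  exact ⟨⟨⟨h1.le, h2.le⟩, ⟨h3, h4⟩⟩, h0⟩

/-- The zero counting function `N(T)`: the number of non-trivial zeros of the Riemann zeta
function with ordinate in `[0, T]`, each counted with its multiplicity. -/
noncomputable def zetaZeroCount (T : ℝ) : ℕ :=
  ∑ ρ ∈ (nontrivialZerosUpTo_finite T).toFinset, analyticOrderNatAt riemannZeta ρ

/-!
On the Riemann hypothesis, the deviation of `N(t + h) - N(t - h)` from its mean is, up to an error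
`log t / (2πΔ)`, the size of two Dirichlet polynomials of length `x = exp (2πΔ)` supported on prime
powers, with coefficients `O(Λ(n) / (√n log n))`; and high moments show that such polynomials are
seldom large on a set of well-spaced points.

*From zeros to Dirichlet polynomials* (`exists_abs_count_sub_le`). Beurling's function
approximates the sign function with exponential type `2π` and an error bounded by the Fejér kernel
(`abs_sign_sub_beurling_le`), so the number of zeros with ordinate in `(t - h, t + h]` is, up to a
sum of Fejér kernels over the zeros, a sum over the zeros of a band-limited function. Both sums are
evaluated with an explicit formula for weights whose Fourier transform is supported in `[-Δ, Δ]`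
(`explicit_formula`). It is derived without contour integration. Partial fractions for `ξ'/ξ`
(`tendsto_sum_zeros_logDeriv`) express `Re ξ'/ξ (2 + iu)` as the sum over the zeros of the Poisson
kernel `a / (a² + (u - γ)²)` with `a = 3 / 2`, all zeros being at the same distance from the line
`Re s = 2` (`hasSum_poisson`). Convolution with this kernel multiplies the Fourier transform at
frequency `w` by a constant times `exp (-a |w|)`. For band-limited weights it can be undone: the
weight is first multiplied by `exp (a |w|)` on the Fourier side, and the result is integrated
against the Poisson sums. On the prime side this turns `Λ(n) n ^ (-2)` into `Λ(n) n ^ (-1 / 2)`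
and cuts the sum off at `x`; the Gamma factor yields the main term `h / π * log (t / 2π)`.

*Large values* (`sum_dirSq_pow_le`). The proper prime powers contribute little
(`abs_sum_cos_le`). The `k`-th power of a Dirichlet polynomial over primes `p ≤ x` has length at
most `T` when `x ^ k ≤ T`, and a number has at most `k!` representations as an ordered product of
`k` primes. Gallagher's lemma and the mean value theorem for Dirichlet polynomials then bound the
`2k`-th moment over points of `[T, 2T]` at mutual distance at least `1` by a constant times
`T (log T) ^ 2 k! (∑ |a p| ^ 2) ^ k`, where `∑ |a p| ^ 2 ≪ ∑ 1 / p ≪ log log T`.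

*Choice of parameters.* With `x = T ^ (1 / k)` the error term `log t / (2πΔ)` is about `k`. Taking
`k` close to `(1 - 2 / log V) V`, one of the two Dirichlet polynomials has modulus at least a
constant times `V / log V` at each point, and the moment bound gives
`R ≪ T (log T) ^ 2 (C log log T (log V) ^ 2 / V) ^ k`, which is the claim.
-/

/-! ### Partial fractions for the logarithmic derivative of an even entire function -/

namespace ZetaZeroCount

open Filter Topology Metric

theorem analyticOrderAt_ne_top_of_apply_ne_zero {f : ℂ → ℂ} (hf : Differentiable ℂ f) {z₀ : ℂ}
    (h₀ : f z₀ ≠ 0) (z : ℂ) : analyticOrderAt f z ≠ ⊤ := by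
  have hA : AnalyticOnNhd ℂ f Set.univ := fun w _ => hf.analyticAt w
  refine hA.analyticOrderAt_ne_top_of_isPreconnected isPreconnected_univ (Set.mem_univ z₀)
    (Set.mem_univ z) ?_
  rw [(hf.analyticAt z₀).analyticOrderAt_eq_zero.2 h₀]
  simp

theorem finite_zeros_closedBall {f : ℂ → ℂ} (hf : Differentiable ℂ f) {z₀ : ℂ}
    (h₀ : f z₀ ≠ 0) (R : ℝ) : {ρ : ℂ | f ρ = 0 ∧ ‖ρ‖ ≤ R}.Finite := by
  have hA : AnalyticOnNhd ℂ f Set.univ := fun w _ => hf.analyticAt w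
  have h1 := hA.preimage_zero_mem_codiscrete h₀
  have h2 := (mem_codiscrete'.mp h1).2
  have hc : IsClosed (f ⁻¹' {0}) := isClosed_singleton.preimage hf.continuous
  have h3 : (closedBall (0 : ℂ) R ∩ f ⁻¹' {0}).Finite := by
    refine ((isCompact_closedBall _ _).inter_right hc).finite ?_
    refine IsDiscrete.mono ?_ Set.inter_subset_right
    simpa [Set.preimage_compl] using h2
  refine h3.subset ?_
  rintro ρ ⟨h0, h1⟩
  exact ⟨by simpa using h1, h0⟩

/-- The zero of an entire function at `ρ` can be divided out within entire functions. -/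
theorem exists_entire_eq_pow_mul {f : ℂ → ℂ} (hf : Differentiable ℂ f) {ρ : ℂ}
    (hρ : analyticOrderAt f ρ ≠ ⊤) :
    ∃ g : ℂ → ℂ, Differentiable ℂ g ∧ g ρ ≠ 0 ∧
      ∀ z, f z = (z - ρ) ^ analyticOrderNatAt f ρ * g z := by
  classical
  obtain ⟨g₀, hg₀, hne, heq⟩ := ((hf.analyticAt ρ).analyticOrderAt_ne_top).1 hρ
  set n := analyticOrderNatAt f ρ
  let g : ℂ → ℂ := fun z => if z = ρ then g₀ ρ else f z / (z - ρ) ^ n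
  have hev : g =ᶠ[𝓝 ρ] g₀ := by
    filter_upwards [heq] with z hz
    by_cases h : z = ρ
    · simp [g, h]
    · have : (z - ρ) ^ n ≠ 0 := pow_ne_zero _ (sub_ne_zero.2 h)
      simp only [g, h, if_false, hz, smul_eq_mul]
      field_simp
  refine ⟨g, ?_, by simpa [g] using hne, ?_⟩
  · intro z
    by_cases h : z = ρ
    · subst h
      exact (hg₀.differentiableAt).congr_of_eventuallyEq hev
    · have h1 : (fun w => f w / (w - ρ) ^ n) =ᶠ[𝓝 z] g := by
        filter_upwards [isOpen_ne.mem_nhds h] with w hw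
        simp only [g]
        rw [if_neg hw]
      refine DifferentiableAt.congr_of_eventuallyEq ?_ h1.symm
      exact (hf z).div (by fun_prop) (pow_ne_zero _ (sub_ne_zero.2 h))
  · intro z
    by_cases h : z = ρ
    · subst h
      have := heq.self_of_nhds
      simpa [g] using this
    · have : (z - ρ) ^ n ≠ 0 := pow_ne_zero _ (sub_ne_zero.2 h)
      simp only [g, h, if_false]
      field_simp

/-- All zeros in a finite set can be divided out within entire functions. -/
theorem exists_entire_eq_prod_mul {f : ℂ → ℂ} (hf : Differentiable ℂ f) {z₀ : ℂ}
    (h₀ : f z₀ ≠ 0) (S : Finset ℂ) :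
    ∃ g : ℂ → ℂ, Differentiable ℂ g ∧ (∀ ρ ∈ S, g ρ ≠ 0) ∧
      ∀ z, f z = (∏ ρ ∈ S, (z - ρ) ^ analyticOrderNatAt f ρ) * g z := by
  classical
  induction S using Finset.induction_on with
  | empty => exact ⟨f, hf, by simp, by simp⟩
  | insert ρ S hρ ih =>
    obtain ⟨g, hg, hgS, hfg⟩ := ih
    have hg0 : g z₀ ≠ 0 := by
      intro h
      exact h₀ (by rw [hfg, h, mul_zero])
    have htop := analyticOrderAt_ne_top_of_apply_ne_zero hg hg0 ρ
    have hP : Differentiable ℂ fun z : ℂ => ∏ ρ ∈ S, (z - ρ) ^ analyticOrderNatAt f ρ := by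
      fun_prop
    have hP0 : (∏ σ ∈ S, (ρ - σ) ^ analyticOrderNatAt f σ) ≠ 0 := by
      refine Finset.prod_ne_zero_iff.2 fun σ hσ => pow_ne_zero _ (sub_ne_zero.2 ?_)
      rintro rfl
      exact hρ hσ
    have hord : analyticOrderNatAt f ρ = analyticOrderNatAt g ρ := by
      have : f = (fun z : ℂ => ∏ σ ∈ S, (z - σ) ^ analyticOrderNatAt f σ) * g := by
        funext z
        exact hfg z
      have h1 : analyticOrderAt f ρ = analyticOrderAt g ρ := by
        conv_lhs => rw [this]
        rw [analyticOrderAt_mul (hP.analyticAt ρ) (hg.analyticAt ρ),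
          (hP.analyticAt ρ).analyticOrderAt_eq_zero.2 hP0, zero_add]
      simp only [analyticOrderNatAt, h1]
    obtain ⟨k, hk, hkρ, hgk⟩ := exists_entire_eq_pow_mul hg htop
    refine ⟨k, hk, ?_, ?_⟩
    · intro σ hσ
      rcases Finset.mem_insert.1 hσ with rfl | hσ
      · exact hkρ
      · intro h
        exact hgS σ hσ (by rw [hgk, h, mul_zero])
    · intro z
      rw [Finset.prod_insert hρ, hfg z, hgk z, hord]
      ring

theorem analyticOrderNatAt_neg_of_even {f : ℂ → ℂ} (he : ∀ z, f (-z) = f z) (ρ : ℂ) :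
    analyticOrderNatAt f (-ρ) = analyticOrderNatAt f ρ := by
  have h1 : f ∘ (fun z => -z) = f := by
    funext z
    exact he z
  have h2 : analyticOrderAt (f ∘ fun z => -z) ρ = analyticOrderAt f (-ρ) :=
    analyticOrderAt_comp_of_deriv_ne_zero (g := fun z : ℂ => -z) (by fun_prop) (by simp)
  rw [h1] at h2
  simp only [analyticOrderNatAt, h2]

/-- Dividing an even entire function by a symmetric set of zeros that contains the origin whenever
the function vanishes there leaves a function whose derivative vanishes at the origin. -/
theorem deriv_zero_of_even_quotient {f g : ℂ → ℂ} (he : ∀ z, f (-z) = f z)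
    (hg : Differentiable ℂ g) (S : Finset ℂ) (hS : ∀ ρ ∈ S, -ρ ∈ S) (hg0 : g 0 ≠ 0)
    (hfg : ∀ z, f z = (∏ ρ ∈ S, (z - ρ) ^ analyticOrderNatAt f ρ) * g z) :
    deriv g 0 = 0 := by
  classical
  set P : ℂ → ℂ := fun z => ∏ ρ ∈ S, (z - ρ) ^ analyticOrderNatAt f ρ with hPdef
  set ε : ℂ := ∏ ρ ∈ S, (-1) ^ analyticOrderNatAt f ρ with hε
  have hPneg : ∀ z, P (-z) = ε * P z := by
    intro z
    simp only [hPdef, hε]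
    rw [← Finset.prod_mul_distrib]
    refine Finset.prod_nbij' (fun ρ => -ρ) (fun ρ => -ρ) (fun ρ h => hS ρ h) (fun ρ h => hS ρ h)
      (by simp) (by simp) ?_
    intro ρ _
    rw [analyticOrderNatAt_neg_of_even he, ← mul_pow]
    congr 1
    ring
  have hPne : ∀ᶠ z in 𝓝[≠] (0 : ℂ), P z ≠ 0 := by
    have : ∀ᶠ z in 𝓝[≠] (0 : ℂ), ∀ ρ ∈ S, z ≠ ρ := by
      rw [Filter.eventually_all_finset]
      intro ρ _
      by_cases h : ρ = 0
      · subst h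
        exact self_mem_nhdsWithin
      · exact nhdsWithin_le_nhds (isOpen_ne.mem_nhds (Ne.symm h))
    filter_upwards [this] with z hz
    exact Finset.prod_ne_zero_iff.2 fun ρ hρ => pow_ne_zero _ (sub_ne_zero.2 (hz ρ hρ))
  have hrel : ∀ᶠ z in 𝓝[≠] (0 : ℂ), g z = ε * g (-z) := by
    filter_upwards [hPne] with z hz
    have h1 := he z
    rw [hfg (-z), hfg z] at h1
    change P (-z) * g (-z) = P z * g z at h1
    rw [hPneg] at h1
    have : P z * (g z - ε * g (-z)) = 0 := by linear_combination -h1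
    rcases mul_eq_zero.1 this with h | h
    · exact absurd h hz
    · exact sub_eq_zero.1 h
  have hgc : Continuous g := hg.continuous
  -- Letting `z → 0` in `g z = ε * g (-z)` fixes the sign, as `g 0 ≠ 0`.
  have hε1 : ε = 1 := by
    have t1 : Tendsto g (𝓝[≠] 0) (𝓝 (g 0)) := hgc.continuousAt.tendsto.mono_left nhdsWithin_le_nhds
    have t2 : Tendsto (fun z => ε * g (-z)) (𝓝[≠] 0) (𝓝 (ε * g (-0))) := by
      have : Continuous fun z => ε * g (-z) := by fun_prop
      exact this.continuousAt.tendsto.mono_left nhdsWithin_le_nhds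
    have t3 := tendsto_nhds_unique (t1.congr' hrel) t2
    rw [neg_zero] at t3
    have : (ε - 1) * g 0 = 0 := by linear_combination -t3
    rcases mul_eq_zero.1 this with h | h
    · exact sub_eq_zero.1 h
    · exact absurd h hg0
  have hev : (fun z => g (-z)) =ᶠ[𝓝 0] g := by
    have h1 : ∀ᶠ z in 𝓝[≠] (0 : ℂ), g (-z) = g z := by
      filter_upwards [hrel] with z hz
      rw [hz, hε1, one_mul]
    rw [eventually_nhdsWithin_iff] at h1
    filter_upwards [h1] with z hz
    by_cases h : z = 0
    · simp [h]
    · exact hz h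
  have h2 := hev.deriv_eq
  rw [deriv_comp_neg] at h2
  simp only [neg_zero] at h2
  have h3 : 2 * deriv g 0 = 0 := by linear_combination -h2
  simpa using h3

/-- If an entire function has no zeros within distance `r` of `z` and grows by a factor at most
`exp M` there, then its logarithmic derivative varies little near `z`: the bound is obtained from
the Borel–Carathéodory theorem for a logarithm of the function. -/
theorem norm_logDeriv_sub_le {g : ℂ → ℂ} (hg : Differentiable ℂ g) {z : ℂ} {r M : ℝ} (hr : 0 < r)
    (hM : 0 < M) (hne : ∀ w ∈ ball z r, g w ≠ 0)
    (hbd : ∀ w ∈ ball z r, ‖g w‖ ≤ Real.exp M * ‖g z‖) {w : ℂ} (hw : w ∈ ball z (r / 4)) :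
    ‖logDeriv g w - logDeriv g z‖ ≤ 64 * M * dist w z / r ^ 2 := by
  have hg0 : ∀ w ∈ ball (0 : ℂ) r, g (z + w) ≠ 0 := by
    intro w hw
    exact hne _ (by simpa using hw)
  have hz0 : g z ≠ 0 := hne z (mem_ball_self hr)
  have hshift : Differentiable ℂ fun w => g (z + w) := by fun_prop
  have hdshift : ∀ w, deriv (fun w => g (z + w)) w = deriv g (z + w) := by
    intro w
    exact deriv_comp_const_add _ _ _
  have hdg : Differentiable ℂ (deriv g) := by
    intro w
    exact ((hg.analyticAt w).deriv).differentiableAt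
  let k : ℂ → ℂ := fun w => deriv g (z + w) / g (z + w)
  have hkd : DifferentiableOn ℂ k (ball 0 r) := by
    intro w hw
    exact (((hdg (z + w)).comp w (by fun_prop)).div (hshift w) (hg0 w hw)).differentiableWithinAt
  obtain ⟨φ, hφ0, hφ⟩ := hkd.isExactOn_ball.with_val_at 0 0
  -- `φ` is a logarithm of `g (z + w) / g z`.
  have hexp : ∀ w ∈ ball (0 : ℂ) r, g (z + w) = g z * Complex.exp (φ w) := by
    have hconst : ∀ w ∈ ball (0 : ℂ) r,
        g (z + w) * Complex.exp (-φ w) = g (z + 0) * Complex.exp (-φ 0) := by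
      intro w hw
      refine (convex_ball (0 : ℂ) r).is_const_of_fderivWithin_eq_zero (𝕜 := ℂ)
        (f := fun w => g (z + w) * Complex.exp (-φ w)) ?_ ?_ hw (mem_ball_self hr)
      · intro w hw
        exact ((hshift w).mul ((hφ w hw).neg.cexp.differentiableAt)).differentiableWithinAt
      · intro w hw
        have hd : HasDerivAt (fun w => g (z + w) * Complex.exp (-φ w)) 0 w := by
          have h1 : HasDerivAt (fun w => g (z + w)) (deriv g (z + w)) w := by
            rw [← hdshift]
            exact (hshift w).hasDerivAt
          have h2 := h1.mul (hφ w hw).neg.cexp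
          refine h2.congr_deriv ?_
          have := hg0 w hw
          simp only [k, Pi.neg_apply]
          field_simp
          ring
        rw [fderivWithin_of_isOpen isOpen_ball hw, hd.hasFDerivAt.fderiv]
        simp
    intro w hw
    have h := hconst w hw
    rw [hφ0] at h
    simp only [add_zero, neg_zero, Complex.exp_zero, mul_one] at h
    rw [← h, mul_assoc, ← Complex.exp_add]
    simp
  have hre : Set.MapsTo φ (ball 0 r) {w | w.re ≤ M} := by
    intro w hw
    have h1 := hbd (z + w) (by simpa using hw)
    rw [hexp w hw, norm_mul, Complex.norm_exp, mul_comm] at h1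
    have h2 : Real.exp (φ w).re ≤ Real.exp M :=
      le_of_mul_le_mul_right h1 (norm_pos_iff.2 hz0)
    exact Real.exp_le_exp.1 h2
  have hφd : DifferentiableOn ℂ φ (ball 0 r) := fun w hw =>
    (hφ w hw).differentiableAt.differentiableWithinAt
  have hφb : ∀ w ∈ closedBall (0 : ℂ) (r / 2), ‖φ w‖ ≤ 2 * M := by
    intro w hw
    have hw' : ‖w‖ ≤ r / 2 := by simpa using hw
    have h1 := Complex.borelCaratheodory_zero hM hφd hre hr (z := w)
      (by simp only [mem_ball, dist_zero_right]; linarith) hφ0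
    refine h1.trans ?_
    rw [div_le_iff₀ (by linarith)]
    nlinarith
  have hkb : ∀ w ∈ ball (0 : ℂ) (r / 4), ‖k w‖ ≤ 8 * M / r := by
    intro w hw
    have hw' : ‖w‖ < r / 4 := by simpa using hw
    have hsub : closedBall w (r / 4) ⊆ closedBall 0 (r / 2) := by
      intro v hv
      simp only [mem_closedBall, dist_zero_right] at hv ⊢
      have := norm_le_norm_add_norm_sub' v w
      rw [dist_eq_norm] at hv
      linarith
    have hsub2 : closedBall (0 : ℂ) (r / 2) ⊆ ball 0 r := closedBall_subset_ball (by linarith)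
    have h1 := Complex.norm_deriv_le_of_forall_mem_sphere_norm_le (c := w) (R := r / 4)
      (C := 2 * M) (f := φ) (by positivity)
      (DifferentiableOn.diffContOnCl (by
        rw [closure_ball _ (by positivity)]
        exact hφd.mono (hsub.trans hsub2)))
      (fun v hv => hφb v (hsub (sphere_subset_closedBall hv)))
    rw [(hφ w (by simp only [mem_ball, dist_zero_right]; linarith)).deriv] at h1
    refine h1.trans (le_of_eq ?_)
    field_simp
    ring
  -- The Schwarz lemma turns the bound for `k` into a Lipschitz bound at the centre.
  have hmap : Set.MapsTo k (ball 0 (r / 4)) (closedBall (k 0) (16 * M / r)) := by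
    intro v hv
    rw [mem_closedBall, dist_eq_norm]
    refine (norm_sub_le _ _).trans ?_
    have h1 := hkb v hv
    have h2 := hkb 0 (mem_ball_self (by positivity))
    have : 16 * M / r = 8 * M / r + 8 * M / r := by ring
    linarith
  have hfin := Complex.dist_le_div_mul_dist_of_mapsTo_ball (z := w - z)
    (hkd.mono (ball_subset_ball (by linarith))) hmap
    (by simpa [dist_eq_norm] using hw)
  have e1 : k (w - z) = logDeriv g w := by simp [k, logDeriv_apply]
  have e2 : k 0 = logDeriv g z := by simp [k, logDeriv_apply]
  rw [e1, e2, dist_eq_norm, dist_zero_right, ← dist_eq_norm w z] at hfin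
  refine hfin.trans (le_of_eq ?_)
  field_simp
  ring

/-- The zeros of `f` of modulus at most `R`, as a finite set. -/
noncomputable def zerosIn {f : ℂ → ℂ} (hf : Differentiable ℂ f) {z₀ : ℂ} (h₀ : f z₀ ≠ 0) (R : ℝ) :
    Finset ℂ :=
  (finite_zeros_closedBall hf h₀ R).toFinset

theorem mem_zerosIn {f : ℂ → ℂ} (hf : Differentiable ℂ f) {z₀ : ℂ} (h₀ : f z₀ ≠ 0) (R : ℝ) (ρ : ℂ) :
    ρ ∈ zerosIn hf h₀ R ↔ f ρ = 0 ∧ ‖ρ‖ ≤ R := by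
  simp [zerosIn]

/-- **Partial fractions.** For an even entire function of order less than two, the logarithmic
derivative is the limit of the sums of `m(ρ) / (z - ρ)` over the zeros in growing discs. Once the
zeros of modulus at most `R` are divided out, the logarithmic derivative of the quotient vanishes
at the origin by evenness, and hence is `O(R ^ (3 / 2 - 2))` at `z`. -/
theorem tendsto_sum_zeros_logDeriv {f : ℂ → ℂ} (hf : Differentiable ℂ f)
    (he : ∀ z, f (-z) = f z) {C : ℝ} (hC : 0 ≤ C)
    (hgrow : ∀ R : ℝ, 1 ≤ R → ∀ z, ‖z‖ ≤ R → ‖f z‖ ≤ Real.exp (C * R ^ (3 / 2 : ℝ)))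
    {z : ℂ} (hz : f z ≠ 0) :
    Tendsto (fun R : ℝ => ∑ ρ ∈ zerosIn hf hz R, (analyticOrderNatAt f ρ : ℂ) / (z - ρ)) atTop
      (𝓝 (logDeriv f z)) := by
  set B : ℝ := |Real.log ‖f z‖| + 1 with hB
  have hmain : ∀ R : ℝ, 1 ≤ R → 16 * ‖z‖ < R →
      ‖logDeriv f z - ∑ ρ ∈ zerosIn hf hz R, (analyticOrderNatAt f ρ : ℂ) / (z - ρ)‖ ≤
        64 * (C * (4 * R) ^ (3 / 2 : ℝ) + B) * ‖z‖ / (R / 2) ^ 2 := by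
    intro R hR1 hRz
    have hzn : 0 ≤ ‖z‖ := norm_nonneg z
    set S := zerosIn hf hz R with hS
    obtain ⟨g, hg, hgS, hfg⟩ := exists_entire_eq_prod_mul hf hz S
    have hgne : ∀ w, ‖w‖ ≤ R → g w ≠ 0 := by
      intro w hw h
      have hfw : f w = 0 := by rw [hfg, h, mul_zero]
      exact hgS w ((mem_zerosIn hf hz R w).2 ⟨hfw, hw⟩) h
    have hgz : g z ≠ 0 := hgne z (by linarith)
    have hzS : ∀ ρ ∈ S, z - ρ ≠ 0 := by
      intro ρ hρ h
      rw [sub_eq_zero] at h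
      exact hz (h ▸ ((mem_zerosIn hf hz R ρ).1 hρ).1)
    have hlog : logDeriv f z = ∑ ρ ∈ S, (analyticOrderNatAt f ρ : ℂ) / (z - ρ) + logDeriv g z := by
      have h1 : f = fun z => (∏ ρ ∈ S, (z - ρ) ^ analyticOrderNatAt f ρ) * g z := funext hfg
      conv_lhs => rw [h1]
      rw [logDeriv_mul z (Finset.prod_ne_zero_iff.2 fun ρ hρ => pow_ne_zero _ (hzS ρ hρ)) hgz
        (by fun_prop) (hg z), logDeriv_prod (f := fun ρ z => (z - ρ) ^ analyticOrderNatAt f ρ)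
        (fun ρ hρ => pow_ne_zero _ (hzS ρ hρ)) (fun ρ _ => by fun_prop)]
      congr 1
      refine Finset.sum_congr rfl fun ρ _ => ?_
      rw [logDeriv_fun_pow (by fun_prop), logDeriv_apply]
      simp [div_eq_mul_inv]
    have hd0 : deriv g 0 = 0 := by
      refine deriv_zero_of_even_quotient he hg S ?_ (hgne 0 (by simp; linarith)) hfg
      intro ρ hρ
      have := (mem_zerosIn hf hz R ρ).1 hρ
      exact (mem_zerosIn hf hz R _).2 ⟨by rw [he]; exact this.1, by simpa using this.2⟩
    have hl0 : logDeriv g 0 = 0 := by rw [logDeriv_apply, hd0, zero_div]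
    rw [hlog, add_sub_cancel_left]
    have hCR : 0 ≤ C * (4 * R) ^ (3 / 2 : ℝ) := by positivity
    have hM : 0 < C * (4 * R) ^ (3 / 2 : ℝ) + B := by
      have : 0 < B := by positivity
      linarith
    -- On the circle of radius `4 R` every factor `|w - ρ|` is at least `|z - ρ|`.
    have hsphere : ∀ w ∈ sphere (0 : ℂ) (4 * R),
        ‖g w‖ ≤ Real.exp (C * (4 * R) ^ (3 / 2 : ℝ) + B) * ‖g z‖ := by
      intro w hw
      have hw' : ‖w‖ = 4 * R := by simpa using hw
      have hP : ‖∏ ρ ∈ S, (z - ρ) ^ analyticOrderNatAt f ρ‖ ≤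
          ‖∏ ρ ∈ S, (w - ρ) ^ analyticOrderNatAt f ρ‖ := by
        simp only [norm_prod, norm_pow]
        refine Finset.prod_le_prod (fun _ _ => by positivity) fun ρ hρ => ?_
        refine pow_le_pow_left₀ (norm_nonneg _) ?_ _
        have h1 : ‖ρ‖ ≤ R := ((mem_zerosIn hf hz R ρ).1 hρ).2
        have h2 := norm_sub_le z ρ
        have h3 := norm_sub_norm_le w ρ
        linarith
      have hPpos : 0 < ‖∏ ρ ∈ S, (z - ρ) ^ analyticOrderNatAt f ρ‖ :=
        norm_pos_iff.2 (Finset.prod_ne_zero_iff.2 fun ρ hρ => pow_ne_zero _ (hzS ρ hρ))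
      have h1 : ‖f w‖ ≤ Real.exp (C * (4 * R) ^ (3 / 2 : ℝ)) := hgrow _ (by linarith) w hw'.le
      have h2 : 1 ≤ Real.exp B * ‖f z‖ := by
        have h3 : 0 < ‖f z‖ := norm_pos_iff.2 hz
        rw [← Real.exp_log h3, ← Real.exp_add]
        refine Real.one_le_exp ?_
        have := neg_abs_le (Real.log ‖f z‖)
        rw [hB]
        linarith
      have h4 : ‖f w‖ ≤ Real.exp (C * (4 * R) ^ (3 / 2 : ℝ) + B) * ‖f z‖ := by
        rw [Real.exp_add, mul_assoc]
        exact h1.trans (le_mul_of_one_le_right (Real.exp_pos _).le h2)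
      rw [hfg w, hfg z, norm_mul, norm_mul] at h4
      have h5 : ‖∏ ρ ∈ S, (z - ρ) ^ analyticOrderNatAt f ρ‖ * ‖g w‖ ≤
          ‖∏ ρ ∈ S, (z - ρ) ^ analyticOrderNatAt f ρ‖ *
            (Real.exp (C * (4 * R) ^ (3 / 2 : ℝ) + B) * ‖g z‖) := by
        refine (mul_le_mul_of_nonneg_right hP (norm_nonneg _)).trans (h4.trans (le_of_eq ?_))
        ring
      exact le_of_mul_le_mul_left h5 hPpos
    have hball : ∀ w ∈ ball z (R / 2), ‖g w‖ ≤
        Real.exp (C * (4 * R) ^ (3 / 2 : ℝ) + B) * ‖g z‖ := by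
      intro w hw
      refine Complex.norm_le_of_forall_mem_frontier_norm_le (U := ball (0 : ℂ) (4 * R))
        isBounded_ball hg.diffContOnCl ?_ ?_
      · intro v hv
        rw [frontier_ball _ (by positivity)] at hv
        exact hsphere v hv
      · refine subset_closure ?_
        simp only [mem_ball, dist_eq_norm, sub_zero] at hw ⊢
        have := norm_le_norm_add_norm_sub' w z
        linarith
    -- The quotient has no zeros in the disc of radius `R / 2` about `z`, which contains the origin.
    have hfin := norm_logDeriv_sub_le hg (z := z) (r := R / 2) (by positivity) hM
      (fun w hw => hgne w (by
        simp only [mem_ball, dist_eq_norm] at hw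
        have := norm_le_norm_add_norm_sub' w z
        linarith)) hball (w := 0) (by simp; linarith)
    rw [hl0, zero_sub, norm_neg, dist_zero_left] at hfin
    exact hfin
  have hlim : Tendsto (fun R : ℝ => 64 * (C * (4 * R) ^ (3 / 2 : ℝ) + B) * ‖z‖ / (R / 2) ^ 2) atTop
      (𝓝 0) := by
    have h1 : Tendsto (fun R : ℝ => R ^ (-(1 / 2) : ℝ)) atTop (𝓝 0) :=
      tendsto_rpow_neg_atTop (by norm_num)
    have h2 : Tendsto (fun R : ℝ => R ^ (-2 : ℝ)) atTop (𝓝 0) := tendsto_rpow_neg_atTop (by norm_num)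
    have h3 := ((h1.const_mul (256 * C * 4 ^ (3 / 2 : ℝ) * ‖z‖))).add
      (h2.const_mul (256 * B * ‖z‖))
    simp only [mul_zero, add_zero] at h3
    refine h3.congr' ?_
    filter_upwards [eventually_gt_atTop 0] with R hR
    have e1 : R ^ (-(1 / 2) : ℝ) = R ^ (3 / 2 : ℝ) / R ^ 2 := by
      rw [← Real.rpow_natCast, ← Real.rpow_sub hR]
      norm_num
    have e2 : R ^ (-2 : ℝ) = 1 / R ^ 2 := by
      rw [Real.rpow_neg hR.le, one_div]
      norm_cast
    rw [e1, e2, Real.mul_rpow (by norm_num) hR.le]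
    field_simp
    ring
  rw [tendsto_iff_norm_sub_tendsto_zero]
  refine squeeze_zero' (Eventually.of_forall fun _ => norm_nonneg _) ?_ hlim
  filter_upwards [eventually_ge_atTop 1, eventually_gt_atTop (16 * ‖z‖)] with R h1 h2
  rw [norm_sub_rev]
  exact hmain R h1 h2

end ZetaZeroCount

/-! ### The Riemann `ξ`-function -/

namespace ZetaZeroCount

open Filter Topology MeasureTheory Set

/-- The entire function `ξ(s) = s (s - 1) Λ(s)`, where `Λ` is the completed zeta function
(twice the classical normalization). It is written through `Λ₀`, which is entire. -/
noncomputable def xi (s : ℂ) : ℂ := s * (s - 1) * completedRiemannZeta₀ s + 1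

theorem differentiable_xi : Differentiable ℂ xi := by
  have := differentiable_completedZeta₀
  unfold xi
  fun_prop

theorem xi_one_sub (s : ℂ) : xi (1 - s) = xi s := by
  unfold xi
  rw [completedRiemannZeta₀_one_sub]
  ring

theorem xi_eq {s : ℂ} (h0 : s ≠ 0) (h1 : s ≠ 1) : xi s = s * (s - 1) * completedRiemannZeta s := by
  have h2 : 1 - s ≠ 0 := sub_ne_zero.2 (Ne.symm h1)
  rw [xi, completedRiemannZeta_eq]
  field_simp
  ring

theorem xi_eq_mul_zeta {s : ℂ} (h0 : 0 < s.re) (h1 : s ≠ 1) :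
    xi s = s * (s - 1) * (Complex.Gammaℝ s * riemannZeta s) := by
  have hs : s ≠ 0 := by
    rintro rfl
    simp at h0
  rw [xi_eq hs h1, riemannZeta_def_of_ne_zero hs,
    mul_div_cancel₀ _ (Complex.Gammaℝ_ne_zero_of_re_pos h0)]

theorem xi_ne_zero_of_one_le_re {s : ℂ} (hs : 1 ≤ s.re) : xi s ≠ 0 := by
  by_cases h1 : s = 1
  · subst h1
    simp [xi]
  · have h0 : 0 < s.re := by linarith
    have hs0 : s ≠ 0 := by
      rintro rfl
      simp at h0
    rw [xi_eq_mul_zeta h0 h1]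
    exact mul_ne_zero (mul_ne_zero hs0 (sub_ne_zero.2 h1))
      (mul_ne_zero (Complex.Gammaℝ_ne_zero_of_re_pos h0) (riemannZeta_ne_zero_of_one_le_re hs))

theorem re_mem_of_xi_eq_zero {s : ℂ} (hs : xi s = 0) : 0 < s.re ∧ s.re < 1 := by
  constructor
  · by_contra h
    refine xi_ne_zero_of_one_le_re (s := 1 - s) ?_ (by rw [xi_one_sub, hs])
    simp only [Complex.sub_re, Complex.one_re]
    linarith
  · by_contra h
    exact xi_ne_zero_of_one_le_re (not_lt.1 h) hs

theorem xi_eq_zero_iff {s : ℂ} : xi s = 0 ↔ riemannZeta s = 0 ∧ 0 < s.re ∧ s.re < 1 := by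
  constructor
  · intro h
    obtain ⟨h0, h1⟩ := re_mem_of_xi_eq_zero h
    have hs1 : s ≠ 1 := by
      rintro rfl
      simp at h1
    have hs0 : s ≠ 0 := by
      rintro rfl
      simp at h0
    rw [xi_eq_mul_zeta h0 hs1] at h
    refine ⟨?_, h0, h1⟩
    have := Complex.Gammaℝ_ne_zero_of_re_pos h0
    simpa [hs0, sub_ne_zero.2 hs1, this] using h
  · rintro ⟨hz, h0, h1⟩
    have hs1 : s ≠ 1 := by
      rintro rfl
      simp at h1
    rw [xi_eq_mul_zeta h0 hs1, hz]
    simp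

theorem analyticOrderNatAt_xi {s : ℂ} (h0 : 0 < s.re) (h1 : s.re < 1) :
    analyticOrderNatAt xi s = analyticOrderNatAt riemannZeta s := by
  have hs1 : s ≠ 1 := by
    rintro rfl
    simp at h1
  have hs0 : s ≠ 0 := by
    rintro rfl
    simp at h0
  have hU : {z : ℂ | 0 < z.re ∧ z.re < 1} ∈ 𝓝 s := by
    refine IsOpen.mem_nhds ?_ ⟨h0, h1⟩
    exact (isOpen_lt continuous_const Complex.continuous_re).inter
      (isOpen_lt Complex.continuous_re continuous_const)
  have hz : AnalyticAt ℂ riemannZeta s := analyticOn_riemannZeta s hs1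
  have hxi : AnalyticAt ℂ xi s := differentiable_xi.analyticAt s
  -- Compare `ζ` with `ξ` times the nonvanishing analytic factor `1 / (s (s - 1) Γ_ℝ(s))`.
  have hG : AnalyticAt ℂ (fun z : ℂ => (z * (z - 1))⁻¹ * (Complex.Gammaℝ z)⁻¹) s := by
    refine AnalyticAt.mul ?_ (Complex.differentiable_Gammaℝ_inv.analyticAt s)
    exact AnalyticAt.inv (by fun_prop) (mul_ne_zero hs0 (sub_ne_zero.2 hs1))
  have hG0 : (fun z : ℂ => (z * (z - 1))⁻¹ * (Complex.Gammaℝ z)⁻¹) s ≠ 0 :=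
    mul_ne_zero (inv_ne_zero (mul_ne_zero hs0 (sub_ne_zero.2 hs1)))
      (inv_ne_zero (Complex.Gammaℝ_ne_zero_of_re_pos h0))
  have heq : riemannZeta =ᶠ[𝓝 s]
      (fun z : ℂ => (z * (z - 1))⁻¹ * (Complex.Gammaℝ z)⁻¹) * xi := by
    filter_upwards [hU] with z hz
    have hz1 : z ≠ 1 := by
      rintro rfl
      simp at hz
    have hz0 : z ≠ 0 := by
      rintro rfl
      simp at hz
    have h3 := Complex.Gammaℝ_ne_zero_of_re_pos hz.1
    have h4 := sub_ne_zero.2 hz1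
    simp only [Pi.mul_apply]
    rw [xi_eq_mul_zeta hz.1 hz1]
    field_simp
  simp only [analyticOrderNatAt]
  rw [analyticOrderAt_congr heq, analyticOrderAt_mul hG hxi, hG.analyticOrderAt_eq_zero.2 hG0,
    zero_add]

theorem re_eq_half_of_xi_eq_zero (hRH : RiemannHypothesis) {s : ℂ} (hs : xi s = 0) :
    s.re = 1 / 2 := by
  obtain ⟨hz, h0, h1⟩ := xi_eq_zero_iff.1 hs
  refine hRH s hz ?_ ?_
  · rintro ⟨n, rfl⟩
    simp only [Complex.mul_re, Complex.neg_re, Complex.re_ofNat, Complex.add_re, Complex.natCast_re,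
      Complex.one_re, Complex.neg_im, Complex.im_ofNat, Complex.add_im, Complex.natCast_im,
      Complex.one_im] at h0
    have : (0 : ℝ) ≤ n := Nat.cast_nonneg n
    linarith
  · rintro rfl
    simp at h1

/-- Bound for `Λ₀` in a half-strip, from its representation as a Mellin transform: the theta
function decays exponentially. -/
theorem exists_norm_completedRiemannZeta₀_le :
    ∃ A q : ℝ, 1 ≤ A ∧ 1 ≤ q ∧ ∀ n : ℕ, ∀ s : ℂ, 1 / 2 ≤ s.re → s.re ≤ 2 * n →
      ‖completedRiemannZeta₀ s‖ ≤ A * q ^ n * n.factorial := by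
  set P := HurwitzZeta.hurwitzEvenFEPair 0 with hP
  obtain ⟨p, hp, hO⟩ := HurwitzZeta.isBigO_atTop_evenKernel_sub 0
  simp only [if_true] at hO
  have hmod : ∀ t : ℝ, 1 < t → P.f_modif t = ((HurwitzZeta.evenKernel 0 t - 1 : ℝ) : ℂ) := by
    intro t ht
    simp only [WeakFEPair.f_modif, Pi.add_apply]
    rw [indicator_of_mem (mem_Ioi.2 ht), indicator_of_notMem (fun h => not_lt.2 ht.le h.2)]
    simp [hP, HurwitzZeta.hurwitzEvenFEPair]
  have hconv : ∀ s : ℂ, MellinConvergent P.f_modif s := fun s =>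
    (P.isStrongFEPair_toStrongFEPair.hasMellin s).1
  -- On `(0, 1]` the Mellin kernel at `s` is dominated by the one at `1 / 2`.
  have hint1 : IntegrableOn (fun t : ℝ => t ^ (-(3 / 4) : ℝ) * ‖P.f_modif t‖) (Ioi 0) := by
    have h := (hconv (1 / 4 : ℝ)).norm
    refine h.congr ?_
    filter_upwards [ae_restrict_mem measurableSet_Ioi] with t ht
    rw [norm_smul, Complex.norm_cpow_eq_rpow_re_of_pos ht]
    congr 2
    simp
    norm_num
  have hint2 : IntegrableOn (fun t : ℝ => ‖P.f_modif t‖ * Real.exp (p / 2 * t)) (Ioi 1) := by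
    have h1 : IntegrableOn (fun t : ℝ => (HurwitzZeta.evenKernel 0 t - 1) * Real.exp (p / 2 * t))
        (Ioi 1) := by
      refine integrable_of_isBigO_exp_neg (b := p / 2) (by positivity) ?_ ?_
      · have h2 : ContinuousOn (HurwitzZeta.evenKernel 0) (Ici 1) :=
          (HurwitzZeta.continuousOn_evenKernel 0).mono (fun x hx =>
            lt_of_lt_of_le (one_pos : (0 : ℝ) < 1) hx)
        exact (h2.sub continuousOn_const).mul (by fun_prop)
      · have h3 := hO.mul (Asymptotics.isBigO_refl (fun t : ℝ => Real.exp (p / 2 * t)) atTop)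
        refine h3.congr_right fun t => ?_
        rw [← Real.exp_add]
        congr 1
        ring
    refine h1.norm.congr ?_
    filter_upwards [ae_restrict_mem measurableSet_Ioi] with t ht
    rw [hmod t ht, norm_mul, Real.norm_of_nonneg (Real.exp_pos _).le, Complex.norm_real]
  set I1 := ∫ t in Ioi 0, t ^ (-(3 / 4) : ℝ) * ‖P.f_modif t‖ with hI1
  set I2 := ∫ t in Ioi 1, ‖P.f_modif t‖ * Real.exp (p / 2 * t) with hI2
  have hI1n : 0 ≤ I1 := setIntegral_nonneg measurableSet_Ioi fun t ht => by
    have : (0 : ℝ) < t := ht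
    positivity
  have hI2n : 0 ≤ I2 := setIntegral_nonneg measurableSet_Ioi fun t _ => by positivity
  refine ⟨I1 + I2 + 1, max 1 (2 / p), by linarith, le_max_left _ _, ?_⟩
  intro n s hs1 hs2
  set q := max 1 (2 / p) with hq
  have hq1 : 1 ≤ q := le_max_left _ _
  set K : ℝ := q ^ n * n.factorial with hK
  have hK1 : 1 ≤ K := by
    have h1 : 1 ≤ q ^ n := one_le_pow₀ hq1
    have h2 : (1 : ℝ) ≤ n.factorial := by exact_mod_cast Nat.succ_le_of_lt n.factorial_pos
    nlinarith
  have hpow : ∀ t : ℝ, 1 < t → t ^ ((s / 2).re - 1) ≤ K * Real.exp (p / 2 * t) := by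
    intro t ht
    have ht0 : 0 < t := by linarith
    have h1 : t ^ ((s / 2).re - 1) ≤ t ^ (n : ℝ) := by
      refine Real.rpow_le_rpow_of_exponent_le ht.le ?_
      have : (s / 2).re = s.re / 2 := by simp
      rw [this]
      linarith
    rw [Real.rpow_natCast] at h1
    have h2 := Real.pow_div_factorial_le_exp (p / 2 * t) (by positivity) n
    rw [div_le_iff₀ (by positivity)] at h2
    have h3 : t ^ n = (2 / p) ^ n * (p / 2 * t) ^ n := by
      rw [← mul_pow]
      congr 1
      field_simp
    have h4 : (2 / p) ^ n ≤ q ^ n := pow_le_pow_left₀ (by positivity) (le_max_right _ _) n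
    calc t ^ ((s / 2).re - 1) ≤ (2 / p) ^ n * (p / 2 * t) ^ n := by rw [← h3]; exact h1
      _ ≤ q ^ n * (Real.exp (p / 2 * t) * n.factorial) := by gcongr
      _ = K * Real.exp (p / 2 * t) := by rw [hK]; ring
  have hnorm : ‖P.Λ₀ (s / 2)‖ ≤ I1 + K * I2 := by
    have hg2 : IntegrableOn (fun t : ℝ => (Ioi (1 : ℝ)).indicator
        (fun t => K * (‖P.f_modif t‖ * Real.exp (p / 2 * t))) t) (Ioi 0) := by
      refine Integrable.integrableOn ?_
      rw [integrable_indicator_iff measurableSet_Ioi]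
      exact hint2.const_mul K
    have h1 : ‖P.Λ₀ (s / 2)‖ ≤ ∫ t in Ioi (0 : ℝ), (t ^ (-(3 / 4) : ℝ) * ‖P.f_modif t‖ +
        (Ioi (1 : ℝ)).indicator (fun t => K * (‖P.f_modif t‖ * Real.exp (p / 2 * t))) t) := by
      refine norm_integral_le_of_norm_le (hint1.add hg2) ?_
      filter_upwards [ae_restrict_mem measurableSet_Ioi] with t ht
      have ht0 : (0 : ℝ) < t := ht
      rw [norm_smul, Complex.norm_cpow_eq_rpow_re_of_pos ht, Complex.sub_re, Complex.one_re]
      by_cases h : 1 < t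
      · rw [indicator_of_mem (mem_Ioi.2 h)]
        have h2 : t ^ ((s / 2).re - 1) * ‖P.f_modif t‖ ≤
            K * (‖P.f_modif t‖ * Real.exp (p / 2 * t)) := by
          have := mul_le_mul_of_nonneg_right (hpow t h) (norm_nonneg (P.f_modif t))
          linarith
        have h3 : 0 ≤ t ^ (-(3 / 4) : ℝ) * ‖P.f_modif t‖ := by positivity
        linarith
      · rw [indicator_of_notMem (by simpa using h), add_zero]
        refine mul_le_mul_of_nonneg_right ?_ (norm_nonneg _)
        refine Real.rpow_le_rpow_of_exponent_ge ht0 (not_lt.1 h) ?_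
        have : (s / 2).re = s.re / 2 := by simp
        rw [this]
        linarith
    rw [integral_add hint1 hg2] at h1
    refine h1.trans (le_of_eq ?_)
    congr 1
    rw [setIntegral_indicator measurableSet_Ioi, Ioi_inter_Ioi, sup_of_le_right zero_le_one,
      integral_const_mul]
  have heq : completedRiemannZeta₀ s = P.Λ₀ (s / 2) / 2 := rfl
  rw [heq, norm_div]
  simp only [RCLike.norm_ofNat]
  have : I1 ≤ K * I1 := le_mul_of_one_le_left hI1n hK1
  have h5 : (I1 + I2 + 1) * q ^ n * n.factorial = K * I1 + K * I2 + K := by rw [hK]; ring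
  rw [h5]
  have h6 : 0 ≤ K * I2 := by positivity
  have := norm_nonneg (P.Λ₀ (s / 2))
  linarith

/-- `ξ` has order less than two. -/
theorem exists_norm_xi_le : ∃ C : ℝ, 0 ≤ C ∧ ∀ R : ℝ, 1 ≤ R → ∀ z : ℂ, ‖z‖ ≤ R →
    ‖xi (1 / 2 + z)‖ ≤ Real.exp (C * R ^ (3 / 2 : ℝ)) := by
  obtain ⟨A, q, hA, hq, hbd⟩ := exists_norm_completedRiemannZeta₀_le
  have hlogA : 0 ≤ Real.log (A + 1) := Real.log_nonneg (by linarith)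
  refine ⟨6 * (3 * q) ^ (1 / 2 : ℝ) + Real.log (A + 1) + 6, by positivity, ?_⟩
  have key : ∀ R : ℝ, 1 ≤ R → ∀ z : ℂ, ‖z‖ ≤ R → 0 ≤ z.re → ‖xi (1 / 2 + z)‖ ≤
      Real.exp ((6 * (3 * q) ^ (1 / 2 : ℝ) + Real.log (A + 1) + 6) * R ^ (3 / 2 : ℝ)) := by
    intro R hR z hz hre
    set n := ⌈R⌉₊ with hn
    have hnR : R ≤ n := Nat.le_ceil R
    have hnR' : (n : ℝ) < R + 1 := Nat.ceil_lt_add_one (by linarith)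
    have hn1 : (1 : ℝ) ≤ n := hR.trans hnR
    have hzre : z.re ≤ R := (Complex.re_le_norm z).trans hz
    have h1 := hbd n (1 / 2 + z) (by simp; linarith) (by simp; linarith)
    have hfac : q ^ n * (n.factorial : ℝ) ≤ Real.exp (6 * (3 * q) ^ (1 / 2 : ℝ) * R ^ (3 / 2 : ℝ)) := by
      have h2 : (n.factorial : ℝ) ≤ (n : ℝ) ^ n := by exact_mod_cast Nat.factorial_le_pow n
      have h3 : q ^ n * (n.factorial : ℝ) ≤ (q * n) ^ n := by
        rw [mul_pow]
        gcongr
      have h4 : Real.log (q * n) ≤ 2 * (3 * q) ^ (1 / 2 : ℝ) * R ^ (1 / 2 : ℝ) := by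
        have h5 := Real.log_le_rpow_div (x := q * n) (by positivity) (ε := 1 / 2) (by norm_num)
        have h6 : (q * n) ^ (1 / 2 : ℝ) ≤ (3 * q * R) ^ (1 / 2 : ℝ) := by
          refine Real.rpow_le_rpow (by positivity) ?_ (by norm_num)
          nlinarith
        rw [Real.mul_rpow (x := 3 * q) (y := R) (by positivity) (by positivity)] at h6
        linarith
      have h7 : (q * n) ^ n = Real.exp (n * Real.log (q * n)) := by
        rw [← Real.rpow_natCast, Real.rpow_def_of_pos (by positivity), mul_comm (n : ℝ)]
      rw [h7] at h3
      refine h3.trans (Real.exp_le_exp.2 ?_)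
      have h8 : (0 : ℝ) ≤ 2 * (3 * q) ^ (1 / 2 : ℝ) * R ^ (1 / 2 : ℝ) := by positivity
      have h9 : R ^ (3 / 2 : ℝ) = R * R ^ (1 / 2 : ℝ) := by
        rw [show (3 / 2 : ℝ) = 1 + 1 / 2 by norm_num, Real.rpow_add (by linarith), Real.rpow_one]
      rw [h9]
      calc (n : ℝ) * Real.log (q * n) ≤ n * (2 * (3 * q) ^ (1 / 2 : ℝ) * R ^ (1 / 2 : ℝ)) := by gcongr
        _ ≤ (3 * R) * (2 * (3 * q) ^ (1 / 2 : ℝ) * R ^ (1 / 2 : ℝ)) := by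
            gcongr
            linarith
        _ = _ := by ring
    have hRR : R ≤ R ^ (3 / 2 : ℝ) := by
      conv_lhs => rw [← Real.rpow_one R]
      exact Real.rpow_le_rpow_of_exponent_le hR (by norm_num)
    have hE : 1 ≤ Real.exp (6 * (3 * q) ^ (1 / 2 : ℝ) * R ^ (3 / 2 : ℝ)) :=
      Real.one_le_exp (by positivity)
    set E := Real.exp (6 * (3 * q) ^ (1 / 2 : ℝ) * R ^ (3 / 2 : ℝ)) with hEdef
    have h10 : ‖xi (1 / 2 + z)‖ ≤ (R + 2) ^ 2 * (A * E) + 1 := by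
      unfold xi
      refine (norm_add_le _ _).trans ?_
      rw [norm_one]
      gcongr
      rw [norm_mul, norm_mul]
      have e1 : ‖(1 / 2 + z : ℂ)‖ ≤ R + 2 := by
        refine (norm_add_le _ _).trans ?_
        norm_num
        linarith
      have e2 : ‖(1 / 2 + z - 1 : ℂ)‖ ≤ R + 2 := by
        refine (norm_sub_le _ _).trans ?_
        rw [norm_one]
        have := norm_add_le (1 / 2 : ℂ) z
        norm_num at this ⊢
        linarith
      have e3 : ‖completedRiemannZeta₀ (1 / 2 + z)‖ ≤ A * E := by
        refine h1.trans ?_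
        rw [mul_assoc]
        gcongr
      rw [pow_two]
      gcongr
    have h11 : (R + 2) ^ 2 * (A * E) + 1 ≤ (A + 1) * (R + 2) ^ 2 * E := by
      have : 1 ≤ (R + 2) ^ 2 * E := by nlinarith
      nlinarith
    have h12 : (A + 1) * (R + 2) ^ 2 * E ≤
        Real.exp ((6 * (3 * q) ^ (1 / 2 : ℝ) + Real.log (A + 1) + 6) * R ^ (3 / 2 : ℝ)) := by
      have e1 : A + 1 ≤ Real.exp (Real.log (A + 1) * R ^ (3 / 2 : ℝ)) := by
        conv_lhs => rw [← Real.exp_log (show 0 < A + 1 by linarith)]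
        refine Real.exp_le_exp.2 ?_
        exact le_mul_of_one_le_right hlogA (hR.trans hRR)
      have e2 : (R + 2) ^ 2 ≤ Real.exp (6 * R ^ (3 / 2 : ℝ)) := by
        have e3 : R + 2 ≤ Real.exp (3 * R ^ (3 / 2 : ℝ)) := by
          refine le_trans ?_ (Real.add_one_le_exp _)
          linarith
        have e4 : Real.exp (6 * R ^ (3 / 2 : ℝ)) = Real.exp (3 * R ^ (3 / 2 : ℝ)) ^ 2 := by
          rw [← Real.exp_nat_mul]
          congr 1
          push_cast
          ring
        rw [e4]
        exact pow_le_pow_left₀ (by linarith) e3 2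
      have e5 : Real.exp ((6 * (3 * q) ^ (1 / 2 : ℝ) + Real.log (A + 1) + 6) * R ^ (3 / 2 : ℝ)) =
          Real.exp (Real.log (A + 1) * R ^ (3 / 2 : ℝ)) * Real.exp (6 * R ^ (3 / 2 : ℝ)) * E := by
        rw [hEdef, ← Real.exp_add, ← Real.exp_add]
        congr 1
        ring
      rw [e5]
      gcongr
    exact h10.trans (h11.trans h12)
  intro R hR z hz
  rcases le_total 0 z.re with h | h
  · exact key R hR z hz h
  · have h1 := key R hR (-z) (by simpa using hz) (by simpa using h)
    rwa [show (1 / 2 + -z : ℂ) = 1 - (1 / 2 + z) by ring, xi_one_sub] at h1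

/-- The zeros of `ξ`, that is, the non-trivial zeros of the zeta function. -/
abbrev XiZero : Type := {ρ : ℂ // xi ρ = 0}

/-- The multiplicity of a zero of `ξ`. -/
noncomputable def mult (ρ : XiZero) : ℝ := analyticOrderNatAt xi ρ.1

theorem mult_nonneg (ρ : XiZero) : 0 ≤ mult ρ := Nat.cast_nonneg _

/-- The Poisson kernel `a / (a² + x²)` with `a = 3 / 2`, the distance of the line `Re s = 2` from the
critical line. -/
noncomputable def poisson (x : ℝ) : ℝ := (3 / 2) / ((3 / 2) ^ 2 + x ^ 2)

theorem poisson_pos (x : ℝ) : 0 < poisson x := by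
  unfold poisson
  positivity

/-- Under the Riemann hypothesis, the Poisson average of the ordinates of the zeros is the real
part of `ξ'/ξ` on the line `Re s = 2`. -/
theorem hasSum_poisson (hRH : RiemannHypothesis) (u : ℝ) :
    HasSum (fun ρ : XiZero => mult ρ * poisson (u - ρ.1.im))
      (logDeriv xi (2 + u * Complex.I)).re := by
  classical
  obtain ⟨C, hC, hgrow⟩ := exists_norm_xi_le
  set f : ℂ → ℂ := fun z => xi (1 / 2 + z) with hf
  have hfd : Differentiable ℂ f := by
    have := differentiable_xi
    fun_prop
  have he : ∀ z, f (-z) = f z := by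
    intro z
    simp only [hf]
    rw [← xi_one_sub]
    congr 1
    ring
  set z : ℂ := 3 / 2 + u * Complex.I with hz
  have hz2 : 1 / 2 + z = 2 + u * Complex.I := by
    rw [hz]
    ring
  have hfz : f z ≠ 0 := by
    simp only [hf]
    rw [hz2]
    refine xi_ne_zero_of_one_le_re ?_
    simp
  have hlim := tendsto_sum_zeros_logDeriv hfd he hC hgrow hfz
  have hld : logDeriv f z = logDeriv xi (2 + u * Complex.I) := by
    rw [logDeriv_apply, logDeriv_apply, ← hz2]
    congr 1
    exact deriv_comp_const_add _ _ _
  have hord : ∀ w, analyticOrderNatAt f w = analyticOrderNatAt xi (1 / 2 + w) := by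
    intro w
    have h : analyticOrderAt (xi ∘ fun w : ℂ => 1 / 2 + w) w = analyticOrderAt xi (1 / 2 + w) :=
      analyticOrderAt_comp_of_deriv_ne_zero (g := fun w : ℂ => 1 / 2 + w) (by fun_prop)
        (by simp)
    simp only [analyticOrderNatAt]
    exact congrArg ENat.toNat h
  let T : ℝ → Finset XiZero := fun R =>
    ((zerosIn hfd hfz R).image fun w : ℂ => 1 / 2 + w).subtype fun ρ => xi ρ = 0
  have hmem : ∀ R (ρ : XiZero), ρ ∈ T R ↔ ‖ρ.1 - 1 / 2‖ ≤ R := by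
    intro R ρ
    simp only [T, Finset.mem_subtype, Finset.mem_image, mem_zerosIn]
    constructor
    · rintro ⟨w, ⟨_, hw⟩, hρ⟩
      rw [← hρ]
      simpa using hw
    · intro h
      refine ⟨ρ.1 - 1 / 2, ⟨?_, h⟩, by ring⟩
      simp only [hf]
      rw [show 1 / 2 + (ρ.1 - 1 / 2) = ρ.1 by ring]
      exact ρ.2
  have hmono : Monotone T := by
    intro R R' hRR ρ hρ
    rw [hmem] at hρ ⊢
    exact hρ.trans hRR
  have hT : Tendsto T atTop atTop :=
    tendsto_atTop_finset_of_monotone hmono fun ρ => ⟨_, (hmem _ ρ).2 le_rfl⟩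
  have hsum : ∀ R, (∑ w ∈ zerosIn hfd hfz R, (analyticOrderNatAt f w : ℂ) / (z - w)).re =
      ∑ ρ ∈ T R, mult ρ * poisson (u - ρ.1.im) := by
    intro R
    rw [Complex.re_sum]
    symm
    refine Finset.sum_bij (fun (ρ : XiZero) _ => ρ.1 - 1 / 2) ?_ ?_ ?_ ?_
    · intro ρ hρ
      rw [mem_zerosIn]
      refine ⟨?_, (hmem R ρ).1 hρ⟩
      simp only [hf]
      rw [show 1 / 2 + (ρ.1 - 1 / 2) = ρ.1 by ring]
      exact ρ.2
    · intro ρ _ σ _ h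
      exact Subtype.ext (sub_left_injective h)
    · intro w hw
      rw [mem_zerosIn] at hw
      refine ⟨⟨1 / 2 + w, hw.1⟩, (hmem R _).2 (by simpa using hw.2), by simp⟩
    · intro ρ _
      rw [hord, show 1 / 2 + (ρ.1 - 1 / 2) = ρ.1 by ring, div_eq_mul_inv, ← Complex.ofReal_natCast,
        Complex.re_ofReal_mul]
      congr 1
      have hre := re_eq_half_of_xi_eq_zero hRH ρ.2
      have e1 : z - (ρ.1 - 1 / 2) = (3 / 2 : ℝ) + (u - ρ.1.im : ℝ) * Complex.I := by
        apply Complex.ext <;> simp [hz, hre]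
      rw [e1, Complex.inv_re]
      simp [poisson, Complex.normSq_apply]
      ring
  have hlim2 : Tendsto (fun R => ∑ ρ ∈ T R, mult ρ * poisson (u - ρ.1.im)) atTop
      (𝓝 (logDeriv xi (2 + u * Complex.I)).re) := by
    rw [← hld]
    simp only [← hsum]
    exact (Complex.continuous_re.tendsto _).comp hlim
  have hnn : ∀ ρ : XiZero, 0 ≤ mult ρ * poisson (u - ρ.1.im) := fun ρ =>
    mul_nonneg (mult_nonneg ρ) (poisson_pos _).le
  -- All terms are nonnegative, so convergence along growing discs is unconditional.
  have hsm : Summable fun ρ : XiZero => mult ρ * poisson (u - ρ.1.im) := by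
    refine summable_of_sum_le (c := (logDeriv xi (2 + u * Complex.I)).re) hnn fun s => ?_
    obtain ⟨R, hR⟩ := (hT.eventually_ge_atTop s).exists
    refine (Finset.sum_le_sum_of_subset_of_nonneg hR fun ρ _ _ => hnn ρ).trans ?_
    refine Monotone.ge_of_tendsto ?_ hlim2 R
    intro R R' hRR
    exact Finset.sum_le_sum_of_subset_of_nonneg (hmono hRR) fun ρ _ _ => hnn ρ
  have h := tendsto_nhds_unique (hsm.hasSum.comp hT) hlim2
  rw [← h]
  exact hsm.hasSum

end ZetaZeroCount

/-! ### The digamma function on a vertical line -/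

namespace ZetaZeroCount

open Filter Topology MeasureTheory Set

theorem norm_GammaSeq_le {z : ℂ} (h1 : 1 / 2 ≤ z.re) (h2 : z.re ≤ 3 / 2) {n : ℕ} (hn : n ≠ 0) :
    ‖Complex.GammaSeq z n‖ ≤ ∫ x in Ioi (0 : ℝ),
      (Real.exp (-x) * x ^ ((1 / 2 : ℝ) - 1) + Real.exp (-x) * x ^ ((3 / 2 : ℝ) - 1)) := by
  have hI : IntegrableOn (fun x : ℝ => Real.exp (-x) * x ^ ((1 / 2 : ℝ) - 1) +
      Real.exp (-x) * x ^ ((3 / 2 : ℝ) - 1)) (Ioi 0) :=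
    (Real.GammaIntegral_convergent (by norm_num)).add (Real.GammaIntegral_convergent (by norm_num))
  have hn0 : (0 : ℝ) ≤ n := Nat.cast_nonneg n
  rw [Complex.GammaSeq_eq_approx_Gamma_integral (by linarith) hn,
    intervalIntegral.integral_of_le hn0]
  have hsub : Ioc (0 : ℝ) n ⊆ Ioi 0 := fun x hx => hx.1
  refine (norm_integral_le_of_norm_le (hI.mono_set hsub) ?_).trans
    (setIntegral_mono_set hI ?_ hsub.eventuallyLE)
  · filter_upwards [ae_restrict_mem measurableSet_Ioc] with x hx
    have hx0 : 0 < x := hx.1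
    rw [norm_mul, Complex.norm_cpow_eq_rpow_re_of_pos hx0, Complex.norm_real, Real.norm_eq_abs,
      abs_of_nonneg (pow_nonneg (by
        have : x / n ≤ 1 := div_le_one_of_le₀ hx.2 hn0
        linarith) n), ← mul_add]
    refine mul_le_mul (Real.one_sub_div_pow_le_exp_neg hx.2) ?_ (by positivity) (by positivity)
    rw [Complex.sub_re, Complex.one_re]
    have p1 : 0 ≤ x ^ ((1 / 2 : ℝ) - 1) := by positivity
    have p2 : 0 ≤ x ^ ((3 / 2 : ℝ) - 1) := by positivity
    rcases le_total x 1 with h | h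
    · have := Real.rpow_le_rpow_of_exponent_ge hx0 h (by linarith : (1 / 2 : ℝ) - 1 ≤ z.re - 1)
      linarith
    · have := Real.rpow_le_rpow_of_exponent_le h (by linarith : z.re - 1 ≤ (3 / 2 : ℝ) - 1)
      linarith
  · filter_upwards [ae_restrict_mem measurableSet_Ioi] with x hx
    have hx0 : (0 : ℝ) < x := hx
    simp only [Pi.zero_apply]
    positivity

theorem add_natCast_ne_zero_of_re_pos {s : ℂ} (hs : 0 < s.re) (j : ℕ) : s + j ≠ 0 := by
  intro h
  have := congrArg Complex.re h
  simp only [Complex.add_re, Complex.natCast_re, Complex.zero_re] at this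
  have : (0 : ℝ) ≤ j := Nat.cast_nonneg j
  linarith

theorem hasDerivAt_GammaSeq {s : ℂ} (hs : 0 < s.re) {n : ℕ} (hn : n ≠ 0) :
    HasDerivAt (fun z => Complex.GammaSeq z n)
      (Complex.GammaSeq s n * (Real.log n - ∑ j ∈ Finset.range (n + 1), 1 / (s + j))) s := by
  have hP0 : ∀ j ∈ Finset.range (n + 1), s + (j : ℂ) ≠ 0 := fun j _ =>
    add_natCast_ne_zero_of_re_pos hs j
  have hP := Finset.prod_ne_zero_iff.2 hP0
  have hnn : (n : ℂ) ≠ 0 := Nat.cast_ne_zero.2 hn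
  have hd : DifferentiableAt ℂ (fun z : ℂ => ∏ j ∈ Finset.range (n + 1), (z + (j : ℂ))) s := by
    fun_prop
  have hld : logDeriv (fun z : ℂ => ∏ j ∈ Finset.range (n + 1), (z + (j : ℂ))) s =
      ∑ j ∈ Finset.range (n + 1), 1 / (s + j) := by
    rw [logDeriv_prod (f := fun (j : ℕ) (z : ℂ) => z + j) hP0 (fun _ _ => by fun_prop)]
    refine Finset.sum_congr rfl fun j _ => ?_
    simp [logDeriv_apply]
  rw [logDeriv_apply, div_eq_iff hP] at hld
  have h1 : HasDerivAt (fun z : ℂ => (n : ℂ) ^ z * (n.factorial : ℂ))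
      ((n : ℂ) ^ s * Complex.log n * 1 * n.factorial) s :=
    ((hasDerivAt_id s).const_cpow (Or.inl hnn)).mul_const _
  have h2 := h1.div hd.hasDerivAt hP
  refine h2.congr_deriv ?_
  rw [hld]
  simp only [Complex.GammaSeq, Complex.natCast_log]
  field_simp

/-- Euler's limit for the digamma function on the line `Re s = 1`. It follows from Euler's limit for
`Γ` by dominated convergence in Cauchy's formula for the derivative. -/
theorem tendsto_digamma {s : ℂ} (hs : s.re = 1) :
    Tendsto (fun n : ℕ => (Real.log n : ℂ) - ∑ j ∈ Finset.range (n + 1), 1 / (s + j)) atTop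
      (𝓝 (Complex.digamma s)) := by
  have hball : ∀ z ∈ Metric.closedBall s (1 / 2), 1 / 2 ≤ z.re ∧ z.re ≤ 3 / 2 := by
    intro z hz
    rw [Metric.mem_closedBall, dist_eq_norm] at hz
    have h1 := (Complex.abs_re_le_norm (z - s)).trans hz
    rw [Complex.sub_re, hs, abs_le] at h1
    constructor <;> linarith
  have hdG : ∀ z : ℂ, 1 / 2 ≤ z.re → DifferentiableAt ℂ Complex.Gamma z := by
    intro z hz
    refine Complex.differentiableAt_Gamma z fun m hm => ?_
    rw [hm] at hz
    simp only [Complex.neg_re, Complex.natCast_re] at hz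
    have : (0 : ℝ) ≤ m := Nat.cast_nonneg m
    linarith
  set B := ∫ x in Ioi (0 : ℝ),
      (Real.exp (-x) * x ^ ((1 / 2 : ℝ) - 1) + Real.exp (-x) * x ^ ((3 / 2 : ℝ) - 1)) with hB
  have hcirc : Tendsto (fun n : ℕ => ∮ z in C(s, 1 / 2), (1 / (z - s) ^ 2) • Complex.GammaSeq z n)
      atTop (𝓝 (∮ z in C(s, 1 / 2), (1 / (z - s) ^ 2) • Complex.Gamma z)) := by
    unfold circleIntegral
    have hnorm : ∀ θ : ℝ, ‖circleMap s (1 / 2) θ - s‖ = 1 / 2 := by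
      intro θ
      rw [circleMap_sub_center, norm_circleMap_zero]
      norm_num
    refine intervalIntegral.tendsto_integral_filter_of_dominated_convergence
      (fun _ => 1 / 2 * (4 * B)) ?_ ?_ (by simp) ?_
    · filter_upwards [eventually_ne_atTop 0] with n hn
      refine Continuous.aestronglyMeasurable ?_
      refine Continuous.fun_smul ?_ (Continuous.fun_smul ?_ ?_)
      · rw [show deriv (circleMap s (1 / 2)) = fun θ => circleMap 0 (1 / 2) θ * Complex.I from
          funext fun θ => deriv_circleMap _ _ _]
        fun_prop
      · refine Continuous.div continuous_const (by fun_prop) fun θ => ?_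
        refine pow_ne_zero _ (norm_ne_zero_iff.1 ?_)
        rw [hnorm]
        norm_num
      · rw [continuous_iff_continuousAt]
        intro θ
        have hz := hball (circleMap s (1 / 2) θ)
          (by rw [Metric.mem_closedBall, dist_eq_norm, hnorm])
        exact (hasDerivAt_GammaSeq (by linarith) hn).continuousAt.comp (f := circleMap s (1 / 2))
          (continuous_circleMap s (1 / 2)).continuousAt
    · filter_upwards [eventually_ne_atTop 0] with n hn
      refine Eventually.of_forall fun θ _ => ?_
      have hz := hball (circleMap s (1 / 2) θ)
        (by rw [Metric.mem_closedBall, dist_eq_norm, hnorm])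
      have hb := norm_GammaSeq_le hz.1 hz.2 hn
      rw [norm_smul, norm_smul, norm_div, norm_pow, hnorm, norm_one, deriv_circleMap, norm_mul,
        Complex.norm_I, norm_circleMap_zero]
      norm_num
      linarith
    · refine Eventually.of_forall fun θ _ => ?_
      exact ((Complex.GammaSeq_tendsto_Gamma _).const_smul _).const_smul _
  have hderiv : Tendsto (fun n : ℕ => deriv (fun z => Complex.GammaSeq z n) s) atTop
      (𝓝 (deriv Complex.Gamma s)) := by
    have hπ : (2 * Real.pi * Complex.I : ℂ) ≠ 0 := by simp [Real.pi_ne_zero]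
    have hsub : closure (Metric.ball s (1 / 2)) ⊆ Metric.closedBall s (1 / 2) :=
      Metric.closure_ball_subset_closedBall
    have e1 : (2 * Real.pi * Complex.I : ℂ)⁻¹ •
        (∮ z in C(s, 1 / 2), (1 / (z - s) ^ 2) • Complex.Gamma z) = deriv Complex.Gamma s := by
      rw [DiffContOnCl.deriv_eq_smul_circleIntegral (by norm_num)
        (DifferentiableOn.diffContOnCl fun z hz =>
          (hdG z (hball z (hsub hz)).1).differentiableWithinAt), inv_smul_smul₀ hπ]
    rw [← e1]
    refine (hcirc.const_smul _).congr' ?_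
    filter_upwards [eventually_ne_atTop 0] with n hn
    rw [DiffContOnCl.deriv_eq_smul_circleIntegral (by norm_num)
      (DifferentiableOn.diffContOnCl fun z hz =>
        (hasDerivAt_GammaSeq (by linarith [(hball z (hsub hz)).1])
          hn).differentiableAt.differentiableWithinAt), inv_smul_smul₀ hπ]
  have hG0 : Complex.Gamma s ≠ 0 := Complex.Gamma_ne_zero_of_re_pos (by linarith)
  have hq := hderiv.div (Complex.GammaSeq_tendsto_Gamma s) hG0
  rw [Complex.digamma_def, logDeriv_apply]
  refine hq.congr' ?_
  filter_upwards [eventually_ne_atTop 0, (Complex.GammaSeq_tendsto_Gamma s).eventually_ne hG0]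
    with n hn hne
  simp only [Pi.div_apply]
  rw [(hasDerivAt_GammaSeq (by linarith) hn).deriv, mul_div_cancel_left₀ _ hne]

/-- Each increment `log ‖s + j + 1‖ - log ‖s + j‖` is `Re 1 / (s + j)` up to a quadratic error, and
the errors are dominated by a telescoping sum. -/
theorem abs_re_digamma_sub_log_norm_le {τ : ℝ} (hτ : 1 ≤ |τ|) :
    |(Complex.digamma (1 + τ * Complex.I)).re - Real.log ‖(1 + τ * Complex.I : ℂ)‖| ≤ 4 / |τ| := by
  set s : ℂ := 1 + τ * Complex.I with hs
  have hre : s.re = 1 := by simp [hs]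
  have him : s.im = τ := by simp [hs]
  have hτ0 : 0 < |τ| := by linarith
  have hne : ∀ j : ℕ, s + j ≠ 0 := fun j => add_natCast_ne_zero_of_re_pos (by rw [hre]; norm_num) j
  have hnsq : ∀ j : ℕ, ‖s + j‖ ^ 2 = (1 + j) ^ 2 + |τ| ^ 2 := by
    intro j
    rw [← Complex.normSq_eq_norm_sq, Complex.normSq_apply, sq_abs]
    simp [hre, him]
    ring
  have hterm : ∀ j : ℕ, |Real.log ‖s + (j + 1 : ℕ)‖ - Real.log ‖s + j‖ - (1 / (s + j)).re| ≤
      4 * (1 / (j + |τ|) - 1 / ((j + 1 : ℕ) + |τ|)) := by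
    intro j
    have hj : (0 : ℝ) ≤ j := Nat.cast_nonneg j
    set w : ℂ := 1 / (s + j) with hw
    have hwn : ‖w‖ ^ 2 = 1 / ((1 + j) ^ 2 + |τ| ^ 2) := by
      rw [hw, norm_div, norm_one, div_pow, one_pow, hnsq]
    have hw34 : ‖w‖ ≤ 3 / 4 := by
      have h1 : ‖w‖ ^ 2 ≤ (3 / 4) ^ 2 := by
        rw [hwn, div_le_iff₀ (by positivity)]
        nlinarith
      exact le_of_sq_le_sq h1 (by norm_num)
    have h1 := Complex.norm_log_one_add_sub_self_le (z := w) (by linarith)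
    have h2 : 1 + w = (s + (j + 1 : ℕ)) / (s + j) := by
      have := hne j
      rw [hw]
      push_cast
      field_simp
      ring
    have h3 : (Complex.log (1 + w)).re = Real.log ‖s + (j + 1 : ℕ)‖ - Real.log ‖s + j‖ := by
      rw [Complex.log_re, h2, norm_div, Real.log_div (norm_ne_zero_iff.2 (hne _))
        (norm_ne_zero_iff.2 (hne _))]
    have h4 := (Complex.abs_re_le_norm (Complex.log (1 + w) - w)).trans h1
    rw [Complex.sub_re, h3] at h4
    refine h4.trans ?_
    have h5 : (1 - ‖w‖)⁻¹ ≤ 4 := by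
      rw [inv_le_comm₀ (by linarith) (by norm_num)]
      linarith
    have h6 : ‖w‖ ^ 2 * (1 - ‖w‖)⁻¹ / 2 ≤ 2 * ‖w‖ ^ 2 := by
      have := mul_le_mul_of_nonneg_left h5 (sq_nonneg ‖w‖)
      linarith
    refine h6.trans ?_
    rw [hwn]
    have h7 : 4 * (1 / ((j : ℝ) + |τ|) - 1 / (((j + 1 : ℕ) : ℝ) + |τ|)) =
        4 / ((j + |τ|) * (j + 1 + |τ|)) := by
      push_cast
      field_simp
      ring
    rw [h7, mul_one_div, div_le_div_iff₀ (by positivity) (by positivity)]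
    nlinarith [sq_nonneg (j + 1 - |τ|)]
  have hpart : ∀ n : ℕ, |Real.log ‖s + (n : ℕ)‖ - Real.log ‖s‖ -
      ∑ j ∈ Finset.range n, (1 / (s + j)).re| ≤ 4 / |τ| := by
    intro n
    have e1 : Real.log ‖s + (n : ℕ)‖ - Real.log ‖s‖ - ∑ j ∈ Finset.range n, (1 / (s + j)).re =
        ∑ j ∈ Finset.range n,
          (Real.log ‖s + (j + 1 : ℕ)‖ - Real.log ‖s + j‖ - (1 / (s + j)).re) := by
      rw [Finset.sum_sub_distrib, Finset.sum_range_sub (fun j : ℕ => Real.log ‖s + j‖)]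
      simp
    rw [e1]
    refine (Finset.abs_sum_le_sum_abs _ _).trans ((Finset.sum_le_sum fun j _ => hterm j).trans ?_)
    rw [← Finset.mul_sum, Finset.sum_range_sub' (fun j : ℕ => 1 / ((j : ℝ) + |τ|))]
    have : 0 ≤ 1 / ((n : ℝ) + |τ|) := by positivity
    have e2 : 4 / |τ| = 4 * (1 / |τ|) := by ring
    rw [e2]
    simp only [CharP.cast_eq_zero, zero_add]
    linarith
  have hlim := (Complex.continuous_re.tendsto _).comp (tendsto_digamma hre)
  have hlog : Tendsto (fun n : ℕ => Real.log ‖s + ((n + 1 : ℕ) : ℂ)‖ - Real.log n) atTop (𝓝 0) := by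
    have h1 : Tendsto (fun n : ℕ => ‖(s + 1) * ((n : ℂ))⁻¹ + 1‖) atTop (𝓝 ‖(s + 1) * 0 + 1‖) :=
      ((tendsto_inv_atTop_nhds_zero_nat (𝕜 := ℂ)).const_mul _ |>.add_const 1).norm
    have h2 := h1.log (by simp)
    simp only [mul_zero, zero_add, norm_one, Real.log_one] at h2
    refine h2.congr' ?_
    filter_upwards [eventually_gt_atTop 0] with n hn
    have hn0 : (n : ℂ) ≠ 0 := Nat.cast_ne_zero.2 hn.ne'
    have hnr : ‖(n : ℂ)‖ = n := Complex.norm_natCast n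
    have e : (s + 1) * ((n : ℂ))⁻¹ + 1 = (s + ((n + 1 : ℕ) : ℂ)) / n := by
      push_cast
      field_simp
      ring
    rw [e, norm_div, hnr, Real.log_div (norm_ne_zero_iff.2 (hne _)) (Nat.cast_ne_zero.2 hn.ne')]
  have hfin : Tendsto (fun n : ℕ => Real.log ‖s + ((n + 1 : ℕ) : ℂ)‖ - Real.log ‖s‖ -
      ∑ j ∈ Finset.range (n + 1), (1 / (s + j)).re) atTop
      (𝓝 ((Complex.digamma s).re - Real.log ‖s‖)) := by
    have h := (hlim.add hlog).sub_const (Real.log ‖s‖)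
    rw [add_zero] at h
    refine h.congr fun n => ?_
    simp only [Function.comp_apply, Complex.sub_re, Complex.ofReal_re, Complex.re_sum]
    ring
  refine le_of_tendsto hfin.abs (Eventually.of_forall fun n => ?_)
  exact hpart (n + 1)

/-- The contribution of the pole and the Gamma factor to `Re ξ'/ξ` on the line `Re s = 2`. -/
noncomputable def archimedean (u : ℝ) : ℝ :=
  (logDeriv xi (2 + u * Complex.I)).re - (logDeriv riemannZeta (2 + u * Complex.I)).re

theorem two_add_mul_I_ne_one (u : ℝ) : (2 + u * Complex.I : ℂ) ≠ 1 := by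
  intro h
  have := congrArg Complex.re h
  simp at this

theorem zeta_two_add_ne_zero (u : ℝ) : riemannZeta (2 + u * Complex.I) ≠ 0 :=
  riemannZeta_ne_zero_of_one_le_re (by simp)

theorem continuous_logDeriv_xi : Continuous fun u : ℝ => logDeriv xi (2 + u * Complex.I) := by
  have h1 : Continuous (deriv xi) := by
    have : Differentiable ℂ (deriv xi) := fun z =>
      ((differentiable_xi.analyticAt z).deriv).differentiableAt
    exact this.continuous
  simp only [logDeriv_apply]
  refine Continuous.div (h1.comp (by fun_prop)) (differentiable_xi.continuous.comp (by fun_prop))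
    fun u => ?_
  exact xi_ne_zero_of_one_le_re (by simp)

theorem continuous_logDeriv_zeta :
    Continuous fun u : ℝ => logDeriv riemannZeta (2 + u * Complex.I) := by
  rw [continuous_iff_continuousAt]
  intro u
  have hA := analyticOn_riemannZeta _ (two_add_mul_I_ne_one u)
  have h1 : ContinuousAt (fun v : ℝ => (2 + v * Complex.I : ℂ)) u := by fun_prop
  exact ContinuousAt.comp (f := fun v : ℝ => (2 + v * Complex.I : ℂ)) (g := logDeriv riemannZeta)
    (hA.deriv.continuousAt.div hA.continuousAt (zeta_two_add_ne_zero u)) h1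

theorem continuous_archimedean : Continuous archimedean := by
  unfold archimedean
  exact (Complex.continuous_re.comp continuous_logDeriv_xi).sub
    (Complex.continuous_re.comp continuous_logDeriv_zeta)

theorem archimedean_eq (u : ℝ) : archimedean u =
    (1 / (2 + u * Complex.I)).re + (1 / (1 + u * Complex.I)).re - Real.log Real.pi / 2 +
      (Complex.digamma (1 + (u / 2 : ℝ) * Complex.I)).re / 2 := by
  set s : ℂ := 2 + u * Complex.I with hs
  have hre : s.re = 2 := by simp [hs]
  have hs1 : s ≠ 1 := two_add_mul_I_ne_one u
  have hs0 : s ≠ 0 := by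
    intro h
    rw [h] at hre
    simp at hre
  have hU : {z : ℂ | 0 < z.re ∧ z ≠ 1} ∈ 𝓝 s := by
    refine IsOpen.mem_nhds ?_ ⟨by rw [hre]; norm_num, hs1⟩
    exact (isOpen_lt continuous_const Complex.continuous_re).inter isOpen_ne
  have heq : xi =ᶠ[𝓝 s] fun z => (z * (z - 1)) * (Complex.Gammaℝ z * riemannZeta z) := by
    filter_upwards [hU] with z hz
    exact xi_eq_mul_zeta hz.1 hz.2
  have hG0 : Complex.Gammaℝ s ≠ 0 := Complex.Gammaℝ_ne_zero_of_re_pos (by rw [hre]; norm_num)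
  have hs2 : s / 2 = 1 + (u / 2 : ℝ) * Complex.I := by
    rw [hs]
    push_cast
    ring
  have hGd : DifferentiableAt ℂ Complex.Gamma (s / 2) := by
    refine Complex.differentiableAt_Gamma _ fun m hm => ?_
    have := congrArg Complex.re hm
    rw [hs2] at this
    simp at this
    have : (0 : ℝ) ≤ m := Nat.cast_nonneg m
    linarith
  have hΓ2 : Complex.Gamma (s / 2) ≠ 0 := Complex.Gamma_ne_zero_of_re_pos (by rw [hs2]; simp)
  have hπ : (Real.pi : ℂ) ≠ 0 := by exact_mod_cast Real.pi_ne_zero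
  have hd1 : HasDerivAt (fun z : ℂ => (Real.pi : ℂ) ^ (-z / 2))
      ((Real.pi : ℂ) ^ (-s / 2) * Complex.log Real.pi * (-1 / 2)) s := by
    have : HasDerivAt (fun z : ℂ => -z / 2) (-1 / 2) s := ((hasDerivAt_id s).neg).div_const 2
    exact this.const_cpow (Or.inl hπ)
  have hd2 : HasDerivAt (fun z : ℂ => Complex.Gamma (z / 2))
      (deriv Complex.Gamma (s / 2) * (1 / 2)) s := by
    have : HasDerivAt (fun z : ℂ => z / 2) (1 / 2) s := (hasDerivAt_id s).div_const 2
    exact hGd.hasDerivAt.comp s this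
  have hGfun : Complex.Gammaℝ = fun z => (Real.pi : ℂ) ^ (-z / 2) * Complex.Gamma (z / 2) := by
    funext z
    exact Complex.Gammaℝ_def z
  have hpi0 : (Real.pi : ℂ) ^ (-s / 2) ≠ 0 := by
    simp [Complex.cpow_eq_zero_iff, hπ]
  have hGdiff : DifferentiableAt ℂ Complex.Gammaℝ s := by
    rw [hGfun]
    exact (hd1.mul hd2).differentiableAt
  have hlG : logDeriv Complex.Gammaℝ s = -Complex.log Real.pi / 2 + Complex.digamma (s / 2) / 2 := by
    rw [hGfun, logDeriv_mul s hpi0 hΓ2 hd1.differentiableAt hd2.differentiableAt,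
      logDeriv_apply, logDeriv_apply, hd1.deriv, hd2.deriv, Complex.digamma_def, logDeriv_apply]
    field_simp
  have hz := (analyticOn_riemannZeta s hs1).differentiableAt
  have hl : logDeriv xi s = 1 / s + 1 / (s - 1) + (logDeriv Complex.Gammaℝ s +
      logDeriv riemannZeta s) := by
    rw [(logDeriv_congr_nhds heq).self_of_nhds,
      logDeriv_mul (f := fun z : ℂ => z * (z - 1)) (g := fun z => Complex.Gammaℝ z * riemannZeta z) s
        (mul_ne_zero hs0 (sub_ne_zero.2 hs1)) (mul_ne_zero hG0 (zeta_two_add_ne_zero u))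
        (by fun_prop) (hGdiff.mul hz),
      logDeriv_mul s hG0 (zeta_two_add_ne_zero u) hGdiff hz,
      logDeriv_mul (f := fun z : ℂ => z) (g := fun z : ℂ => z - 1) s hs0 (sub_ne_zero.2 hs1)
        (by fun_prop) (by fun_prop)]
    congr 1
    simp [logDeriv_apply]
  have hs1' : s - 1 = 1 + u * Complex.I := by
    rw [hs]
    ring
  rw [archimedean, ← hs, hl, hlG, hs1', hs2, ← Complex.ofReal_log Real.pi_pos.le]
  simp only [Complex.add_re, Complex.div_ofNat_re, Complex.neg_re, Complex.ofReal_re]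
  ring

/-- The archimedean contribution is `½ log (|u| / 2π)` up to `O(1 / |u|)`. -/
theorem exists_abs_archimedean_sub_le : ∃ C : ℝ, 0 ≤ C ∧ ∀ u : ℝ,
    |archimedean u - Real.log ((1 + |u|) / (2 * Real.pi)) / 2| ≤ C / (1 + |u|) := by
  have hcont : Continuous fun u : ℝ =>
      (1 + |u|) * (archimedean u - Real.log ((1 + |u|) / (2 * Real.pi)) / 2) := by
    have := continuous_archimedean
    refine Continuous.mul (by fun_prop) (this.sub (Continuous.div_const (Continuous.log
      (by fun_prop) fun u => ?_) _))
    have := Real.pi_pos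
    positivity
  obtain ⟨C₁, hC₁⟩ := (isCompact_Icc (a := (-2 : ℝ)) (b := 2)).exists_bound_of_continuousOn
    hcont.continuousOn
  refine ⟨max C₁ 30, le_max_of_le_right (by norm_num), fun u => ?_⟩
  have hu1 : 0 < 1 + |u| := by positivity
  rcases le_total |u| 2 with h | h
  · have h1 := hC₁ u (abs_le.1 h)
    rw [Real.norm_eq_abs, abs_mul, abs_of_pos hu1] at h1
    rw [le_div_iff₀ hu1, mul_comm]
    exact h1.trans (le_max_left _ _)
  · have hu0 : 0 < |u| := by linarith
    have hτ : |u / 2| = |u| / 2 := by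
      rw [abs_div, abs_two]
    have h1 := abs_re_digamma_sub_log_norm_le (τ := u / 2) (by rw [hτ]; linarith)
    rw [hτ] at h1
    set s : ℂ := 1 + (u / 2 : ℝ) * Complex.I with hs
    have hup : ‖s‖ ≤ 1 + |u| / 2 := by
      refine (norm_add_le _ _).trans ?_
      rw [norm_one, norm_mul, Complex.norm_I, mul_one, Complex.norm_real, Real.norm_eq_abs, hτ]
    have hlow : |u| / 2 ≤ ‖s‖ := by
      have := Complex.abs_im_le_norm s
      have him : s.im = u / 2 := by simp [hs]
      rwa [him, hτ] at this
    have hlog : |Real.log ‖s‖ - Real.log ((1 + |u|) / 2)| ≤ 1 / |u| := by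
      have p0 : 0 < ‖s‖ := by linarith
      have l1 : Real.log ‖s‖ - Real.log ((1 + |u|) / 2) ≤ 1 / |u| := by
        rw [← Real.log_div p0.ne' (by positivity)]
        refine (Real.log_le_sub_one_of_pos (by positivity)).trans ?_
        rw [sub_le_iff_le_add, div_le_iff₀ (by positivity)]
        have : (1 / |u| + 1) * ((1 + |u|) / 2) = 1 + |u| / 2 + 1 / (2 * |u|) := by
          field_simp
          ring
        rw [this]
        have : 0 ≤ 1 / (2 * |u|) := by positivity
        linarith
      have l2 : Real.log ((1 + |u|) / 2) - Real.log ‖s‖ ≤ 1 / |u| := by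
        rw [← Real.log_div (by positivity) p0.ne']
        refine (Real.log_le_sub_one_of_pos (by positivity)).trans ?_
        rw [sub_le_iff_le_add, div_le_iff₀ p0]
        have : (1 / |u| + 1) * (|u| / 2) = (1 + |u|) / 2 := by
          field_simp
        rw [← this]
        gcongr
      rw [abs_le]
      constructor <;> linarith
    have hinv : ∀ a : ℝ, 1 ≤ a → |(1 / (a + u * Complex.I : ℂ)).re| ≤ 1 / |u| := by
      intro a _
      refine (Complex.abs_re_le_norm _).trans ?_
      rw [norm_div, norm_one]
      refine one_div_le_one_div_of_le hu0 ?_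
      have := Complex.abs_im_le_norm (a + u * Complex.I : ℂ)
      simpa using this
    have i1 := hinv 1 le_rfl
    have i2 := hinv 2 (by norm_num)
    rw [Complex.ofReal_one] at i1
    rw [Complex.ofReal_ofNat] at i2
    rw [archimedean_eq, ← hs]
    have e1 : Real.log ((1 + |u|) / (2 * Real.pi)) =
        Real.log ((1 + |u|) / 2) - Real.log Real.pi := by
      rw [← Real.log_div (by positivity) Real.pi_ne_zero, div_div]
    rw [e1]
    have h2 : 4 / (|u| / 2) = 8 * (1 / |u|) := by
      field_simp
      norm_num
    rw [h2] at h1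
    rw [abs_le] at h1 hlog i1 i2
    have h3 : 1 / |u| ≤ 2 / (1 + |u|) := by
      rw [div_le_div_iff₀ hu0 hu1]
      linarith
    have h4 : max C₁ 30 / (1 + |u|) = max C₁ 30 / 2 * (2 / (1 + |u|)) := by
      field_simp
    have h5 : 15 * (2 / (1 + |u|)) ≤ max C₁ 30 / 2 * (2 / (1 + |u|)) := by
      refine mul_le_mul_of_nonneg_right ?_ (by positivity)
      have := le_max_right C₁ 30
      linarith
    rw [h4, abs_le]
    constructor <;> linarith [h1.1, h1.2, hlog.1, hlog.2, i1.1, i1.2, i2.1, i2.2]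

end ZetaZeroCount

/-! ### Cosine transforms -/

namespace ZetaZeroCount

open Filter Topology MeasureTheory Set

/-- Fourier inversion for even real functions. -/
theorem integral_cos_transform_mul_cos {Ψ : ℝ → ℝ} (hc : Continuous Ψ) (he : ∀ x, Ψ (-x) = Ψ x)
    (hi : Integrable Ψ) (hF : Integrable fun y => ∫ ξ, Ψ ξ * Real.cos (2 * Real.pi * y * ξ))
    (θ : ℝ) :
    ∫ y, (∫ ξ, Ψ ξ * Real.cos (2 * Real.pi * y * ξ)) * Real.cos (2 * Real.pi * y * θ) = Ψ θ := by
  have hgen : ∀ (g : ℝ → ℝ), Integrable g → (∀ x, g (-x) = g x) → ∀ (ε : ℝ), (ε = 1 ∨ ε = -1) →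
      ∀ y : ℝ, ∫ v : ℝ, Complex.exp ((ε * (2 * Real.pi * y * v) : ℝ) * Complex.I) • (g v : ℂ) =
      ((∫ v, g v * Real.cos (2 * Real.pi * y * v) : ℝ) : ℂ) := by
    intro g hg hge ε hε y
    have i1 : Integrable fun v => g v * Real.cos (2 * Real.pi * y * v) :=
      hg.mul_bdd (c := 1) (by fun_prop) (Eventually.of_forall fun v => Real.abs_cos_le_one _)
    have i2 : Integrable fun v => g v * Real.sin (2 * Real.pi * y * v) :=
      hg.mul_bdd (c := 1) (by fun_prop) (Eventually.of_forall fun v => Real.abs_sin_le_one _)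
    have hodd : ∫ v, g v * Real.sin (2 * Real.pi * y * v) = 0 := by
      have h := integral_neg_eq_self (fun v => g v * Real.sin (2 * Real.pi * y * v)) volume
      simp only [hge, mul_neg, Real.sin_neg, integral_neg] at h
      linarith
    have e1 : ∀ v : ℝ, Complex.exp ((ε * (2 * Real.pi * y * v) : ℝ) * Complex.I) • (g v : ℂ) =
        ((g v * Real.cos (2 * Real.pi * y * v) : ℝ) : ℂ) +
          ((g v * Real.sin (2 * Real.pi * y * v) : ℝ) : ℂ) * (ε * Complex.I) := by
      intro v
      rw [Complex.exp_mul_I, ← Complex.ofReal_cos, ← Complex.ofReal_sin, smul_eq_mul]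
      rcases hε with rfl | rfl
      · push_cast
        ring_nf
      · rw [show (-1 * (2 * Real.pi * y * v) : ℝ) = -(2 * Real.pi * y * v) by ring, Real.cos_neg,
          Real.sin_neg]
        push_cast
        ring
    simp_rw [e1]
    rw [integral_add i1.ofReal (i2.ofReal.mul_const _), integral_mul_const,
      integral_complex_ofReal, integral_complex_ofReal, hodd]
    simp
  have h1 : FourierTransform.fourier (fun x => (Ψ x : ℂ)) =
      fun y => ((∫ ξ, Ψ ξ * Real.cos (2 * Real.pi * y * ξ) : ℝ) : ℂ) := by
    funext y
    rw [Real.fourier_real_eq_integral_exp_smul, ← hgen Ψ hi he (-1) (Or.inr rfl) y]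
    refine integral_congr_ae (Eventually.of_forall fun v => ?_)
    simp only
    congr 3
    push_cast
    ring
  have hinv := Continuous.fourierInv_fourier_eq (f := fun x => (Ψ x : ℂ))
    (Complex.continuous_ofReal.comp hc) hi.ofReal (by rw [h1]; exact hF.ofReal)
  have h2 := congrFun hinv θ
  rw [h1, Real.fourierInv_eq'] at h2
  have h3 := hgen _ hF (by
    intro y
    simp only [mul_neg, neg_mul, Real.cos_neg]) 1 (Or.inl rfl) θ
  have h4 : (∫ y, (∫ ξ, Ψ ξ * Real.cos (2 * Real.pi * y * ξ)) * Real.cos (2 * Real.pi * y * θ)) =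
      ∫ y, (∫ ξ, Ψ ξ * Real.cos (2 * Real.pi * y * ξ)) * Real.cos (2 * Real.pi * θ * y) := by
    refine integral_congr_ae (Eventually.of_forall fun v => ?_)
    simp only
    congr 2
    ring
  rw [h4, ← Complex.ofReal_inj, ← h3, ← h2]
  refine integral_congr_ae (Eventually.of_forall fun v => ?_)
  simp only
  congr 3
  rw [show inner ℝ v θ = θ * v by simp]
  push_cast
  ring

theorem integrable_exp_neg_mul_abs {c : ℝ} (hc : 0 < c) :
    Integrable fun x : ℝ => Real.exp (-c * |x|) := by
  rw [← integrableOn_univ, ← Iic_union_Ioi (a := (0 : ℝ))]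
  refine IntegrableOn.union ?_ ?_
  · refine (integrableOn_exp_mul_Iic hc 0).congr_fun (fun x hx => ?_) measurableSet_Iic
    simp only
    rw [abs_of_nonpos hx]
    ring_nf
  · refine (exp_neg_integrableOn_Ioi 0 hc).congr_fun (fun x hx => ?_) measurableSet_Ioi
    simp only
    rw [abs_of_pos hx]

theorem integral_exp_neg_mul_abs_mul_cos {c : ℝ} (hc : 0 < c) (w : ℝ) :
    ∫ x : ℝ, Real.exp (-c * |x|) * Real.cos (w * x) = 2 * c / (c ^ 2 + w ^ 2) := by
  have h0 : ∀ x : ℝ, Real.exp (-c * |x|) * Real.cos (w * x) =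
      (fun x => Real.exp (-c * x) * Real.cos (w * x)) |x| := by
    intro x
    simp only
    rw [← Real.cos_abs (w * |x|), ← Real.cos_abs (w * x), abs_mul, abs_mul, abs_abs]
  simp_rw [h0]
  rw [integral_comp_abs (f := fun x => Real.exp (-c * x) * Real.cos (w * x))]
  have h1 := integral_exp_mul_complex_Ioi (a := (-c : ℝ) + (w : ℝ) * Complex.I) (by simp [hc]) 0
  have hre : ∀ x : ℝ, Real.exp (-c * x) * Real.cos (w * x) =
      RCLike.re (Complex.exp (((-c : ℝ) + (w : ℝ) * Complex.I) * x)) := by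
    intro x
    simp only [RCLike.re_eq_complex_re]
    rw [Complex.exp_re]
    simp
  have hint : IntegrableOn (fun x : ℝ => Complex.exp (((-c : ℝ) + (w : ℝ) * Complex.I) * x))
      (Ioi 0) := by
    refine (integrable_norm_iff (by fun_prop)).1 ?_
    refine (exp_neg_integrableOn_Ioi 0 hc).congr_fun (fun x _ => ?_) measurableSet_Ioi
    simp only
    rw [Complex.norm_exp]
    simp
  simp_rw [hre]
  rw [integral_re hint, h1]
  simp only [Complex.ofReal_zero, mul_zero, Complex.exp_zero, RCLike.re_eq_complex_re]
  rw [neg_div, Complex.neg_re, one_div, Complex.inv_re]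
  have h2 : Complex.normSq ((-c : ℝ) + (w : ℝ) * Complex.I) = c ^ 2 + w ^ 2 := by
    simp [Complex.normSq_apply]
    ring
  rw [h2]
  simp
  ring

theorem continuous_poisson : Continuous poisson := by
  unfold poisson
  exact Continuous.div continuous_const (by fun_prop) fun x => by positivity

theorem poisson_le (x : ℝ) : poisson x ≤ (3 / 2) * (1 + x ^ 2)⁻¹ := by
  unfold poisson
  rw [div_eq_mul_inv]
  gcongr
  norm_num

theorem integrable_poisson : Integrable poisson := by
  refine (integrable_inv_one_add_sq.const_mul (3 / 2)).mono'
    continuous_poisson.aestronglyMeasurable (Eventually.of_forall fun x => ?_)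
  rw [Real.norm_of_nonneg (poisson_pos x).le]
  exact poisson_le x

/-- The Fourier transform of the Poisson kernel. -/
theorem integral_poisson_mul_cos (w : ℝ) :
    ∫ x, poisson x * Real.cos (w * x) = Real.pi * Real.exp (-(3 / 2) * |w|) := by
  have hπ := Real.pi_pos
  have hc : (0 : ℝ) < 3 * Real.pi := by positivity
  have hC : ∀ y : ℝ, (∫ ξ, Real.exp (-(3 * Real.pi) * |ξ|) * Real.cos (2 * Real.pi * y * ξ)) =
      Real.pi⁻¹ * poisson y := by
    intro y
    rw [integral_exp_neg_mul_abs_mul_cos hc, poisson]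
    field_simp
  have h := integral_cos_transform_mul_cos (Ψ := fun ξ => Real.exp (-(3 * Real.pi) * |ξ|))
    (by fun_prop) (by simp) (integrable_exp_neg_mul_abs hc)
    (by simp_rw [hC]; exact integrable_poisson.const_mul _) (w / (2 * Real.pi))
  simp_rw [hC, mul_assoc] at h
  rw [integral_const_mul, inv_mul_eq_iff_eq_mul₀ hπ.ne'] at h
  have e1 : ∫ x, poisson x * Real.cos (w * x) =
      ∫ x, poisson x * Real.cos (2 * (Real.pi * (x * (w / (2 * Real.pi))))) := by
    refine integral_congr_ae (Eventually.of_forall fun v => ?_)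
    simp only
    congr 2
    field_simp
  rw [e1, h]
  congr 2
  rw [abs_div, abs_of_pos (show 0 < 2 * Real.pi by positivity)]
  field_simp

/-- The cosine transform of a function on `[0, 1]`, extended to an even function on `[-1, 1]`. -/
noncomputable def cosT (ψ : ℝ → ℝ) (y : ℝ) : ℝ :=
  ∫ ξ in (0 : ℝ)..1, 2 * ψ ξ * Real.cos (2 * Real.pi * y * ξ)

/-- The even extension of a function on `[0, 1]` which is constant outside `[-1, 1]`. -/
noncomputable def fold (ψ : ℝ → ℝ) (ξ : ℝ) : ℝ := ψ (min |ξ| 1)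

theorem fold_of_mem {ψ : ℝ → ℝ} {ξ : ℝ} (h : ξ ∈ Icc (0 : ℝ) 1) : fold ψ ξ = ψ ξ := by
  rw [fold, abs_of_nonneg h.1, min_eq_left h.2]

theorem fold_of_one_le {ψ : ℝ → ℝ} (h1 : ψ 1 = 0) {ξ : ℝ} (h : 1 ≤ |ξ|) : fold ψ ξ = 0 := by
  rw [fold, min_eq_right h, h1]

theorem continuous_fold {ψ : ℝ → ℝ} (hc : ContinuousOn ψ (Icc 0 1)) : Continuous (fold ψ) := by
  refine hc.comp_continuous (by fun_prop) fun ξ => ⟨?_, min_le_right _ _⟩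
  exact le_min (abs_nonneg _) zero_le_one

theorem cosT_eq_fold (ψ : ℝ → ℝ) (y : ℝ) : cosT ψ y =
    ∫ ξ in (0 : ℝ)..1, 2 * fold ψ ξ * Real.cos (2 * Real.pi * y * ξ) := by
  refine intervalIntegral.integral_congr fun ξ hξ => ?_
  rw [uIcc_of_le zero_le_one] at hξ
  rw [fold_of_mem hξ]

theorem continuous_cosT {ψ : ℝ → ℝ} (hc : ContinuousOn ψ (Icc 0 1)) : Continuous (cosT ψ) := by
  have h := continuous_fold hc
  have h1 : cosT ψ = fun y => ∫ ξ in (0 : ℝ)..1, 2 * fold ψ ξ * Real.cos (2 * Real.pi * y * ξ) :=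
    funext (cosT_eq_fold ψ)
  rw [h1]
  refine intervalIntegral.continuous_parametric_intervalIntegral_of_continuous' ?_ 0 1
  unfold Function.uncurry
  fun_prop

theorem cosT_neg (ψ : ℝ → ℝ) (y : ℝ) : cosT ψ (-y) = cosT ψ y := by
  simp only [cosT, mul_neg, neg_mul, Real.cos_neg]

theorem integrable_fold {ψ : ℝ → ℝ} (hc : ContinuousOn ψ (Icc 0 1)) (h1 : ψ 1 = 0) :
    Integrable (fold ψ) := by
  refine (continuous_fold hc).integrable_of_hasCompactSupport ?_
  refine HasCompactSupport.of_support_subset_isCompact (isCompact_Icc (a := (-1 : ℝ)) (b := 1)) ?_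
  intro ξ hξ
  by_contra h
  refine hξ (fold_of_one_le h1 ?_)
  by_contra h2
  exact h (abs_le.1 (not_le.1 h2).le)

theorem integral_fold_mul_cos {ψ : ℝ → ℝ} (h1 : ψ 1 = 0) (y : ℝ) :
    ∫ ξ, fold ψ ξ * Real.cos (2 * Real.pi * y * ξ) = cosT ψ y := by
  have h0 : ∀ ξ : ℝ, fold ψ ξ * Real.cos (2 * Real.pi * y * ξ) =
      (fun ξ => fold ψ ξ * Real.cos (2 * Real.pi * y * ξ)) |ξ| := by
    intro ξ
    simp only [fold, abs_abs]
    congr 1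
    rw [← Real.cos_abs (2 * Real.pi * y * |ξ|), ← Real.cos_abs (2 * Real.pi * y * ξ), abs_mul,
      abs_mul _ |ξ|, abs_abs]
  rw [integral_congr_ae (Eventually.of_forall h0),
    integral_comp_abs (f := fun ξ => fold ψ ξ * Real.cos (2 * Real.pi * y * ξ)), cosT_eq_fold,
    intervalIntegral.integral_of_le zero_le_one, ← integral_const_mul]
  rw [setIntegral_eq_of_subset_of_forall_sdiff_eq_zero measurableSet_Ioi
    (show Ioc (0 : ℝ) 1 ⊆ Ioi 0 from Ioc_subset_Ioi_self) (fun ξ hξ => ?_)]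
  · refine setIntegral_congr_fun measurableSet_Ioc fun ξ _ => ?_
    ring
  · have hξ0 : (0 : ℝ) < ξ := hξ.1
    have hξ1 : 1 < ξ := by
      by_contra h
      exact hξ.2 ⟨hξ0, not_lt.1 h⟩
    rw [fold_of_one_le h1 (by rw [abs_of_pos hξ0]; exact hξ1.le)]
    ring

/-- Fourier inversion for cosine transforms. -/
theorem integral_cosT_mul_cos {ψ : ℝ → ℝ} (hc : ContinuousOn ψ (Icc 0 1)) (h1 : ψ 1 = 0)
    (hi : Integrable (cosT ψ)) (θ : ℝ) :
    ∫ y, cosT ψ y * Real.cos (2 * Real.pi * y * θ) = fold ψ θ := by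
  have h := integral_cos_transform_mul_cos (continuous_fold hc) (fun x => by simp [fold])
    (integrable_fold hc h1) (by simp_rw [integral_fold_mul_cos h1]; exact hi) θ
  simp_rw [integral_fold_mul_cos h1] at h
  exact h

/-- The decay of the cosine transform of a function with two derivatives, by two integrations by
parts. -/
theorem abs_cosT_le {ψ : ℝ → ℝ} {M : ℝ} (hψ : ∀ ξ ∈ Icc (0 : ℝ) 1, ContDiffAt ℝ 2 ψ ξ)
    (h1 : ψ 1 = 0) (hM0 : ∀ ξ ∈ Icc (0 : ℝ) 1, |ψ ξ| ≤ M)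
    (hM1 : ∀ ξ ∈ Icc (0 : ℝ) 1, |deriv ψ ξ| ≤ M)
    (hM2 : ∀ ξ ∈ Icc (0 : ℝ) 1, |deriv (deriv ψ) ξ| ≤ M) (y : ℝ) :
    |cosT ψ y| ≤ 3 * M * (1 + y ^ 2)⁻¹ := by
  have hd1 : ∀ ξ ∈ Icc (0 : ℝ) 1, ContDiffAt ℝ 1 (deriv ψ) ξ := fun ξ hξ =>
    (hψ ξ hξ).derivWithin (by norm_num)
  have hd2 : ∀ ξ ∈ Icc (0 : ℝ) 1, ContDiffAt ℝ 0 (deriv (deriv ψ)) ξ := fun ξ hξ =>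
    (hd1 ξ hξ).derivWithin (by norm_num)
  have hu : uIcc (0 : ℝ) 1 = Icc 0 1 := uIcc_of_le zero_le_one
  have hM : 0 ≤ M := (abs_nonneg _).trans (hM0 0 (by simp))
  have hD1 : ∀ ξ ∈ uIcc (0 : ℝ) 1, HasDerivAt ψ (deriv ψ ξ) ξ := fun ξ hξ =>
    ((hψ ξ (hu ▸ hξ)).differentiableAt (by norm_num)).hasDerivAt
  have hD2 : ∀ ξ ∈ uIcc (0 : ℝ) 1, HasDerivAt (deriv ψ) (deriv (deriv ψ) ξ) ξ := fun ξ hξ =>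
    ((hd1 ξ (hu ▸ hξ)).differentiableAt (by norm_num)).hasDerivAt
  have hi1 : IntervalIntegrable (deriv ψ) volume 0 1 :=
    ContinuousOn.intervalIntegrable fun ξ hξ => (hd1 ξ (hu ▸ hξ)).continuousAt.continuousWithinAt
  have hi2 : IntervalIntegrable (deriv (deriv ψ)) volume 0 1 :=
    ContinuousOn.intervalIntegrable fun ξ hξ => (hd2 ξ (hu ▸ hξ)).continuousAt.continuousWithinAt
  have hb1 : |cosT ψ y| ≤ 2 * M := by
    have h := intervalIntegral.norm_integral_le_of_norm_le_const (a := (0 : ℝ)) (b := 1)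
      (C := 2 * M) (f := fun ξ => 2 * ψ ξ * Real.cos (2 * Real.pi * y * ξ)) (fun ξ hξ => by
        rw [uIoc_of_le zero_le_one] at hξ
        rw [Real.norm_eq_abs, abs_mul, abs_mul, abs_two]
        have e1 := hM0 ξ ⟨hξ.1.le, hξ.2⟩
        have e2 := Real.abs_cos_le_one (2 * Real.pi * y * ξ)
        calc 2 * |ψ ξ| * |Real.cos (2 * Real.pi * y * ξ)| ≤ 2 * M * 1 := by gcongr
          _ = 2 * M := mul_one _)
    simpa [cosT] using h
  have hb2 : y ^ 2 * |cosT ψ y| ≤ M := by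
    rcases eq_or_ne y 0 with rfl | hy
    · simpa using hM
    set w := 2 * Real.pi * y with hw
    have hw0 : w ≠ 0 := by
      have := Real.pi_ne_zero
      positivity
    have hs : ∀ ξ : ℝ, HasDerivAt (fun ξ => Real.sin (w * ξ) / w) (Real.cos (w * ξ)) ξ := by
      intro ξ
      have h := (((hasDerivAt_id ξ).const_mul w).sin).div_const w
      refine h.congr_deriv ?_
      simp only [id]
      field_simp
    have hcs : ∀ ξ : ℝ, HasDerivAt (fun ξ => -Real.cos (w * ξ) / w ^ 2) (Real.sin (w * ξ) / w) ξ := by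
      intro ξ
      have h := ((((hasDerivAt_id ξ).const_mul w).cos).neg).div_const (w ^ 2)
      refine h.congr_deriv ?_
      simp only [id]
      field_simp
    have p1 := intervalIntegral.integral_mul_deriv_eq_deriv_mul hD1 (fun ξ _ => hs ξ) hi1
      (Continuous.intervalIntegrable (by fun_prop) 0 1)
    have p2 := intervalIntegral.integral_mul_deriv_eq_deriv_mul hD2 (fun ξ _ => hcs ξ) hi2
      (Continuous.intervalIntegrable (by fun_prop) 0 1)
    rw [h1, p2] at p1
    have e0 : cosT ψ y = 2 * ∫ ξ in (0 : ℝ)..1, ψ ξ * Real.cos (w * ξ) := by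
      rw [cosT, ← intervalIntegral.integral_const_mul]
      refine intervalIntegral.integral_congr fun ξ _ => ?_
      ring
    rw [p1] at e0
    have hI : |∫ ξ in (0 : ℝ)..1, deriv (deriv ψ) ξ * (-Real.cos (w * ξ) / w ^ 2)| ≤ M / w ^ 2 := by
      have h := intervalIntegral.norm_integral_le_of_norm_le_const (a := (0 : ℝ)) (b := 1)
        (C := M / w ^ 2) (f := fun ξ => deriv (deriv ψ) ξ * (-Real.cos (w * ξ) / w ^ 2))
        (fun ξ hξ => by
          rw [uIoc_of_le zero_le_one] at hξ
          rw [Real.norm_eq_abs, abs_mul, abs_div, abs_neg, abs_of_pos (show 0 < w ^ 2 by positivity)]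
          have e1 := hM2 ξ ⟨hξ.1.le, hξ.2⟩
          have e2 := Real.abs_cos_le_one (w * ξ)
          calc _ ≤ M * (1 / w ^ 2) := by gcongr
            _ = M / w ^ 2 := by ring)
      simpa using h
    have a1 := hM1 0 (by simp)
    have a2 := hM1 1 (by simp)
    have c1 := Real.abs_cos_le_one (w * 1)
    set I := ∫ ξ in (0 : ℝ)..1, deriv (deriv ψ) ξ * (-Real.cos (w * ξ) / w ^ 2)
    have e1 : w ^ 2 * cosT ψ y = 2 * (deriv ψ 1 * Real.cos (w * 1) - deriv ψ 0) + 2 * (w ^ 2 * I) := by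
      rw [e0]
      simp only [mul_zero, Real.sin_zero, zero_div, Real.cos_zero, zero_mul]
      field_simp
      ring
    have e2 : |w ^ 2 * I| ≤ M := by
      rw [abs_mul, abs_of_pos (show 0 < w ^ 2 by positivity)]
      calc w ^ 2 * |I| ≤ w ^ 2 * (M / w ^ 2) := by gcongr
        _ = M := by field_simp
    have e3 : |w ^ 2 * cosT ψ y| ≤ 6 * M := by
      rw [e1]
      have e4 : |deriv ψ 1 * Real.cos (w * 1)| ≤ M := by
        rw [abs_mul]
        calc _ ≤ M * 1 := by gcongr
          _ = M := mul_one _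
      rw [abs_le] at *
      constructor <;> linarith [e4.1, e4.2, a1.1, a1.2, e2.1, e2.2]
    rw [abs_mul, abs_of_pos (show 0 < w ^ 2 by positivity), hw, mul_pow, mul_assoc] at e3
    have h36 : 6 ≤ (2 * Real.pi) ^ 2 := by nlinarith [Real.pi_gt_three]
    have : 0 ≤ y ^ 2 * |cosT ψ y| := by positivity
    nlinarith
  rw [← div_eq_mul_inv, le_div_iff₀ (by positivity)]
  nlinarith

theorem exists_bound_of_contDiffAt {ψ : ℝ → ℝ} (hψ : ∀ ξ ∈ Icc (0 : ℝ) 1, ContDiffAt ℝ 2 ψ ξ) :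
    ∃ M : ℝ, 0 ≤ M ∧ (∀ ξ ∈ Icc (0 : ℝ) 1, |ψ ξ| ≤ M) ∧ (∀ ξ ∈ Icc (0 : ℝ) 1, |deriv ψ ξ| ≤ M) ∧
      ∀ ξ ∈ Icc (0 : ℝ) 1, |deriv (deriv ψ) ξ| ≤ M := by
  have hd1 : ∀ ξ ∈ Icc (0 : ℝ) 1, ContDiffAt ℝ 1 (deriv ψ) ξ := fun ξ hξ =>
    (hψ ξ hξ).derivWithin (by norm_num)
  have hd2 : ∀ ξ ∈ Icc (0 : ℝ) 1, ContDiffAt ℝ 0 (deriv (deriv ψ)) ξ := fun ξ hξ =>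
    (hd1 ξ hξ).derivWithin (by norm_num)
  obtain ⟨M0, h0⟩ := (isCompact_Icc (a := (0 : ℝ)) (b := 1)).exists_bound_of_continuousOn
    (f := ψ) fun ξ hξ => (hψ ξ hξ).continuousAt.continuousWithinAt
  obtain ⟨M1, h1⟩ := (isCompact_Icc (a := (0 : ℝ)) (b := 1)).exists_bound_of_continuousOn
    (f := deriv ψ) fun ξ hξ => (hd1 ξ hξ).continuousAt.continuousWithinAt
  obtain ⟨M2, h2⟩ := (isCompact_Icc (a := (0 : ℝ)) (b := 1)).exists_bound_of_continuousOn
    (f := deriv (deriv ψ)) fun ξ hξ => (hd2 ξ hξ).continuousAt.continuousWithinAt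
  have z : (0 : ℝ) ∈ Icc (0 : ℝ) 1 := by simp
  have n0 := (norm_nonneg _).trans (h0 0 z)
  have n1 := (norm_nonneg _).trans (h1 0 z)
  have n2 := (norm_nonneg _).trans (h2 0 z)
  refine ⟨M0 + M1 + M2, by linarith, fun ξ hξ => ?_, fun ξ hξ => ?_, fun ξ hξ => ?_⟩
  · have := h0 ξ hξ
    rw [Real.norm_eq_abs] at this
    linarith
  · have := h1 ξ hξ
    rw [Real.norm_eq_abs] at this
    linarith
  · have := h2 ξ hξ
    rw [Real.norm_eq_abs] at this
    linarith

/-- The weight `ψ(ξ) e^{b ξ}`; the exponential compensates for the Poisson kernel. -/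
noncomputable def expW (ψ : ℝ → ℝ) (b : ℝ) (ξ : ℝ) : ℝ := ψ ξ * Real.exp (b * ξ)

theorem expW_zero (ψ : ℝ → ℝ) : expW ψ 0 = ψ := by
  funext ξ
  simp [expW]

theorem contDiffAt_expW {ψ : ℝ → ℝ} {ξ : ℝ} (hψ : ContDiffAt ℝ 2 ψ ξ) (b : ℝ) :
    ContDiffAt ℝ 2 (expW ψ b) ξ := by
  unfold expW
  exact hψ.mul (by fun_prop)

theorem expW_one {ψ : ℝ → ℝ} (h1 : ψ 1 = 0) (b : ℝ) : expW ψ b 1 = 0 := by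
  simp [expW, h1]

/-- Uniformity in `b` matters here: each of the two derivatives costs a factor `1 + b`. -/
theorem exists_abs_cosT_expW_le {ψ : ℝ → ℝ} (hψ : ∀ ξ ∈ Icc (0 : ℝ) 1, ContDiffAt ℝ 2 ψ ξ)
    (h1 : ψ 1 = 0) : ∃ A : ℝ, 0 ≤ A ∧ ∀ b : ℝ, 0 ≤ b → ∀ y,
      |cosT (expW ψ b) y| ≤ A * ((1 + b) ^ 2 * Real.exp b) * (1 + y ^ 2)⁻¹ := by
  obtain ⟨M, hM, h0, hd, hdd⟩ := exists_bound_of_contDiffAt hψ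
  refine ⟨3 * M, by positivity, fun b hb y => ?_⟩
  have hder : ∀ φ : ℝ → ℝ, ∀ ξ, DifferentiableAt ℝ φ ξ →
      deriv (expW φ b) ξ = expW (fun ξ => deriv φ ξ + b * φ ξ) b ξ := by
    intro φ ξ hφ
    have h : HasDerivAt (expW φ b) (deriv φ ξ * Real.exp (b * ξ) +
        φ ξ * (Real.exp (b * ξ) * (b * 1))) ξ :=
      hφ.hasDerivAt.mul ((hasDerivAt_id ξ).const_mul b).exp
    rw [h.deriv, expW]
    ring
  have hdiff : ∀ ξ ∈ Icc (0 : ℝ) 1, ∀ᶠ x in 𝓝 ξ, DifferentiableAt ℝ ψ x := by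
    intro ξ hξ
    filter_upwards [(hψ ξ hξ).eventually (by norm_num)] with x hx
    exact hx.differentiableAt (by norm_num)
  have hexp : ∀ ξ ∈ Icc (0 : ℝ) 1, Real.exp (b * ξ) ≤ Real.exp b := by
    intro ξ hξ
    exact Real.exp_le_exp.2 (mul_le_of_le_one_right hb hξ.2)
  have hgen : ∀ (φ : ℝ → ℝ) (K : ℝ) (ξ : ℝ), ξ ∈ Icc (0 : ℝ) 1 → |φ ξ| ≤ M * K → 0 ≤ K →
      K ≤ (1 + b) ^ 2 → |expW φ b ξ| ≤ M * ((1 + b) ^ 2 * Real.exp b) := by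
    intro φ K ξ hξ hφ hK hKb
    rw [expW, abs_mul, Real.abs_exp, ← mul_assoc]
    refine mul_le_mul (hφ.trans (by gcongr)) (hexp ξ hξ) (Real.exp_pos _).le (by positivity)
  have hmain := abs_cosT_le (ψ := expW ψ b) (M := M * ((1 + b) ^ 2 * Real.exp b))
    (fun ξ hξ => contDiffAt_expW (hψ ξ hξ) b) (expW_one h1 b) ?_ ?_ ?_ y
  · refine hmain.trans (le_of_eq ?_)
    ring
  · intro ξ hξ
    exact hgen ψ 1 ξ hξ (by simpa using h0 ξ hξ) zero_le_one (by nlinarith)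
  · intro ξ hξ
    rw [hder ψ ξ (hdiff ξ hξ).self_of_nhds]
    refine hgen _ (1 + b) ξ hξ ?_ (by linarith) (by nlinarith)
    refine (abs_add_le _ _).trans ?_
    rw [abs_mul, abs_of_nonneg hb]
    have := h0 ξ hξ
    have := hd ξ hξ
    nlinarith
  · intro ξ hξ
    have hev : deriv (expW ψ b) =ᶠ[𝓝 ξ] expW (fun ξ => deriv ψ ξ + b * ψ ξ) b := by
      filter_upwards [hdiff ξ hξ] with x hx
      exact hder ψ x hx
    have hdd1 : DifferentiableAt ℝ (deriv ψ) ξ :=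
      ((hψ ξ hξ).derivWithin (m := 1) (by norm_num)).differentiableAt (by norm_num)
    have hd0 := (hdiff ξ hξ).self_of_nhds
    have hs : DifferentiableAt ℝ (fun ξ => deriv ψ ξ + b * ψ ξ) ξ := hdd1.add (hd0.const_mul b)
    have hds : deriv (fun ξ => deriv ψ ξ + b * ψ ξ) ξ = deriv (deriv ψ) ξ + b * deriv ψ ξ :=
      (hdd1.hasDerivAt.add (hd0.hasDerivAt.const_mul b)).deriv
    rw [hev.deriv_eq, hder _ ξ hs]
    refine hgen _ ((1 + b) ^ 2) ξ hξ ?_ (by positivity) le_rfl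
    rw [hds]
    have q0 := h0 ξ hξ
    have q1 := hd ξ hξ
    have q2 := hdd ξ hξ
    have e : deriv (deriv ψ) ξ + b * deriv ψ ξ + b * (deriv ψ ξ + b * ψ ξ) =
        deriv (deriv ψ) ξ + (2 * b) * deriv ψ ξ + (b * b) * ψ ξ := by ring
    rw [e]
    refine (abs_add_three _ _ _).trans ?_
    rw [abs_mul (2 * b), abs_mul (b * b), abs_of_nonneg (show 0 ≤ 2 * b by positivity),
      abs_of_nonneg (show 0 ≤ b * b by positivity)]
    have r1 : 2 * b * |deriv ψ ξ| ≤ 2 * b * M := by gcongr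
    have r2 : b * b * |ψ ξ| ≤ b * b * M := by gcongr
    nlinarith

theorem continuousOn_of_contDiffAt {ψ : ℝ → ℝ} (hψ : ∀ ξ ∈ Icc (0 : ℝ) 1, ContDiffAt ℝ 2 ψ ξ) :
    ContinuousOn ψ (Icc 0 1) := fun ξ hξ => (hψ ξ hξ).continuousAt.continuousWithinAt

theorem integrable_cosT_expW {ψ : ℝ → ℝ} (hψ : ∀ ξ ∈ Icc (0 : ℝ) 1, ContDiffAt ℝ 2 ψ ξ)
    (h1 : ψ 1 = 0) {b : ℝ} (hb : 0 ≤ b) : Integrable (cosT (expW ψ b)) := by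
  obtain ⟨A, hA, h⟩ := exists_abs_cosT_expW_le hψ h1
  refine (integrable_inv_one_add_sq.const_mul (A * ((1 + b) ^ 2 * Real.exp b))).mono'
    (continuous_cosT (continuousOn_of_contDiffAt fun ξ hξ =>
      contDiffAt_expW (hψ ξ hξ) b)).aestronglyMeasurable (Eventually.of_forall fun y => ?_)
  exact h b hb y

/-- Convolution with the Poisson kernel multiplies the cosine transform by an exponential. The
constant `3πΔ` is `3 / 2` times `2πΔ`, the frequency that corresponds to `ξ = 1`. -/
theorem integral_cosT_expW_mul_poisson {ψ : ℝ → ℝ} (hψ : ContinuousOn ψ (Icc 0 1)) {Δ : ℝ}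
    (hΔ : 0 ≤ Δ) (x : ℝ) :
    ∫ v, cosT (expW ψ (3 * Real.pi * Δ)) (Δ * v) * poisson (x - v) =
      Real.pi * cosT ψ (Δ * x) := by
  have hπ := Real.pi_pos
  set b := 3 * Real.pi * Δ with hb
  have hW : ContinuousOn (expW ψ b) (Icc 0 1) := by
    unfold expW
    exact hψ.mul (by fun_prop)
  have hWc := continuous_fold hW
  obtain ⟨M, hM⟩ := (isCompact_Icc (a := (0 : ℝ)) (b := 1)).exists_bound_of_continuousOn
    hWc.continuousOn
  -- The convolution is computed by exchanging the two integrals.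
  have h1 : ∀ v, cosT (expW ψ b) (Δ * v) * poisson (x - v) = ∫ ξ in Ioc (0 : ℝ) 1,
      2 * fold (expW ψ b) ξ * Real.cos (2 * Real.pi * (Δ * v) * ξ) * poisson (x - v) := by
    intro v
    rw [cosT_eq_fold, intervalIntegral.integral_of_le zero_le_one, integral_mul_const]
  simp_rw [h1]
  rw [integral_integral_swap]
  · rw [cosT_eq_fold, intervalIntegral.integral_of_le zero_le_one, ← integral_const_mul]
    refine setIntegral_congr_fun measurableSet_Ioc fun ξ hξ => ?_
    have hinner : ∫ v, Real.cos (2 * Real.pi * (Δ * v) * ξ) * poisson (x - v) =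
        Real.cos (2 * Real.pi * (Δ * x) * ξ) * (Real.pi * Real.exp (-(3 * Real.pi * Δ * ξ))) := by
      have e1 := integral_sub_left_eq_self
        (fun v => Real.cos (2 * Real.pi * (Δ * (x - v)) * ξ) * poisson v) volume x
      simp only [sub_sub_cancel] at e1
      rw [e1]
      set w := 2 * Real.pi * Δ * ξ with hw
      have hw0 : 0 ≤ w := by
        have := hξ.1.le
        positivity
      have e2 : ∀ v, Real.cos (2 * Real.pi * (Δ * (x - v)) * ξ) * poisson v =
          Real.cos (2 * Real.pi * (Δ * x) * ξ) * (poisson v * Real.cos (w * v)) +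
          Real.sin (2 * Real.pi * (Δ * x) * ξ) * (poisson v * Real.sin (w * v)) := by
        intro v
        rw [show 2 * Real.pi * (Δ * (x - v)) * ξ = 2 * Real.pi * (Δ * x) * ξ - w * v by
          rw [hw]; ring, Real.cos_sub]
        ring
      have i1 : Integrable fun v => poisson v * Real.cos (w * v) :=
        integrable_poisson.mul_bdd (c := 1) (by fun_prop)
          (Eventually.of_forall fun v => Real.abs_cos_le_one _)
      have i2 : Integrable fun v => poisson v * Real.sin (w * v) :=
        integrable_poisson.mul_bdd (c := 1) (by fun_prop)
          (Eventually.of_forall fun v => Real.abs_sin_le_one _)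
      have hodd : ∫ v, poisson v * Real.sin (w * v) = 0 := by
        have h := integral_neg_eq_self (fun v => poisson v * Real.sin (w * v)) volume
        have hp : ∀ v, poisson (-v) = poisson v := fun v => by simp [poisson]
        simp only [hp, mul_neg, Real.sin_neg, integral_neg] at h
        linarith
      simp_rw [e2]
      rw [integral_add (i1.const_mul _) (i2.const_mul _), integral_const_mul, integral_const_mul,
        hodd, integral_poisson_mul_cos, abs_of_nonneg hw0]
      have e3 : -(3 / 2) * w = -(3 * Real.pi * Δ * ξ) := by
        rw [hw]
        ring
      rw [e3]
      ring
    have e4 : ∀ v, 2 * fold (expW ψ b) ξ * Real.cos (2 * Real.pi * (Δ * v) * ξ) * poisson (x - v) =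
        2 * fold (expW ψ b) ξ * (Real.cos (2 * Real.pi * (Δ * v) * ξ) * poisson (x - v)) :=
      fun v => by ring
    simp_rw [e4]
    rw [integral_const_mul, hinner, fold_of_mem ⟨hξ.1.le, hξ.2⟩, fold_of_mem ⟨hξ.1.le, hξ.2⟩, expW,
      Real.exp_neg, hb]
    have := Real.exp_ne_zero (3 * Real.pi * Δ * ξ)
    field_simp
  · have hI : Integrable (fun p : ℝ × ℝ => poisson (x - p.1) * (2 * M))
        (volume.prod (volume.restrict (Ioc (0 : ℝ) 1))) := by
      have i1 : Integrable fun v => poisson (x - v) := integrable_poisson.comp_sub_left x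
      have i2 : Integrable (fun _ : ℝ => 2 * M) (volume.restrict (Ioc (0 : ℝ) 1)) :=
        integrable_const _
      exact i1.mul_prod i2
    refine hI.mono' ?_ ?_
    · refine Continuous.aestronglyMeasurable ?_
      have := continuous_poisson
      unfold Function.uncurry
      fun_prop
    · have : ∀ᵐ p : ℝ × ℝ ∂(volume.prod (volume.restrict (Ioc (0 : ℝ) 1))), p.2 ∈ Ioc (0 : ℝ) 1 :=
        Measure.quasiMeasurePreserving_snd.ae (ae_restrict_mem measurableSet_Ioc)
      filter_upwards [this] with p hp
      simp only [Function.uncurry]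
      rw [norm_mul, Real.norm_of_nonneg (poisson_pos _).le, mul_comm]
      refine mul_le_mul_of_nonneg_left ?_ (poisson_pos _).le
      rw [norm_mul, norm_mul, RCLike.norm_ofNat]
      have m1 := hM p.2 ⟨hp.1.le, hp.2⟩
      have m2 := Real.abs_cos_le_one (2 * Real.pi * (Δ * p.1) * p.2)
      rw [← Real.norm_eq_abs] at m2
      have m0 := (norm_nonneg _).trans m1
      calc _ ≤ 2 * M * 1 := by gcongr
        _ = 2 * M := mul_one _

end ZetaZeroCount

/-! ### Beurling's majorant of the sign function -/

namespace ZetaZeroCount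

open Filter Topology MeasureTheory Set

theorem analyticAt_sinc (x : ℝ) : AnalyticAt ℝ Real.sinc x := by
  rcases eq_or_ne x 0 with rfl | hx
  · rw [Real.sinc_eq_dslope]
    obtain ⟨p, hp⟩ : AnalyticAt ℝ Real.sin 0 := Real.analyticAt_sin
    exact ⟨p.fslope, hp.has_fpower_series_dslope_fslope⟩
  · have h1 : AnalyticAt ℝ (fun x => Real.sin x / x) x :=
      Real.analyticAt_sin.div analyticAt_id hx
    refine h1.congr ?_
    filter_upwards [isOpen_ne.mem_nhds hx] with y hy
    rw [Real.sinc_of_ne_zero hy]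

theorem mul_sinc (x : ℝ) : x * Real.sinc x = Real.sin x := by
  rcases eq_or_ne x 0 with rfl | hx
  · simp
  · rw [Real.sinc_of_ne_zero hx]
    field_simp

/-- `sin (πξ) / (πξ(1-ξ))`, written so that it makes sense at `0` and `1`. -/
noncomputable def sincSum (ξ : ℝ) : ℝ :=
  Real.sinc (Real.pi * ξ) + Real.sinc (Real.pi * (1 - ξ))

theorem mul_sincSum (ξ : ℝ) : Real.pi * ξ * (1 - ξ) * sincSum ξ = Real.sin (Real.pi * ξ) := by
  have h1 := mul_sinc (Real.pi * ξ)
  have h2 := mul_sinc (Real.pi * (1 - ξ))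
  rw [show Real.pi * (1 - ξ) = Real.pi - Real.pi * ξ by ring, Real.sin_pi_sub,
    show Real.pi - Real.pi * ξ = Real.pi * (1 - ξ) by ring] at h2
  rw [sincSum]
  linear_combination (1 - ξ) * h1 + ξ * h2

theorem sincSum_pos {ξ : ℝ} (h : ξ ∈ Icc (0 : ℝ) 1) : 0 < sincSum ξ := by
  have hπ := Real.pi_pos
  rcases eq_or_lt_of_le h.1 with h0 | h0
  · rw [← h0, sincSum]
    simp [Real.sinc_of_ne_zero hπ.ne']
  rcases eq_or_lt_of_le h.2 with h1 | h1
  · rw [h1, sincSum]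
    simp [Real.sinc_of_ne_zero hπ.ne']
  have h2 : 0 < Real.sin (Real.pi * ξ) :=
    Real.sin_pos_of_pos_of_lt_pi (by positivity) (by nlinarith)
  rw [← mul_sincSum] at h2
  have h3 : 0 < Real.pi * ξ * (1 - ξ) := mul_pos (by positivity) (by linarith)
  exact (pos_iff_pos_of_mul_pos h2).1 h3

theorem continuous_sincSum : Continuous sincSum := by
  unfold sincSum
  fun_prop

theorem continuousOn_div_sincSum {f : ℝ → ℝ} (hf : Continuous f) :
    ContinuousOn (fun ξ => f ξ / sincSum ξ) (Icc 0 1) :=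
  hf.continuousOn.div continuous_sincSum.continuousOn fun _ hξ => (sincSum_pos hξ).ne'

/-- The weight `πξ(1-ξ)cot(πξ) + ξ`, the Fourier transform of half the derivative of Beurling's
function. -/
noncomputable def beurlingWeight (ξ : ℝ) : ℝ := Real.cos (Real.pi * ξ) / sincSum ξ + ξ

theorem contDiffAt_beurlingWeight {ξ : ℝ} (h : ξ ∈ Icc (0 : ℝ) 1) :
    ContDiffAt ℝ 2 beurlingWeight ξ := by
  have h1 : ContDiffAt ℝ 2 sincSum ξ := by
    unfold sincSum
    refine ContDiffAt.add ?_ ?_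
    · exact (analyticAt_sinc (Real.pi * ξ)).contDiffAt.comp ξ (f := fun ξ => Real.pi * ξ)
        (by fun_prop)
    · exact (analyticAt_sinc (Real.pi * (1 - ξ))).contDiffAt.comp ξ
        (f := fun ξ => Real.pi * (1 - ξ)) (by fun_prop)
  unfold beurlingWeight
  exact ((by fun_prop : ContDiffAt ℝ 2 (fun ξ => Real.cos (Real.pi * ξ)) ξ).div h1
    (sincSum_pos h).ne').add contDiffAt_id

theorem beurlingWeight_zero : beurlingWeight 0 = 1 := by
  simp [beurlingWeight, sincSum, Real.sinc_of_ne_zero Real.pi_pos.ne']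

theorem beurlingWeight_one : beurlingWeight 1 = 0 := by
  simp [beurlingWeight, sincSum, Real.sinc_of_ne_zero Real.pi_pos.ne']

/-- The weight `1 - ξ`, the Fourier transform of the Fejér kernel. -/
noncomputable def fejerWeight (ξ : ℝ) : ℝ := 1 - ξ

theorem contDiffAt_fejerWeight (ξ : ℝ) : ContDiffAt ℝ 2 fejerWeight ξ := by
  unfold fejerWeight
  fun_prop

theorem fejerWeight_zero : fejerWeight 0 = 1 := by simp [fejerWeight]

theorem fejerWeight_one : fejerWeight 1 = 0 := by simp [fejerWeight]

theorem cosT_fejerWeight_zero : cosT fejerWeight 0 = 1 := by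
  simp only [cosT, fejerWeight, mul_zero, zero_mul, Real.cos_zero, mul_one]
  rw [intervalIntegral.integral_const_mul, intervalIntegral.integral_sub (by simp) (by simp)]
  simp
  norm_num

theorem cosT_fejerWeight {y : ℝ} (hy : y ≠ 0) :
    cosT fejerWeight y = (Real.sin (Real.pi * y) / (Real.pi * y)) ^ 2 := by
  have hπ := Real.pi_ne_zero
  set w := 2 * Real.pi * y with hw
  have hw0 : w ≠ 0 := by positivity
  have hd : ∀ ξ : ℝ, HasDerivAt
      (fun ξ => 2 * ((1 - ξ) * (Real.sin (w * ξ) / w) - Real.cos (w * ξ) / w ^ 2))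
      (2 * (1 - ξ) * Real.cos (w * ξ)) ξ := by
    intro ξ
    have e : HasDerivAt (fun ξ : ℝ => w * ξ) (w * 1) ξ := (hasDerivAt_id ξ).const_mul w
    have h := ((((hasDerivAt_id ξ).const_sub 1).mul (e.sin.div_const w)).sub
      (e.cos.div_const (w ^ 2))).const_mul 2
    refine h.congr_deriv ?_
    simp only [id]
    field_simp
    ring
  have h := intervalIntegral.integral_eq_sub_of_hasDerivAt (a := 0) (b := 1) (fun ξ _ => hd ξ)
    (Continuous.intervalIntegrable (by fun_prop) 0 1)
  have hc : Real.cos w = 1 - 2 * Real.sin (Real.pi * y) ^ 2 := by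
    rw [hw, mul_assoc, Real.cos_two_mul, Real.cos_sq']
    ring
  simp only [cosT, fejerWeight, ← hw]
  rw [h]
  simp only [sub_self, zero_mul, mul_one, mul_zero, Real.sin_zero, zero_div, Real.cos_zero, hc]
  rw [hw]
  field_simp
  ring

theorem cosT_fejerWeight_nonneg (y : ℝ) : 0 ≤ cosT fejerWeight y := by
  rcases eq_or_ne y 0 with rfl | hy
  · rw [cosT_fejerWeight_zero]
    exact zero_le_one
  · rw [cosT_fejerWeight hy]
    positivity

/-- The Riemann-Lebesgue lemma along odd multiples of `π`, on the unit interval. -/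
theorem tendsto_integral_mul_cos_sin {g : ℝ → ℝ} (hg : ContinuousOn g (Icc 0 1)) :
    Tendsto (fun N : ℕ => ∫ ξ in (0 : ℝ)..1, g ξ * Real.cos ((2 * N + 1) * (Real.pi * ξ)))
      atTop (𝓝 0) ∧
    Tendsto (fun N : ℕ => ∫ ξ in (0 : ℝ)..1, g ξ * Real.sin ((2 * N + 1) * (Real.pi * ξ)))
      atTop (𝓝 0) := by
  set f : ℝ → ℂ := (Ioc (0 : ℝ) 1).indicator fun ξ => (g ξ : ℂ) with hf
  have hRL := Real.tendsto_integral_exp_smul_cocompact f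
  have hw : Tendsto (fun N : ℕ => ((2 * N + 1) / 2 : ℝ)) atTop (cocompact ℝ) := by
    refine Tendsto.mono_right ?_ atTop_le_cocompact
    refine tendsto_atTop_mono (f := fun N : ℕ => (N : ℝ)) (fun N => ?_) tendsto_natCast_atTop_atTop
    linarith
  have h := hRL.comp hw
  have hgi : IntegrableOn g (Ioc 0 1) := (hg.integrableOn_Icc).mono_set Ioc_subset_Icc_self
  have key : ∀ N : ℕ, (∫ v : ℝ, (Real.fourierChar (-(v * ((2 * N + 1) / 2 : ℝ)))) • f v) =
      ((∫ ξ in (0 : ℝ)..1, g ξ * Real.cos ((2 * N + 1) * (Real.pi * ξ)) : ℝ) : ℂ) -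
      ((∫ ξ in (0 : ℝ)..1, g ξ * Real.sin ((2 * N + 1) * (Real.pi * ξ)) : ℝ) : ℂ) * Complex.I := by
    intro N
    have e1 : ∀ v : ℝ, (Real.fourierChar (-(v * ((2 * N + 1) / 2 : ℝ)))) • f v =
        (Ioc (0 : ℝ) 1).indicator (fun ξ =>
          ((g ξ * Real.cos ((2 * N + 1) * (Real.pi * ξ)) : ℝ) : ℂ) -
          ((g ξ * Real.sin ((2 * N + 1) * (Real.pi * ξ)) : ℝ) : ℂ) * Complex.I) v := by
      intro v
      by_cases hv : v ∈ Ioc (0 : ℝ) 1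
      · rw [hf, indicator_of_mem hv, indicator_of_mem hv, Circle.smul_def, Real.fourierChar_apply,
          show 2 * Real.pi * -(v * ((2 * N + 1) / 2 : ℝ)) = -((2 * N + 1) * (Real.pi * v)) by ring,
          Complex.exp_mul_I, ← Complex.ofReal_cos, ← Complex.ofReal_sin, Real.cos_neg,
          Real.sin_neg, smul_eq_mul]
        push_cast
        ring
      · rw [hf, indicator_of_notMem hv, indicator_of_notMem hv, smul_zero]
    simp_rw [e1]
    have i1 : IntegrableOn (fun ξ => g ξ * Real.cos ((2 * N + 1) * (Real.pi * ξ))) (Ioc 0 1) :=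
      hgi.mul_bdd (c := 1) (by fun_prop) (Eventually.of_forall fun v => Real.abs_cos_le_one _)
    have i2 : IntegrableOn (fun ξ => g ξ * Real.sin ((2 * N + 1) * (Real.pi * ξ))) (Ioc 0 1) :=
      hgi.mul_bdd (c := 1) (by fun_prop) (Eventually.of_forall fun v => Real.abs_sin_le_one _)
    rw [integral_indicator measurableSet_Ioc, integral_sub i1.ofReal (i2.ofReal.mul_const _),
      integral_mul_const, integral_complex_ofReal, integral_complex_ofReal,
      intervalIntegral.integral_of_le zero_le_one, intervalIntegral.integral_of_le zero_le_one]
  have h' : Tendsto (fun N : ℕ =>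
      ((∫ ξ in (0 : ℝ)..1, g ξ * Real.cos ((2 * N + 1) * (Real.pi * ξ)) : ℝ) : ℂ) -
      ((∫ ξ in (0 : ℝ)..1, g ξ * Real.sin ((2 * N + 1) * (Real.pi * ξ)) : ℝ) : ℂ) * Complex.I)
      atTop (𝓝 0) := by
    refine h.congr fun N => ?_
    exact key N
  constructor
  · have := (Complex.continuous_re.tendsto _).comp h'
    simpa [Function.comp_def] using this
  · have := ((Complex.continuous_im.tendsto _).comp h').neg
    simpa [Function.comp_def] using this

theorem cos_eq_sum_sin (θ : ℝ) (N : ℕ) : Real.cos θ =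
    2 * Real.sin θ * ∑ n ∈ Finset.range N, Real.sin (2 * (n + 1) * θ) +
      Real.cos ((2 * N + 1) * θ) := by
  induction N with
  | zero => simp
  | succ N ih =>
    have h := Real.cos_sub_cos ((2 * N + 1) * θ) ((2 * N + 3) * θ)
    rw [show ((2 * N + 1) * θ + (2 * N + 3) * θ) / 2 = 2 * (N + 1) * θ by ring,
      show ((2 * N + 1) * θ - (2 * N + 3) * θ) / 2 = -θ by ring, Real.sin_neg] at h
    rw [Finset.sum_range_succ, ih]
    push_cast
    rw [show (2 * ((N : ℝ) + 1) + 1) * θ = (2 * N + 3) * θ by ring]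
    linarith

theorem sin_eq_sum_cos (θ : ℝ) (N : ℕ) : Real.sin ((2 * N + 1) * θ) =
    Real.sin θ * (1 + 2 * ∑ n ∈ Finset.range N, Real.cos (2 * (n + 1) * θ)) := by
  induction N with
  | zero => simp
  | succ N ih =>
    have h := Real.sin_sub_sin ((2 * N + 3) * θ) ((2 * N + 1) * θ)
    rw [show ((2 * N + 3) * θ + (2 * N + 1) * θ) / 2 = 2 * (N + 1) * θ by ring,
      show ((2 * N + 3) * θ - (2 * N + 1) * θ) / 2 = θ by ring] at h
    rw [Finset.sum_range_succ]
    push_cast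
    rw [show (2 * ((N : ℝ) + 1) + 1) * θ = (2 * N + 3) * θ by ring]
    linarith

/-- Beurling's entire function of exponential type `2π` approximating the sign function. -/
noncomputable def beurling (y : ℝ) : ℝ :=
  ∫ ξ in (0 : ℝ)..1, 4 * y * beurlingWeight ξ * Real.sinc (2 * Real.pi * y * ξ)

theorem beurling_neg (y : ℝ) : beurling (-y) = -beurling y := by
  unfold beurling
  rw [← intervalIntegral.integral_neg]
  refine intervalIntegral.integral_congr fun ξ _ => ?_
  simp only [mul_neg, neg_mul, Real.sinc_neg]

theorem integral_cos_fejer (y : ℝ) :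
    ∫ ξ in (0 : ℝ)..1, 2 * (1 - ξ) * Real.cos (2 * Real.pi * y * ξ) = cosT fejerWeight y := rfl

/-- Beurling's function as a finite interpolation series, up to an oscillating integral. -/
theorem beurling_eq_sum {y : ℝ} (hy : y ≠ 0) (N : ℕ) : beurling y =
    (∑ n ∈ Finset.range N, (cosT fejerWeight (y - (n + 1)) - cosT fejerWeight (y + (n + 1)))) +
      2 * Real.sin (Real.pi * y) ^ 2 / (Real.pi ^ 2 * y) +
      ∫ ξ in (0 : ℝ)..1, (4 * y * Real.sinc (2 * Real.pi * y * ξ) / sincSum ξ) *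
        Real.cos ((2 * N + 1) * (Real.pi * ξ)) := by
  have hπ := Real.pi_ne_zero
  have hlast : ∫ ξ in (0 : ℝ)..1, 2 / Real.pi * Real.sin (2 * Real.pi * y * ξ) =
      2 * Real.sin (Real.pi * y) ^ 2 / (Real.pi ^ 2 * y) := by
    rw [intervalIntegral.integral_const_mul]
    have h := intervalIntegral.integral_comp_mul_left (a := 0) (b := 1) Real.sin
      (show 2 * Real.pi * y ≠ 0 by positivity)
    rw [h, integral_sin]
    have hc : Real.cos (2 * Real.pi * y * 1) = 1 - 2 * Real.sin (Real.pi * y) ^ 2 := by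
      rw [mul_one, mul_assoc, Real.cos_two_mul, Real.cos_sq']
      ring
    rw [hc]
    simp
    field_simp
  have hi : ∀ x : ℝ, IntervalIntegrable
      (fun ξ => 2 * (1 - ξ) * Real.cos (2 * Real.pi * x * ξ)) volume 0 1 := fun x =>
    Continuous.intervalIntegrable (by fun_prop) 0 1
  have hi2 : IntervalIntegrable (fun ξ => 2 / Real.pi * Real.sin (2 * Real.pi * y * ξ))
      volume 0 1 := Continuous.intervalIntegrable (by fun_prop) 0 1
  have hi3 : IntervalIntegrable (fun ξ => (4 * y * Real.sinc (2 * Real.pi * y * ξ) / sincSum ξ) *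
        Real.cos ((2 * N + 1) * (Real.pi * ξ))) volume 0 1 := by
    refine ContinuousOn.intervalIntegrable ?_
    rw [uIcc_of_le zero_le_one]
    exact (continuousOn_div_sincSum (by fun_prop)).mul (by fun_prop)
  simp_rw [← integral_cos_fejer, ← hlast]
  simp_rw [← intervalIntegral.integral_sub (hi _) (hi _)]
  rw [← intervalIntegral.integral_finsetSum (fun n _ => (hi _).sub (hi _)),
    ← intervalIntegral.integral_add (Continuous.intervalIntegrable (by fun_prop) 0 1) hi2,
    ← intervalIntegral.integral_add (Continuous.intervalIntegrable (by fun_prop) 0 1) hi3]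
  rw [beurling]
  refine intervalIntegral.integral_congr_ae ?_
  have h1 : ∀ᵐ ξ : ℝ, ξ ≠ 1 := by simp [ae_iff]
  filter_upwards [h1] with ξ hξ1 hξ
  rw [uIoc_of_le zero_le_one] at hξ
  have hξ0 : ξ ≠ 0 := hξ.1.ne'
  have hlt : ξ < 1 := lt_of_le_of_ne hξ.2 hξ1
  have hD := (sincSum_pos ⟨hξ.1.le, hξ.2⟩).ne'
  have hm := mul_sincSum ξ
  have hs := mul_sinc (2 * Real.pi * y * ξ)
  have hc := cos_eq_sum_sin (Real.pi * ξ) N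
  have hsum : ∀ n : ℕ, 2 * (1 - ξ) * Real.cos (2 * Real.pi * (y - (n + 1)) * ξ) -
      2 * (1 - ξ) * Real.cos (2 * Real.pi * (y + (n + 1)) * ξ) =
      4 * (1 - ξ) * Real.sin (2 * Real.pi * y * ξ) * Real.sin (2 * (n + 1) * (Real.pi * ξ)) := by
    intro n
    rw [show 2 * Real.pi * (y - (n + 1)) * ξ =
        2 * Real.pi * y * ξ - 2 * (n + 1) * (Real.pi * ξ) by ring,
      show 2 * Real.pi * (y + (n + 1)) * ξ =
        2 * Real.pi * y * ξ + 2 * (n + 1) * (Real.pi * ξ) by ring, Real.cos_sub, Real.cos_add]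
    ring
  simp_rw [hsum]
  rw [← Finset.mul_sum, beurlingWeight]
  set S := ∑ n ∈ Finset.range N, Real.sin (2 * (n + 1) * (Real.pi * ξ))
  rw [hc, ← hs, ← hm]
  set C := Real.cos ((2 * N + 1) * (Real.pi * ξ))
  field_simp
  ring

/-- The integer translates of the Fejér kernel sum to `1`, up to an oscillating integral. -/
theorem fejer_sum_eq (y : ℝ) (N : ℕ) : cosT fejerWeight y +
    (∑ n ∈ Finset.range N, (cosT fejerWeight (y - (n + 1)) + cosT fejerWeight (y + (n + 1)))) =
      1 - ∫ ξ in (0 : ℝ)..1,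
        (4 * y * (Real.sin (Real.pi * y * ξ) * Real.sinc (Real.pi * y * ξ)) / sincSum ξ) *
        Real.sin ((2 * N + 1) * (Real.pi * ξ)) := by
  have hπ := Real.pi_ne_zero
  have hi : ∀ x : ℝ, IntervalIntegrable
      (fun ξ => 2 * (1 - ξ) * Real.cos (2 * Real.pi * x * ξ)) volume 0 1 := fun x =>
    Continuous.intervalIntegrable (by fun_prop) 0 1
  have hi3 : IntervalIntegrable (fun ξ =>
      (4 * y * (Real.sin (Real.pi * y * ξ) * Real.sinc (Real.pi * y * ξ)) / sincSum ξ) *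
        Real.sin ((2 * N + 1) * (Real.pi * ξ))) volume 0 1 := by
    refine ContinuousOn.intervalIntegrable ?_
    rw [uIcc_of_le zero_le_one]
    exact (continuousOn_div_sincSum (by fun_prop)).mul (by fun_prop)
  have hone : (1 : ℝ) = cosT fejerWeight 0 +
      ∑ n ∈ Finset.range N, (cosT fejerWeight (n + 1) + cosT fejerWeight (n + 1)) := by
    rw [cosT_fejerWeight_zero, Finset.sum_eq_zero, add_zero]
    intro n _
    have hn : (n : ℝ) + 1 ≠ 0 := by positivity
    have := Real.sin_nat_mul_pi (n + 1)
    push_cast at this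
    rw [cosT_fejerWeight hn, mul_comm Real.pi, this]
    simp
  refine Eq.trans ?_ (congrArg (fun x => x - _) hone.symm)
  simp_rw [← integral_cos_fejer]
  simp_rw [← intervalIntegral.integral_add (hi _) (hi _)]
  rw [← intervalIntegral.integral_finsetSum (fun n _ => (hi _).add (hi _)),
    ← intervalIntegral.integral_finsetSum (fun n _ => (hi _).add (hi _)),
    ← intervalIntegral.integral_add (hi y) (Continuous.intervalIntegrable (by fun_prop) 0 1),
    ← intervalIntegral.integral_add (hi 0) (Continuous.intervalIntegrable (by fun_prop) 0 1),
    ← intervalIntegral.integral_sub (Continuous.intervalIntegrable (by fun_prop) 0 1) hi3]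
  refine intervalIntegral.integral_congr_ae ?_
  have h1 : ∀ᵐ ξ : ℝ, ξ ≠ 1 := by simp [ae_iff]
  filter_upwards [h1] with ξ hξ1 hξ
  rw [uIoc_of_le zero_le_one] at hξ
  have hξ0 : ξ ≠ 0 := hξ.1.ne'
  have hD := (sincSum_pos ⟨hξ.1.le, hξ.2⟩).ne'
  have hm := mul_sincSum ξ
  have hs := mul_sinc (Real.pi * y * ξ)
  have hc := sin_eq_sum_cos (Real.pi * ξ) N
  have hsum : ∀ n : ℕ, 2 * (1 - ξ) * Real.cos (2 * Real.pi * (y - (n + 1)) * ξ) +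
      2 * (1 - ξ) * Real.cos (2 * Real.pi * (y + (n + 1)) * ξ) =
      4 * (1 - ξ) * Real.cos (2 * Real.pi * y * ξ) * Real.cos (2 * (n + 1) * (Real.pi * ξ)) := by
    intro n
    rw [show 2 * Real.pi * (y - (n + 1)) * ξ =
        2 * Real.pi * y * ξ - 2 * (n + 1) * (Real.pi * ξ) by ring,
      show 2 * Real.pi * (y + (n + 1)) * ξ =
        2 * Real.pi * y * ξ + 2 * (n + 1) * (Real.pi * ξ) by ring, Real.cos_sub, Real.cos_add]
    ring
  have hsum2 : ∀ n : ℕ, 2 * (1 - ξ) * Real.cos (2 * Real.pi * (n + 1) * ξ) +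
      2 * (1 - ξ) * Real.cos (2 * Real.pi * (n + 1) * ξ) =
      4 * (1 - ξ) * Real.cos (2 * (n + 1) * (Real.pi * ξ)) := by
    intro n
    rw [show 2 * Real.pi * (n + 1) * ξ = 2 * (n + 1) * (Real.pi * ξ) by ring]
    ring
  simp_rw [hsum, hsum2]
  rw [← Finset.mul_sum, ← Finset.mul_sum, hc]
  set S := ∑ n ∈ Finset.range N, Real.cos (2 * (n + 1) * (Real.pi * ξ))
  have hcos : Real.cos (2 * Real.pi * y * ξ) = 1 - 2 * Real.sin (Real.pi * y * ξ) ^ 2 := by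
    rw [show 2 * Real.pi * y * ξ = 2 * (Real.pi * y * ξ) by ring, Real.cos_two_mul, Real.cos_sq']
    ring
  rw [hcos, mul_zero, zero_mul, Real.cos_zero, ← hm, sq]
  nth_rewrite 1 [← hs]
  nth_rewrite 2 [← hs]
  field_simp
  ring

/-- Beurling's inequality on the positive half line. Subtracting the two interpolation formulas
and letting the number of terms tend to infinity expresses `1 - beurling y` by the sum of
`(y + n)⁻²` over `n ≥ 0`, which lies between `1 / y` and `1 / y + 1 / y ^ 2`. -/
theorem abs_one_sub_beurling_le {y : ℝ} (hy : 0 < y) : |1 - beurling y| ≤ cosT fejerWeight y := by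
  have hπ := Real.pi_pos
  set s := Real.sin (Real.pi * y) ^ 2 / Real.pi ^ 2 with hs
  have hs0 : 0 ≤ s := by positivity
  have hK : ∀ n : ℕ, cosT fejerWeight (y + n) = s / (y + n) ^ 2 := by
    intro n
    have h1 : y + n ≠ 0 := by positivity
    rw [cosT_fejerWeight h1, div_pow, mul_pow, mul_add, mul_comm Real.pi n,
      Real.sin_add_nat_mul_pi, mul_pow, ← pow_mul, mul_comm n 2, pow_mul, neg_one_sq, one_pow,
      one_mul, hs, div_div]
  have hlim : Tendsto (fun N : ℕ => s / y ^ 2 +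
      2 * ∑ n ∈ Finset.range N, s / (y + (n + 1)) ^ 2) atTop
      (𝓝 (1 - beurling y + 2 * s / y)) := by
    have l1 := (tendsto_integral_mul_cos_sin (g := fun ξ =>
      4 * y * Real.sinc (2 * Real.pi * y * ξ) / sincSum ξ)
      (continuousOn_div_sincSum (by fun_prop))).1
    have l2 := (tendsto_integral_mul_cos_sin (g := fun ξ =>
      4 * y * (Real.sin (Real.pi * y * ξ) * Real.sinc (Real.pi * y * ξ)) / sincSum ξ)
      (continuousOn_div_sincSum (by fun_prop))).2
    have l3 := (l1.sub l2).const_add (1 - beurling y + 2 * s / y)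
    rw [sub_zero, add_zero] at l3
    refine l3.congr fun N => ?_
    have e1 := beurling_eq_sum hy.ne' N
    have e2 := fejer_sum_eq y N
    rw [Finset.sum_sub_distrib] at e1
    rw [Finset.sum_add_distrib] at e2
    have e3 : ∑ n ∈ Finset.range N, cosT fejerWeight (y + (n + 1)) =
        ∑ n ∈ Finset.range N, s / (y + (n + 1)) ^ 2 := by
      refine Finset.sum_congr rfl fun n _ => ?_
      have := hK (n + 1)
      push_cast at this
      exact this
    have e4 := hK 0
    simp only [Nat.cast_zero, add_zero] at e4
    rw [e3] at e1 e2
    rw [e4] at e2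
    have e5 : 2 * Real.sin (Real.pi * y) ^ 2 / (Real.pi ^ 2 * y) = 2 * s / y := by
      rw [hs]
      field_simp
    rw [e5] at e1
    linarith
  have hK0 := hK 0
  simp only [Nat.cast_zero, add_zero] at hK0
  rw [hK0]
  -- Compare `∑ (y + n)⁻²` with the telescoping sums of `(y + n)⁻¹ - (y + n + 1)⁻¹`.
  have hup : ∀ N : ℕ, ∑ n ∈ Finset.range N, 1 / (y + (n + 1)) ^ 2 ≤ 1 / y - 1 / (y + N) := by
    intro N
    induction N with
    | zero => simp
    | succ N ih =>
      rw [Finset.sum_range_succ]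
      have h1 : 0 < y + N := by positivity
      have h2 : 1 / (y + (N + 1)) ^ 2 ≤ 1 / (y + N) - 1 / (y + (N + 1)) := by
        rw [div_sub_div _ _ h1.ne' (by positivity), div_le_div_iff₀ (by positivity) (by positivity)]
        nlinarith
      push_cast
      linarith
  have hlow : ∀ N : ℕ, 1 / (y + 0) - 1 / (y + (N + 1)) ≤
      1 / y ^ 2 + ∑ n ∈ Finset.range N, 1 / (y + (n + 1)) ^ 2 := by
    intro N
    induction N with
    | zero =>
      simp only [Finset.range_zero, Finset.sum_empty, add_zero, Nat.cast_zero, zero_add]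
      rw [div_sub_div _ _ hy.ne' (by positivity), div_le_div_iff₀ (by positivity) (by positivity)]
      nlinarith
    | succ N ih =>
      rw [Finset.sum_range_succ]
      have h1 : 0 < y + N := by positivity
      have h2 : 1 / (y + (N + 1)) - 1 / (y + (N + 1 + 1)) ≤ 1 / (y + (N + 1)) ^ 2 := by
        rw [div_sub_div _ _ (by positivity) (by positivity),
          div_le_div_iff₀ (by positivity) (by positivity)]
        nlinarith
      push_cast
      linarith
  have hsum : ∀ N : ℕ, ∑ n ∈ Finset.range N, s / (y + (n + 1)) ^ 2 =
      s * ∑ n ∈ Finset.range N, 1 / (y + ((n : ℝ) + 1)) ^ 2 := by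
    intro N
    rw [Finset.mul_sum]
    exact Finset.sum_congr rfl fun n _ => by ring
  have hA : 1 - beurling y + 2 * s / y ≤ s / y ^ 2 + 2 * s / y := by
    refine le_of_tendsto' hlim fun N => ?_
    rw [hsum]
    have h1 := mul_le_mul_of_nonneg_left (hup N) hs0
    have h2 : s * (1 / y - 1 / (y + N)) ≤ s / y := by
      rw [mul_sub, mul_one_div]
      have : 0 ≤ s * (1 / (y + N)) := by positivity
      linarith
    have h3 : 2 * s / y = 2 * (s / y) := by ring
    linarith
  have hB : 2 * s / y - s / y ^ 2 ≤ 1 - beurling y + 2 * s / y := by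
    have l0 : Tendsto (fun N : ℕ => 1 / (y + (N + 1))) atTop (𝓝 0) := by
      simp_rw [one_div]
      refine tendsto_inv_atTop_zero.comp ?_
      refine tendsto_atTop_mono (f := fun N : ℕ => (N : ℝ)) (fun N => ?_)
        tendsto_natCast_atTop_atTop
      linarith
    have l1 := (l0.const_mul (2 * s)).const_sub (2 * s / y - s / y ^ 2)
    rw [mul_zero, sub_zero] at l1
    refine le_of_tendsto_of_tendsto' l1 hlim fun N => ?_
    rw [hsum]
    have h1 := mul_le_mul_of_nonneg_left (hlow N) hs0
    have h2 : s * (1 / (y + 0) - 1 / (y + (N + 1))) = s / y - s * (1 / (y + (N + 1))) := by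
      rw [add_zero]
      ring
    have h3 : 2 * s / y = 2 * (s / y) := by ring
    have h4 : s * (1 / y ^ 2 + ∑ n ∈ Finset.range N, 1 / (y + ((n : ℝ) + 1)) ^ 2) =
      s / y ^ 2 + s * ∑ n ∈ Finset.range N, 1 / (y + ((n : ℝ) + 1)) ^ 2 := by ring
    linarith
  rw [abs_le]
  constructor <;> linarith

/-- Beurling's inequality: `beurling` approximates the (right continuous) sign function with an
error bounded by the Fejér kernel. The value `1` of the sign function at `0` makes the difference of
two translates count ordinates in a half-open interval, as `N(b) - N(a)` does. -/
theorem abs_sign_sub_beurling_le (y : ℝ) :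
    |(if 0 ≤ y then 1 else -1) - beurling y| ≤ cosT fejerWeight y := by
  rcases lt_trichotomy y 0 with hy | rfl | hy
  · rw [if_neg (not_le.2 hy)]
    have h := abs_one_sub_beurling_le (neg_pos.2 hy)
    rw [beurling_neg, cosT_neg] at h
    rw [show -1 - beurling y = -(1 - -beurling y) by ring, abs_neg]
    exact h
  · rw [if_pos le_rfl, cosT_fejerWeight_zero]
    simp [beurling]
  · rw [if_pos hy.le]
    exact abs_one_sub_beurling_le hy

/-- A difference of two values of Beurling's function is an average of cosine transforms. -/
theorem integral_cosT_beurlingWeight {Δ : ℝ} (hΔ : Δ ≠ 0) (v h : ℝ) :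
    Δ * ∫ u in (-h)..h, cosT beurlingWeight (Δ * (v + u)) =
      (beurling (Δ * (v + h)) - beurling (Δ * (v - h))) / 2 := by
  have hπ := Real.pi_ne_zero
  have hc : ContinuousOn beurlingWeight (Icc 0 1) := fun ξ hξ =>
    (contDiffAt_beurlingWeight hξ).continuousAt.continuousWithinAt
  have hcf := continuous_fold hc
  have hb : ∀ y, beurling y =
      ∫ ξ in (0 : ℝ)..1, 4 * y * fold beurlingWeight ξ * Real.sinc (2 * Real.pi * y * ξ) := by
    intro y
    refine intervalIntegral.integral_congr fun ξ hξ => ?_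
    rw [uIcc_of_le zero_le_one] at hξ
    rw [fold_of_mem hξ]
  simp_rw [cosT_eq_fold, hb]
  have hcont : Continuous (Function.uncurry fun u ξ : ℝ =>
      2 * fold beurlingWeight ξ * Real.cos (2 * Real.pi * (Δ * (v + u)) * ξ)) := by
    unfold Function.uncurry
    fun_prop
  rw [intervalIntegral_intervalIntegral_swap, ← intervalIntegral.integral_const_mul,
    ← intervalIntegral.integral_sub, ← intervalIntegral.integral_div]
  · refine intervalIntegral.integral_congr_ae (Eventually.of_forall fun ξ hξ => ?_)
    rw [uIoc_of_le zero_le_one] at hξ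
    have hξ0 : ξ ≠ 0 := hξ.1.ne'
    have hw : 2 * Real.pi * Δ * ξ ≠ 0 := by positivity
    have e1 : ∀ u : ℝ, 2 * fold beurlingWeight ξ * Real.cos (2 * Real.pi * (Δ * (v + u)) * ξ) =
        2 * fold beurlingWeight ξ *
          Real.cos (2 * Real.pi * Δ * ξ * u + 2 * Real.pi * Δ * ξ * v) := by
      intro u
      congr 2
      ring
    simp_rw [e1]
    rw [intervalIntegral.integral_const_mul,
      intervalIntegral.integral_comp_mul_add (fun x => Real.cos x) hw, integral_cos]
    have s1 := mul_sinc (2 * Real.pi * (Δ * (v + h)) * ξ)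
    have s2 := mul_sinc (2 * Real.pi * (Δ * (v - h)) * ξ)
    rw [show 2 * Real.pi * Δ * ξ * h + 2 * Real.pi * Δ * ξ * v =
        2 * Real.pi * (Δ * (v + h)) * ξ by ring,
      show 2 * Real.pi * Δ * ξ * -h + 2 * Real.pi * Δ * ξ * v =
        2 * Real.pi * (Δ * (v - h)) * ξ by ring, ← s1, ← s2, smul_eq_mul]
    field_simp
    ring
  · exact Continuous.intervalIntegrable (by fun_prop) 0 1
  · exact Continuous.intervalIntegrable (by fun_prop) 0 1
  · have hint : IntegrableOn (Function.uncurry fun u ξ : ℝ =>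
        2 * fold beurlingWeight ξ * Real.cos (2 * Real.pi * (Δ * (v + u)) * ξ))
        (uIcc (-h) h ×ˢ uIcc 0 1) :=
      hcont.continuousOn.integrableOn_compact (isCompact_uIcc.prod isCompact_uIcc)
    exact hint.mono_set (prod_mono uIoc_subset_uIcc uIoc_subset_uIcc)

end ZetaZeroCount

/-! ### The explicit formula -/

namespace ZetaZeroCount

open Filter Topology MeasureTheory Set

theorem inv_one_add_sq_le_poisson (x : ℝ) : (1 + x ^ 2)⁻¹ ≤ 3 / 2 * poisson x := by
  rw [poisson, ← one_div, ← mul_div_assoc, div_le_div_iff₀ (by positivity) (by positivity)]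
  nlinarith [sq_nonneg x]

theorem summable_mult_mul_inv (hRH : RiemannHypothesis) (t : ℝ) :
    Summable fun ρ : XiZero => mult ρ * (1 + (t - ρ.1.im) ^ 2)⁻¹ := by
  refine ((hasSum_poisson hRH t).summable.mul_left (3 / 2)).of_nonneg_of_le
    (fun ρ => mul_nonneg (mult_nonneg ρ) (by positivity)) fun ρ => ?_
  have := mul_le_mul_of_nonneg_left (inv_one_add_sq_le_poisson (t - ρ.1.im)) (mult_nonneg ρ)
  linarith

theorem countable_xiZero : Countable XiZero := by
  have h2 : xi 2 ≠ 0 := xi_ne_zero_of_one_le_re (by norm_num)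
  have h : {ρ : ℂ | xi ρ = 0} ⊆ ⋃ n : ℕ, ↑(zerosIn differentiable_xi h2 n) := by
    intro ρ hρ
    obtain ⟨n, hn⟩ := exists_nat_ge ‖ρ‖
    exact mem_iUnion.2 ⟨n, (mem_zerosIn _ _ _ _).2 ⟨hρ, hn⟩⟩
  exact ((countable_iUnion fun n => (Finset.finite_toSet _).countable).mono h).to_subtype

theorem inv_mul_inv_le (v w : ℝ) : (1 + v ^ 2)⁻¹ * (1 + (w - v) ^ 2)⁻¹ ≤
    2 * (1 + w ^ 2)⁻¹ * ((1 + v ^ 2)⁻¹ + (1 + (w - v) ^ 2)⁻¹) := by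
  have h1 : (0 : ℝ) < 1 + v ^ 2 := by positivity
  have h2 : (0 : ℝ) < 1 + (w - v) ^ 2 := by positivity
  have h3 : (0 : ℝ) < 1 + w ^ 2 := by positivity
  rw [inv_add_inv h1.ne' h2.ne', ← mul_inv, ← one_div, ← div_eq_mul_inv, div_mul_div_comm,
    div_le_div_iff₀ (by positivity) (by positivity)]
  have h4 : 1 + w ^ 2 ≤ 2 * (1 + v ^ 2 + (1 + (w - v) ^ 2)) := by
    nlinarith [sq_nonneg (2 * v - w), sq_nonneg v]
  have h5 := mul_le_mul_of_nonneg_right h4 (mul_pos h1 h2).le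
  linarith

/-- Integrating the partial fraction expansion of `ξ'/ξ` against a rapidly decaying weight. Sum and
integral may be exchanged because the convolution of two kernels of size `(1 + v²)⁻¹` is again of
that size. -/
theorem hasSum_integral_mul_poisson (hRH : RiemannHypothesis) {G : ℝ → ℝ} (hG : Continuous G)
    {B : ℝ} (hB : ∀ v, |G v| ≤ B * (1 + v ^ 2)⁻¹) (t : ℝ) :
    HasSum (fun ρ : XiZero => mult ρ * ∫ v, G v * poisson (t - ρ.1.im - v))
      (∫ v, G v * (logDeriv xi (2 + ((t - v : ℝ) : ℂ) * Complex.I)).re) := by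
  have := countable_xiZero
  have hB0 : 0 ≤ B := by simpa using (abs_nonneg _).trans (hB 0)
  have hI : ∀ w : ℝ, Integrable fun v : ℝ => (1 + v ^ 2)⁻¹ + (1 + (w - v) ^ 2)⁻¹ := fun w =>
    integrable_inv_one_add_sq.add (integrable_inv_one_add_sq.comp_sub_left w)
  have hIv : ∀ w : ℝ, ∫ v : ℝ, ((1 + v ^ 2)⁻¹ + (1 + (w - v) ^ 2)⁻¹) = 2 * Real.pi := by
    intro w
    rw [integral_add integrable_inv_one_add_sq (integrable_inv_one_add_sq.comp_sub_left w),
      integral_sub_left_eq_self (fun v : ℝ => (1 + v ^ 2)⁻¹), integral_univ_inv_one_add_sq]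
    ring
  have hbd : ∀ w v : ℝ, ‖G v * poisson (w - v)‖ ≤
      3 * B * (1 + w ^ 2)⁻¹ * ((1 + v ^ 2)⁻¹ + (1 + (w - v) ^ 2)⁻¹) := by
    intro w v
    rw [norm_mul, Real.norm_of_nonneg (poisson_pos _).le, Real.norm_eq_abs]
    calc |G v| * poisson (w - v) ≤ (B * (1 + v ^ 2)⁻¹) * (3 / 2 * (1 + (w - v) ^ 2)⁻¹) :=
          mul_le_mul (hB v) (poisson_le _) (poisson_pos _).le (by positivity)
      _ = B * (3 / 2) * ((1 + v ^ 2)⁻¹ * (1 + (w - v) ^ 2)⁻¹) := by ring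
      _ ≤ B * (3 / 2) * (2 * (1 + w ^ 2)⁻¹ * ((1 + v ^ 2)⁻¹ + (1 + (w - v) ^ 2)⁻¹)) :=
          mul_le_mul_of_nonneg_left (inv_mul_inv_le v w) (by positivity)
      _ = _ := by ring
  have hint : ∀ w : ℝ, Integrable fun v => G v * poisson (w - v) := by
    intro w
    refine ((hI w).const_mul (3 * B * (1 + w ^ 2)⁻¹)).mono' ?_ (Eventually.of_forall (hbd w))
    have := continuous_poisson
    exact Continuous.aestronglyMeasurable (by fun_prop)
  have hsum : Summable fun ρ : XiZero =>
      ∫ v, ‖mult ρ * (G v * poisson (t - ρ.1.im - v))‖ := by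
    refine ((summable_mult_mul_inv hRH t).mul_left (3 * B * (2 * Real.pi))).of_nonneg_of_le
      (fun ρ => integral_nonneg fun v => norm_nonneg _) fun ρ => ?_
    simp_rw [norm_mul (mult ρ)]
    rw [integral_const_mul, Real.norm_of_nonneg (mult_nonneg ρ)]
    have h1 : ∫ v, ‖G v * poisson (t - ρ.1.im - v)‖ ≤
        3 * B * (1 + (t - ρ.1.im) ^ 2)⁻¹ * (2 * Real.pi) := by
      rw [← hIv (t - ρ.1.im), ← integral_const_mul]
      exact integral_mono (hint _).norm ((hI _).const_mul _) (hbd _)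
    calc _ ≤ mult ρ * (3 * B * (1 + (t - ρ.1.im) ^ 2)⁻¹ * (2 * Real.pi)) :=
          mul_le_mul_of_nonneg_left h1 (mult_nonneg ρ)
      _ = _ := by ring
  have h := hasSum_integral_of_summable_integral_norm
    (fun ρ : XiZero => (hint (t - ρ.1.im)).const_mul (mult ρ)) hsum
  simp_rw [integral_const_mul] at h
  convert! h using 1
  refine integral_congr_ae (Eventually.of_forall fun v => ?_)
  have h2 := ((hasSum_poisson hRH (t - v)).mul_left (G v)).tsum_eq
  simp only
  rw [← h2]
  refine tsum_congr fun ρ => ?_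
  rw [show t - v - ρ.1.im = t - ρ.1.im - v by ring]
  ring

open ArithmeticFunction in
theorem hasSum_vonMangoldt (u : ℝ) :
    HasSum (fun n : ℕ => vonMangoldt n / (n : ℝ) ^ 2 * Real.cos (u * Real.log n))
      (-(logDeriv riemannZeta (2 + (u : ℂ) * Complex.I)).re) := by
  have hs : 1 < (2 + (u : ℂ) * Complex.I).re := by simp
  have h := (LSeriesSummable_vonMangoldt hs).hasSum
  have h2 := LSeries_vonMangoldt_eq_deriv_riemannZeta_div hs
  rw [LSeries] at h2
  rw [h2] at h
  have h3 := Complex.hasSum_re h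
  have e : (-deriv riemannZeta (2 + (u : ℂ) * Complex.I) /
      riemannZeta (2 + (u : ℂ) * Complex.I)).re =
      -(logDeriv riemannZeta (2 + (u : ℂ) * Complex.I)).re := by
    rw [logDeriv_apply, neg_div, Complex.neg_re]
  rw [e] at h3
  convert! h3 using 2 with n
  rcases eq_or_ne n 0 with rfl | hn
  · simp
  have hn0 : (n : ℂ) ≠ 0 := Nat.cast_ne_zero.2 hn
  rw [LSeries.term_of_ne_zero hn, Complex.cpow_add _ _ hn0, Complex.cpow_ofNat, ← div_div,
    div_eq_mul_inv _ ((n : ℂ) ^ ((u : ℂ) * Complex.I)), ← Complex.cpow_neg,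
    Complex.cpow_def_of_ne_zero hn0, ← Complex.ofReal_natCast, ← Complex.ofReal_log
      (Nat.cast_nonneg n), show ((Real.log n : ℝ) : ℂ) * -((u : ℂ) * Complex.I) =
      ((-(u * Real.log n) : ℝ) : ℂ) * Complex.I by push_cast; ring, ← Complex.ofReal_pow,
    ← Complex.ofReal_div, Complex.re_ofReal_mul, Complex.exp_ofReal_mul_I_re, Real.cos_neg]

open ArithmeticFunction in
theorem summable_vonMangoldt_div_sq : Summable fun n : ℕ => vonMangoldt n / (n : ℝ) ^ 2 := by
  have h := (hasSum_vonMangoldt 0).summable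
  simpa using h

open ArithmeticFunction in
theorem abs_re_logDeriv_zeta_le (u : ℝ) :
    |(logDeriv riemannZeta (2 + (u : ℂ) * Complex.I)).re| ≤
      ∑' n : ℕ, vonMangoldt n / (n : ℝ) ^ 2 := by
  have h := hasSum_vonMangoldt u
  have h1 := tsum_of_norm_bounded (f := fun n : ℕ =>
    vonMangoldt n / (n : ℝ) ^ 2 * Real.cos (u * Real.log n))
    summable_vonMangoldt_div_sq.hasSum (fun n => by
      rw [norm_mul, Real.norm_of_nonneg (div_nonneg vonMangoldt_nonneg (by positivity))]
      exact mul_le_of_le_one_right (div_nonneg vonMangoldt_nonneg (by positivity))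
        (Real.abs_cos_le_one _))
  rw [h.tsum_eq, norm_neg, Real.norm_eq_abs] at h1
  exact h1

theorem integrable_of_abs_le_inv {G : ℝ → ℝ} (hG : Continuous G) {B : ℝ}
    (hB : ∀ v, |G v| ≤ B * (1 + v ^ 2)⁻¹) : Integrable G :=
  (integrable_inv_one_add_sq.const_mul B).mono' hG.aestronglyMeasurable (Eventually.of_forall hB)

open ArithmeticFunction in
/-- Integrating the Dirichlet series of `ζ'/ζ` against an even, rapidly decaying weight. -/
theorem hasSum_integral_mul_vonMangoldt {G : ℝ → ℝ} (hG : Continuous G) (he : ∀ v, G (-v) = G v)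
    {B : ℝ} (hB : ∀ v, |G v| ≤ B * (1 + v ^ 2)⁻¹) (t : ℝ) :
    HasSum (fun n : ℕ => vonMangoldt n / (n : ℝ) ^ 2 *
        (Real.cos (t * Real.log n) * ∫ v, G v * Real.cos (v * Real.log n)))
      (-∫ v, G v * (logDeriv riemannZeta (2 + ((t - v : ℝ) : ℂ) * Complex.I)).re) := by
  have hGi := integrable_of_abs_le_inv hG hB
  have hi : ∀ n : ℕ, Integrable fun v =>
      vonMangoldt n / (n : ℝ) ^ 2 * (G v * Real.cos ((t - v) * Real.log n)) := fun n =>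
    (hGi.mul_bdd (c := 1) (by fun_prop)
      (Eventually.of_forall fun v => Real.abs_cos_le_one _)).const_mul _
  have hsum : Summable fun n : ℕ =>
      ∫ v, ‖vonMangoldt n / (n : ℝ) ^ 2 * (G v * Real.cos ((t - v) * Real.log n))‖ := by
    refine (summable_vonMangoldt_div_sq.mul_right (∫ v, ‖G v‖)).of_nonneg_of_le
      (fun n => integral_nonneg fun v => norm_nonneg _) fun n => ?_
    rw [← integral_const_mul]
    refine integral_mono (hi n).norm (hGi.norm.const_mul _) fun v => ?_
    have h0 : 0 ≤ vonMangoldt n / (n : ℝ) ^ 2 := div_nonneg vonMangoldt_nonneg (by positivity)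
    simp only [Real.norm_eq_abs]
    rw [abs_mul, abs_mul (G v), abs_of_nonneg h0]
    refine mul_le_mul_of_nonneg_left ?_ h0
    exact mul_le_of_le_one_right (abs_nonneg _) (Real.abs_cos_le_one _)
  have h := hasSum_integral_of_summable_integral_norm hi hsum
  rw [← integral_neg]
  convert! h using 1
  · funext n
    rw [integral_const_mul]
    congr 1
    have hodd : ∫ v, G v * Real.sin (v * Real.log n) = 0 := by
      have h := integral_neg_eq_self (fun v => G v * Real.sin (v * Real.log n)) volume
      simp only [he, neg_mul, mul_neg, Real.sin_neg, integral_neg] at h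
      linarith
    have i1 : Integrable fun v => G v * Real.cos (v * Real.log n) :=
      hGi.mul_bdd (c := 1) (by fun_prop) (Eventually.of_forall fun v => Real.abs_cos_le_one _)
    have i2 : Integrable fun v => G v * Real.sin (v * Real.log n) :=
      hGi.mul_bdd (c := 1) (by fun_prop) (Eventually.of_forall fun v => Real.abs_sin_le_one _)
    have e : ∀ v, G v * Real.cos ((t - v) * Real.log n) =
        Real.cos (t * Real.log n) * (G v * Real.cos (v * Real.log n)) +
        Real.sin (t * Real.log n) * (G v * Real.sin (v * Real.log n)) := by
      intro v
      rw [sub_mul, Real.cos_sub]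
      ring
    simp_rw [e]
    rw [integral_add (i1.const_mul _) (i2.const_mul _), integral_const_mul, integral_const_mul,
      hodd]
    ring
  · refine integral_congr_ae (Eventually.of_forall fun v => ?_)
    have h2 := ((hasSum_vonMangoldt (t - v)).mul_left (G v)).tsum_eq
    simp only
    rw [← mul_neg, ← h2]
    refine tsum_congr fun n => ?_
    ring

/-- The archimedean factor varies slowly. The exponents matter in two ways: `7 / 8 < 1` makes the
bound integrable against `(1 + v²)⁻¹`, and `3 / 4 > 1 / 2` makes it small on intervals of length
`√t`. -/
theorem exists_abs_archimedean_sub_log_le : ∃ C : ℝ, 0 ≤ C ∧ ∀ t : ℝ, 0 ≤ t → ∀ v : ℝ,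
    |archimedean (t - v) - Real.log ((1 + t) / (2 * Real.pi)) / 2| ≤
      C * ((1 + |v|) ^ (7 / 8 : ℝ) * (1 + t) ^ (-(3 / 4) : ℝ)) := by
  obtain ⟨C, hC, h⟩ := exists_abs_archimedean_sub_le
  refine ⟨2 * C + 8, by positivity, fun t ht v => ?_⟩
  have hπ := Real.pi_pos
  have h0 := h (t - v)
  set a := 1 + |t - v| with ha
  set c := 1 + t with hc
  set s := 1 + |v| with hs
  set Q := s ^ (7 / 8 : ℝ) * c ^ (-(3 / 4) : ℝ) with hQ
  have ha1 : 1 ≤ a := by have := abs_nonneg (t - v); linarith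
  have hc1 : 1 ≤ c := by linarith
  have hs1 : 1 ≤ s := by have := abs_nonneg v; linarith
  have hac : |a - c| ≤ s - 1 := by
    have h1 := abs_abs_sub_abs_le_abs_sub (t - v) t
    rw [abs_of_nonneg ht, show t - v - t = -v by ring, abs_neg] at h1
    rw [ha, hc, hs]
    simpa using h1
  have hac' := abs_le.1 hac
  have hs0 : 0 < s := by linarith
  have hc0 : 0 < c := by linarith
  have ha0 : 0 < a := by linarith
  have hQ0 : 0 ≤ Q := by positivity
  -- `hA` serves the range where `v` is small compared with `t`, `hB` the complementary range, where
  -- only the trivial bound `log s ≪ s ^ (1 / 8)` is available.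
  have hA : s ≤ c → s / c ≤ Q := by
    intro hsc
    have e1 : s = s ^ (7 / 8 : ℝ) * s ^ (1 / 8 : ℝ) := by
      rw [← Real.rpow_add hs0]
      norm_num
    have e2 : c⁻¹ = c ^ (-(3 / 4) : ℝ) * c ^ (-(1 / 4) : ℝ) := by
      rw [← Real.rpow_add hc0, ← Real.rpow_neg_one]
      norm_num
    have e3 : s ^ (1 / 8 : ℝ) ≤ c ^ (1 / 4 : ℝ) :=
      (Real.rpow_le_rpow hs0.le hsc (by norm_num)).trans
        (Real.rpow_le_rpow_of_exponent_le hc1 (by norm_num))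
    have e4 : s ^ (1 / 8 : ℝ) * c ^ (-(1 / 4) : ℝ) ≤ 1 := by
      rw [Real.rpow_neg hc0.le, ← div_eq_mul_inv]
      exact (div_le_one (by positivity)).2 e3
    calc s / c = Q * (s ^ (1 / 8 : ℝ) * c ^ (-(1 / 4) : ℝ)) := by
          rw [div_eq_mul_inv, e2, hQ]
          nth_rewrite 1 [e1]
          ring
      _ ≤ Q * 1 := mul_le_mul_of_nonneg_left e4 hQ0
      _ = Q := mul_one Q
  have hB : c ≤ 2 * s → s ^ (1 / 8 : ℝ) ≤ 2 * Q := by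
    intro hcs
    have e1 : (2 * s) ^ (-(3 / 4) : ℝ) ≤ c ^ (-(3 / 4) : ℝ) :=
      Real.rpow_le_rpow_of_nonpos hc0 hcs (by norm_num)
    have e2 : (2 : ℝ)⁻¹ ≤ 2 ^ (-(3 / 4) : ℝ) := by
      rw [← Real.rpow_neg_one]
      exact Real.rpow_le_rpow_of_exponent_le (by norm_num) (by norm_num)
    rw [Real.mul_rpow (by norm_num) hs0.le] at e1
    have e3 : s ^ (1 / 8 : ℝ) = s ^ (7 / 8 : ℝ) * s ^ (-(3 / 4) : ℝ) := by
      rw [← Real.rpow_add hs0]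
      norm_num
    have e4 : 2⁻¹ * s ^ (-(3 / 4) : ℝ) ≤ c ^ (-(3 / 4) : ℝ) :=
      (mul_le_mul_of_nonneg_right e2 (by positivity)).trans e1
    have e5 := mul_le_mul_of_nonneg_left e4 (show 0 ≤ s ^ (7 / 8 : ℝ) by positivity)
    rw [e3, hQ]
    linarith
  have hmain : 1 / a ≤ 2 * Q ∧ |Real.log a - Real.log c| ≤ 16 * Q := by
    have l1 : Real.log a - Real.log c = -(Real.log c - Real.log a) := by ring
    rcases le_or_gt s (c / 2) with hsc | hsc
    · have hac2 : c / 2 ≤ a := by linarith [hac'.1]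
      have hq := hA (by linarith)
      have hsc1 : 2 / c ≤ 2 * (s / c) := by
        rw [← mul_div_assoc]
        gcongr
        linarith
      have ha2 : 1 / a ≤ 2 / c := by
        rw [div_le_div_iff₀ ha0 hc0]
        linarith
      refine ⟨by linarith, ?_⟩
      have g1 : Real.log a - Real.log c ≤ s / c := by
        rw [← Real.log_div ha0.ne' hc0.ne']
        refine (Real.log_le_sub_one_of_pos (by positivity)).trans ?_
        rw [div_sub_one hc0.ne']
        gcongr
        linarith [hac'.2]
      have g2 : Real.log c - Real.log a ≤ 2 * (s / c) := by
        rw [← Real.log_div hc0.ne' ha0.ne']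
        refine (Real.log_le_sub_one_of_pos (by positivity)).trans ?_
        rw [div_sub_one ha0.ne', div_eq_mul_one_div]
        have : (c - a) * (1 / a) ≤ s * (2 / c) :=
          mul_le_mul (by linarith [hac'.1]) ha2 (by positivity) hs0.le
        calc _ ≤ s * (2 / c) := this
          _ = _ := by ring
      rw [abs_le]
      constructor <;> linarith
    · have hq := hB (by linarith)
      have h1s : (1 : ℝ) ≤ s ^ (1 / 8 : ℝ) := Real.one_le_rpow hs1 (by norm_num)
      refine ⟨((div_le_one ha0).2 ha1).trans (h1s.trans hq), ?_⟩
      have hls : Real.log s ≤ 8 * s ^ (1 / 8 : ℝ) := by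
        refine (Real.log_le_rpow_div hs0.le (show (0 : ℝ) < 1 / 8 by norm_num)).trans (le_of_eq ?_)
        ring
      have g1 : Real.log a ≤ Real.log c + Real.log s := by
        rw [← Real.log_mul hc0.ne' hs0.ne']
        refine Real.log_le_log ha0 ?_
        nlinarith [hac'.2]
      have g2 : Real.log c ≤ Real.log a + Real.log s := by
        rw [← Real.log_mul ha0.ne' hs0.ne']
        refine Real.log_le_log hc0 ?_
        nlinarith [hac'.1]
      rw [abs_le]
      constructor <;> linarith
  have e : archimedean (t - v) - Real.log (c / (2 * Real.pi)) / 2 =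
      (archimedean (t - v) - Real.log (a / (2 * Real.pi)) / 2) +
        (Real.log a - Real.log c) / 2 := by
    rw [Real.log_div hc0.ne' (by positivity), Real.log_div ha0.ne' (by positivity)]
    ring
  rw [e]
  refine (abs_add_le _ _).trans ?_
  rw [abs_div, abs_two]
  have h5 : C / a ≤ C * (2 * Q) := by
    rw [div_eq_mul_one_div]
    exact mul_le_mul_of_nonneg_left hmain.1 hC
  linarith [hmain.2]

theorem integrable_rpow_mul_inv :
    Integrable fun v : ℝ => (1 + |v|) ^ (7 / 8 : ℝ) * (1 + v ^ 2)⁻¹ := by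
  have h := integrable_one_add_norm (E := ℝ) (μ := volume) (r := 9 / 8) (by norm_num)
  refine (h.const_mul 2).mono' ?_ (Eventually.of_forall fun v => ?_)
  · refine Continuous.aestronglyMeasurable (Continuous.mul (Continuous.rpow_const (by fun_prop)
      fun v => Or.inr (by norm_num)) (Continuous.inv₀ (by fun_prop) fun v => by positivity))
  · have h0 : 0 < 1 + |v| := by positivity
    rw [Real.norm_of_nonneg (by positivity), Real.norm_eq_abs]
    have e : (1 + |v|) ^ (-(9 / 8) : ℝ) = (1 + |v|) ^ (7 / 8 : ℝ) * ((1 + |v|) ^ 2)⁻¹ := by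
      rw [← Real.rpow_two, ← Real.rpow_neg h0.le, ← Real.rpow_add h0]
      norm_num
    have e2 : (1 + v ^ 2)⁻¹ ≤ 2 * ((1 + |v|) ^ 2)⁻¹ := by
      rw [← one_div, ← div_eq_mul_inv, div_le_div_iff₀ (by positivity) (by positivity)]
      nlinarith [sq_abs v, sq_nonneg (1 - |v|)]
    rw [e]
    calc _ ≤ (1 + |v|) ^ (7 / 8 : ℝ) * (2 * ((1 + |v|) ^ 2)⁻¹) := by gcongr
      _ = _ := by ring

/-- The weighted sum over the zeros near height `t`. -/
noncomputable def zeroSum (ψ : ℝ → ℝ) (Δ t : ℝ) : ℝ :=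
  ∑' ρ : XiZero, mult ρ * cosT ψ (Δ * (t - ρ.1.im))

open ArithmeticFunction in
/-- The prime side of the explicit formula: a Dirichlet polynomial of length `exp (2πΔ)`. -/
noncomputable def primeSum (ψ : ℝ → ℝ) (Δ t : ℝ) : ℝ :=
  ∑ n ∈ Finset.range (⌊Real.exp (2 * Real.pi * Δ)⌋₊ + 1), vonMangoldt n / √n *
    ψ (Real.log n / (2 * Real.pi * Δ)) * Real.cos (t * Real.log n)

theorem integral_cosT_mul_cos_scaled {ψ : ℝ → ℝ} (hψ : ∀ ξ ∈ Icc (0 : ℝ) 1, ContDiffAt ℝ 2 ψ ξ)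
    (h1 : ψ 1 = 0) {Δ : ℝ} (hΔ : 0 < Δ) {b : ℝ} (hb : 0 ≤ b) (w : ℝ) :
    ∫ v, cosT (expW ψ b) (Δ * v) * Real.cos (v * w) =
      Δ⁻¹ * fold (expW ψ b) (w / (2 * Real.pi * Δ)) := by
  have hπ := Real.pi_ne_zero
  rw [← integral_cosT_mul_cos (continuousOn_of_contDiffAt fun ξ hξ => contDiffAt_expW (hψ ξ hξ) b)
    (expW_one h1 b) (integrable_cosT_expW hψ h1 hb)]
  have h := Measure.integral_comp_mul_left (fun y => cosT (expW ψ b) y *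
    Real.cos (2 * Real.pi * y * (w / (2 * Real.pi * Δ)))) Δ
  rw [abs_of_pos (inv_pos.2 hΔ), smul_eq_mul] at h
  rw [← h]
  refine integral_congr_ae (Eventually.of_forall fun v => ?_)
  simp only
  congr 2
  field_simp

open ArithmeticFunction in
/-- The prime side, with the weight `n^{-2}` turned into `n^{-1/2}` by the exponential factor. -/
theorem hasSum_primeSum {ψ : ℝ → ℝ} (h1 : ψ 1 = 0) {Δ : ℝ} (hΔ : 0 < Δ) (t : ℝ) :
    HasSum (fun n : ℕ => vonMangoldt n / (n : ℝ) ^ 2 * (Real.cos (t * Real.log n) *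
      (Δ⁻¹ * fold (expW ψ (3 * Real.pi * Δ)) (Real.log n / (2 * Real.pi * Δ)))))
      (Δ⁻¹ * primeSum ψ Δ t) := by
  have hπ := Real.pi_pos
  rw [primeSum, Finset.mul_sum]
  have hL : 0 < 2 * Real.pi * Δ := by positivity
  convert! hasSum_sum_of_ne_finset_zero (f := fun n : ℕ => vonMangoldt n / (n : ℝ) ^ 2 *
      (Real.cos (t * Real.log n) *
        (Δ⁻¹ * fold (expW ψ (3 * Real.pi * Δ)) (Real.log n / (2 * Real.pi * Δ)))))
    (s := Finset.range (⌊Real.exp (2 * Real.pi * Δ)⌋₊ + 1)) ?_ using 1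
  · refine Finset.sum_congr rfl fun n hn => ?_
    rcases eq_or_ne n 0 with rfl | hn0
    · simp
    have hn1 : (1 : ℝ) ≤ n := by exact_mod_cast Nat.one_le_iff_ne_zero.2 hn0
    have hn2 : (0 : ℝ) < n := by linarith
    have hle : (n : ℝ) ≤ Real.exp (2 * Real.pi * Δ) :=
      (Nat.le_floor_iff (Real.exp_pos _).le).1 (Nat.lt_succ_iff.1 (Finset.mem_range.1 hn))
    have hlog : Real.log n ≤ 2 * Real.pi * Δ := (Real.log_le_iff_le_exp hn2).2 hle
    rw [fold_of_mem ⟨div_nonneg (Real.log_nonneg hn1) hL.le, (div_le_one hL).2 hlog⟩, expW]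
    have e1 : 3 * Real.pi * Δ * (Real.log n / (2 * Real.pi * Δ)) = Real.log n * (3 / 2) := by
      field_simp
    have e2 : Real.exp (Real.log n * (3 / 2)) = (n : ℝ) ^ (3 / 2 : ℝ) :=
      (Real.rpow_def_of_pos hn2 _).symm
    have e3 : (√n : ℝ)⁻¹ = (n : ℝ) ^ (3 / 2 : ℝ) / (n : ℝ) ^ 2 := by
      rw [Real.sqrt_eq_rpow, ← Real.rpow_neg hn2.le, ← Real.rpow_two, ← Real.rpow_sub hn2]
      norm_num
    rw [e1, e2, div_eq_mul_inv _ (√n : ℝ), e3]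
    ring
  · intro n hn
    have hlt : Real.exp (2 * Real.pi * Δ) < n := by
      have := fun h => hn (Finset.mem_range.2 (Nat.lt_succ_iff.2
        ((Nat.le_floor_iff (Real.exp_pos _).le).2 h)))
      exact not_le.1 this
    have hn2 : (0 : ℝ) < n := (Real.exp_pos _).trans hlt
    have hlog : 2 * Real.pi * Δ < Real.log n := (Real.lt_log_iff_exp_lt hn2).2 hlt
    rw [fold_of_one_le (expW_one h1 _)]
    · ring
    · refine le_trans ?_ (le_abs_self _)
      rw [le_div_iff₀ hL]
      linarith
  · infer_instance

/-- **Explicit formula** with a band-limited weight. The convolution of the function `G`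
in the proof with the Poisson kernel is `π` times `cosT ψ (Δ ·)`. Integrating
`Re ξ'/ξ (2 + i(t - v))` against `G v` yields the sum over the zeros through partial fractions, and
the sum over the primes and the archimedean term through `ξ'/ξ = ζ'/ζ + (archimedean part)`. -/
theorem explicit_formula (hRH : RiemannHypothesis) {ψ : ℝ → ℝ}
    (hψ : ∀ ξ ∈ Icc (0 : ℝ) 1, ContDiffAt ℝ 2 ψ ξ) (h1 : ψ 1 = 0) :
    ∃ C : ℝ, 0 ≤ C ∧ ∀ Δ : ℝ, 1 ≤ Δ → ∀ t : ℝ, 0 ≤ t →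
      |zeroSum ψ Δ t - (ψ 0 * Real.log ((1 + t) / (2 * Real.pi)) / (2 * Real.pi * Δ) -
        (Real.pi * Δ)⁻¹ * primeSum ψ Δ t)| ≤
      C * ((1 + 3 * Real.pi * Δ) ^ 2 * Real.exp (3 * Real.pi * Δ)) * (1 + t) ^ (-(3 / 4) : ℝ) := by
  obtain ⟨A, hA, hbd⟩ := exists_abs_cosT_expW_le hψ h1
  obtain ⟨C, hC, harch⟩ := exists_abs_archimedean_sub_log_le
  set J := ∫ v : ℝ, (1 + |v|) ^ (7 / 8 : ℝ) * (1 + v ^ 2)⁻¹ with hJ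
  have hJ0 : 0 ≤ J := integral_nonneg fun v => by positivity
  refine ⟨A * C * J, by positivity, fun Δ hΔ t ht => ?_⟩
  have hπ := Real.pi_pos
  have hΔ0 : 0 < Δ := by linarith
  set b := 3 * Real.pi * Δ with hb
  have hb0 : 0 ≤ b := by positivity
  set B := A * ((1 + b) ^ 2 * Real.exp b) with hBdef
  have hB0 : 0 ≤ B := by positivity
  set G : ℝ → ℝ := fun v => cosT (expW ψ b) (Δ * v) with hGdef
  have hG : Continuous G := (continuous_cosT (continuousOn_of_contDiffAt fun ξ hξ =>
    contDiffAt_expW (hψ ξ hξ) b)).comp (by fun_prop)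
  have hGe : ∀ v, G (-v) = G v := fun v => by rw [hGdef]; simp only [mul_neg, cosT_neg]
  have hGB : ∀ v, |G v| ≤ B * (1 + v ^ 2)⁻¹ := by
    intro v
    refine (hbd b hb0 (Δ * v)).trans ?_
    refine mul_le_mul_of_nonneg_left (inv_anti₀ (by positivity) ?_) hB0
    rw [mul_pow]
    have := le_mul_of_one_le_left (sq_nonneg v) (one_le_pow₀ hΔ (n := 2))
    linarith
  have hGi := integrable_of_abs_le_inv hG hGB
  have hZ := hasSum_integral_mul_poisson hRH hG hGB t
  have hP := hasSum_integral_mul_vonMangoldt hG hGe hGB t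
  have hS := hasSum_primeSum h1 hΔ0 t
  have hc := integral_cosT_mul_cos_scaled hψ h1 hΔ0 hb0
  simp_rw [hGdef, hc] at hP
  have hPS := hP.unique hS
  have hZ' : ∀ ρ : XiZero, mult ρ * ∫ v, G v * poisson (t - ρ.1.im - v) =
      Real.pi * (mult ρ * cosT ψ (Δ * (t - ρ.1.im))) := by
    intro ρ
    rw [hGdef, hb, integral_cosT_expW_mul_poisson (continuousOn_of_contDiffAt hψ) hΔ0.le]
    ring
  simp_rw [hZ'] at hZ
  have hZS : Real.pi * zeroSum ψ Δ t =
      ∫ v, G v * (logDeriv xi (2 + ((t - v : ℝ) : ℂ) * Complex.I)).re := by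
    rw [zeroSum, ← tsum_mul_left]
    exact hZ.tsum_eq
  have hG0 : ∫ v, G v = Δ⁻¹ * ψ 0 := by
    have := hc 0
    simp only [mul_zero, Real.cos_zero, mul_one, zero_div] at this
    rw [hGdef, this, fold_of_mem (by simp), expW]
    simp
  set m := Real.log ((1 + t) / (2 * Real.pi)) / 2 with hm
  set E : ℝ → ℝ := fun v => archimedean (t - v) - m with hE
  have hEc : Continuous E := by
    have := continuous_archimedean
    rw [hE]
    fun_prop
  set q := (1 + t) ^ (-(3 / 4) : ℝ) with hq
  have hq0 : 0 ≤ q := by positivity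
  have hGE : ∀ v, ‖G v * E v‖ ≤ B * C * q * ((1 + |v|) ^ (7 / 8 : ℝ) * (1 + v ^ 2)⁻¹) := by
    intro v
    rw [norm_mul, Real.norm_eq_abs, Real.norm_eq_abs]
    calc |G v| * |E v| ≤ (B * (1 + v ^ 2)⁻¹) * (C * ((1 + |v|) ^ (7 / 8 : ℝ) * q)) :=
          mul_le_mul (hGB v) (harch t ht v) (abs_nonneg _) (by positivity)
      _ = _ := by ring
  have hGEi : Integrable fun v => G v * E v :=
    (integrable_rpow_mul_inv.const_mul _).mono' (hG.mul hEc).aestronglyMeasurable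
      (Eventually.of_forall hGE)
  have hGEb : |∫ v, G v * E v| ≤ B * C * q * J := by
    have h := norm_integral_le_of_norm_le (integrable_rpow_mul_inv.const_mul (B * C * q))
      (Eventually.of_forall hGE)
    rw [integral_const_mul] at h
    exact h
  have hGz : Integrable fun v =>
      G v * (logDeriv riemannZeta (2 + ((t - v : ℝ) : ℂ) * Complex.I)).re := by
    refine hGi.mul_bdd ?_ (Eventually.of_forall fun v => abs_re_logDeriv_zeta_le (t - v))
    have := continuous_logDeriv_zeta
    exact (Complex.continuous_re.comp (this.comp (continuous_const.sub continuous_id)))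
      |>.aestronglyMeasurable
  have hsplit : ∀ v, G v * (logDeriv xi (2 + ((t - v : ℝ) : ℂ) * Complex.I)).re =
      (m * G v + G v * E v) +
        G v * (logDeriv riemannZeta (2 + ((t - v : ℝ) : ℂ) * Complex.I)).re := by
    intro v
    simp only [hE, archimedean]
    ring
  simp_rw [hsplit] at hZS
  have hmGE : Integrable fun v => m * G v + G v * E v := (hGi.const_mul m).add hGEi
  rw [integral_add hmGE hGz, integral_add (hGi.const_mul m) hGEi,
    integral_const_mul, hG0] at hZS
  have hfin : zeroSum ψ Δ t - (ψ 0 * Real.log ((1 + t) / (2 * Real.pi)) / (2 * Real.pi * Δ) -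
        (Real.pi * Δ)⁻¹ * primeSum ψ Δ t) = Real.pi⁻¹ * ∫ v, G v * E v := by
    have e1 : zeroSum ψ Δ t = Real.pi⁻¹ * (m * (Δ⁻¹ * ψ 0) + ∫ v, G v * E v) -
        Real.pi⁻¹ * (Δ⁻¹ * primeSum ψ Δ t) := by
      have hPS' : -∫ v, G v * (logDeriv riemannZeta (2 + ((t - v : ℝ) : ℂ) * Complex.I)).re =
        Δ⁻¹ * primeSum ψ Δ t := hPS
      have e0 : zeroSum ψ Δ t = Real.pi⁻¹ * (Real.pi * zeroSum ψ Δ t) := by field_simp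
      rw [e0, hZS, ← hPS']
      ring
    rw [e1, hm]
    field_simp
    ring
  rw [hfin, abs_mul, abs_of_pos (inv_pos.2 hπ)]
  have hπ1 : Real.pi⁻¹ ≤ 1 := inv_le_one_of_one_le₀ (by linarith [Real.pi_gt_three])
  calc Real.pi⁻¹ * |∫ v, G v * E v| ≤ 1 * (B * C * q * J) :=
        mul_le_mul hπ1 hGEb (abs_nonneg _) zero_le_one
    _ = _ := by rw [hBdef]; ring

end ZetaZeroCount

/-! ### Approximating the zero count by Dirichlet polynomials -/

namespace ZetaZeroCount

open Filter Topology MeasureTheory Set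

theorem exists_abs_cosT_le {ψ : ℝ → ℝ} (hψ : ∀ ξ ∈ Icc (0 : ℝ) 1, ContDiffAt ℝ 2 ψ ξ)
    (h1 : ψ 1 = 0) : ∃ A : ℝ, 0 ≤ A ∧ ∀ Δ : ℝ, 1 ≤ Δ → ∀ v : ℝ,
      |cosT ψ (Δ * v)| ≤ A * (1 + v ^ 2)⁻¹ := by
  obtain ⟨A, hA, h⟩ := exists_abs_cosT_expW_le hψ h1
  refine ⟨A, hA, fun Δ hΔ v => ?_⟩
  have h0 := h 0 le_rfl (Δ * v)
  rw [expW_zero] at h0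
  simp only [add_zero, one_pow, Real.exp_zero, mul_one] at h0
  refine h0.trans (mul_le_mul_of_nonneg_left (inv_anti₀ (by positivity) ?_) hA)
  rw [mul_pow]
  have := le_mul_of_one_le_left (sq_nonneg v) (one_le_pow₀ hΔ (n := 2))
  linarith

theorem inv_one_add_sq_add_le {h u : ℝ} (hu : |u| ≤ h) (v : ℝ) :
    (1 + (v + u) ^ 2)⁻¹ ≤ 2 * (1 + h ^ 2) * (1 + v ^ 2)⁻¹ := by
  rw [← one_div, ← div_eq_mul_inv, div_le_div_iff₀ (by positivity) (by positivity)]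
  have h1 : u ^ 2 ≤ h ^ 2 := sq_le_sq' (by linarith [(abs_le.1 hu).1]) (abs_le.1 hu).2
  nlinarith [sq_nonneg (v + u), sq_nonneg (v + 2 * u), mul_nonneg (sq_nonneg h) (sq_nonneg (v + u)),
    sq_nonneg v]

theorem hasSum_zeroSum (hRH : RiemannHypothesis) {ψ : ℝ → ℝ}
    (hψ : ∀ ξ ∈ Icc (0 : ℝ) 1, ContDiffAt ℝ 2 ψ ξ) (h1 : ψ 1 = 0) {Δ : ℝ} (hΔ : 1 ≤ Δ) (t : ℝ) :
    HasSum (fun ρ : XiZero => mult ρ * cosT ψ (Δ * (t - ρ.1.im))) (zeroSum ψ Δ t) := by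
  obtain ⟨A, hA, h⟩ := exists_abs_cosT_le hψ h1
  refine Summable.hasSum (Summable.of_norm_bounded ((summable_mult_mul_inv hRH t).mul_left A)
    fun ρ => ?_)
  rw [norm_mul, Real.norm_of_nonneg (mult_nonneg ρ), Real.norm_eq_abs]
  have := mul_le_mul_of_nonneg_left (h Δ hΔ (t - ρ.1.im)) (mult_nonneg ρ)
  linarith

theorem continuousOn_zeroSum (hRH : RiemannHypothesis) {ψ : ℝ → ℝ}
    (hψ : ∀ ξ ∈ Icc (0 : ℝ) 1, ContDiffAt ℝ 2 ψ ξ) (h1 : ψ 1 = 0) {Δ : ℝ} (hΔ : 1 ≤ Δ) {h : ℝ} (t : ℝ) :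
    ContinuousOn (fun u => zeroSum ψ Δ (t + u)) (Icc (-h) h) := by
  obtain ⟨A, hA, hb⟩ := exists_abs_cosT_le hψ h1
  unfold zeroSum
  refine continuousOn_tsum (u := fun ρ => A * (2 * (1 + h ^ 2)) *
    (mult ρ * (1 + (t - ρ.1.im) ^ 2)⁻¹)) (fun ρ => ?_)
    ((summable_mult_mul_inv hRH t).mul_left _) fun ρ u hu => ?_
  · have := continuous_cosT (continuousOn_of_contDiffAt hψ)
    exact Continuous.continuousOn (by fun_prop)
  · rw [norm_mul, Real.norm_of_nonneg (mult_nonneg ρ), Real.norm_eq_abs]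
    have e1 := hb Δ hΔ (t + u - ρ.1.im)
    have e2 := inv_one_add_sq_add_le (abs_le.2 ⟨hu.1, hu.2⟩) (t - ρ.1.im)
    rw [show t - ρ.1.im + u = t + u - ρ.1.im by ring] at e2
    calc _ ≤ mult ρ * (A * (2 * (1 + h ^ 2) * (1 + (t - ρ.1.im) ^ 2)⁻¹)) :=
          mul_le_mul_of_nonneg_left (e1.trans (mul_le_mul_of_nonneg_left e2 hA)) (mult_nonneg ρ)
      _ = _ := by ring

theorem hasSum_integral_zeroSum (hRH : RiemannHypothesis) {ψ : ℝ → ℝ}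
    (hψ : ∀ ξ ∈ Icc (0 : ℝ) 1, ContDiffAt ℝ 2 ψ ξ) (h1 : ψ 1 = 0) {Δ : ℝ} (hΔ : 1 ≤ Δ) {h : ℝ}
    (hh : 0 ≤ h) (t : ℝ) :
    HasSum (fun ρ : XiZero => mult ρ * ∫ u in (-h)..h, cosT ψ (Δ * (t - ρ.1.im + u)))
      (∫ u in (-h)..h, zeroSum ψ Δ (t + u)) := by
  have := countable_xiZero
  obtain ⟨A, hA, hb⟩ := exists_abs_cosT_le hψ h1
  have hc := continuous_cosT (continuousOn_of_contDiffAt hψ)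
  simp_rw [← intervalIntegral.integral_const_mul]
  refine intervalIntegral.hasSum_integral_of_dominated_convergence
    (fun ρ _ => A * (2 * (1 + h ^ 2)) * (mult ρ * (1 + (t - ρ.1.im) ^ 2)⁻¹)) (fun ρ => ?_)
    (fun ρ => Eventually.of_forall fun u hu => ?_)
    (Eventually.of_forall fun u _ => (summable_mult_mul_inv hRH t).mul_left _)
    (by simp) (Eventually.of_forall fun u _ => ?_)
  · exact Continuous.aestronglyMeasurable (by fun_prop)
  · rw [uIoc_of_le (by linarith)] at hu
    rw [norm_mul, Real.norm_of_nonneg (mult_nonneg ρ), Real.norm_eq_abs]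
    have e1 := hb Δ hΔ (t - ρ.1.im + u)
    have e2 := inv_one_add_sq_add_le (abs_le.2 ⟨hu.1.le, hu.2⟩) (t - ρ.1.im)
    calc _ ≤ mult ρ * (A * (2 * (1 + h ^ 2) * (1 + (t - ρ.1.im) ^ 2)⁻¹)) :=
          mul_le_mul_of_nonneg_left (e1.trans (mul_le_mul_of_nonneg_left e2 hA)) (mult_nonneg ρ)
      _ = _ := by ring
  · have h2 := hasSum_zeroSum hRH hψ h1 hΔ (t + u)
    convert! h2 using 3 with ρ
    ring_nf

/-- The zero count as a sum over all zeros. -/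
theorem hasSum_zetaZeroCount {a b : ℝ} (ha : 0 ≤ a) (hab : a ≤ b) :
    HasSum (fun ρ : XiZero => mult ρ * if a < ρ.1.im ∧ ρ.1.im ≤ b then 1 else 0)
      ((zetaZeroCount b : ℝ) - zetaZeroCount a) := by
  classical
  set Sa := (nontrivialZerosUpTo_finite a).toFinset with hSa
  set Sb := (nontrivialZerosUpTo_finite b).toFinset with hSb
  have hma : ∀ ρ, ρ ∈ Sa ↔ xi ρ = 0 ∧ 0 ≤ ρ.im ∧ ρ.im ≤ a := by
    intro ρ
    simp [hSa, nontrivialZerosUpTo, xi_eq_zero_iff, and_assoc]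
  have hmb : ∀ ρ, ρ ∈ Sb ↔ xi ρ = 0 ∧ 0 ≤ ρ.im ∧ ρ.im ≤ b := by
    intro ρ
    simp [hSb, nontrivialZerosUpTo, xi_eq_zero_iff, and_assoc]
  have hord : ∀ ρ, xi ρ = 0 → analyticOrderNatAt xi ρ = analyticOrderNatAt riemannZeta ρ := by
    intro ρ hρ
    have := xi_eq_zero_iff.1 hρ
    exact analyticOrderNatAt_xi this.2.1 this.2.2
  have h := hasSum_sum_of_ne_finset_zero (s := Sb.subtype fun ρ => xi ρ = 0)
    (f := fun ρ : XiZero => mult ρ * if a < ρ.1.im ∧ ρ.1.im ≤ b then (1 : ℝ) else 0)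
    (L := SummationFilter.unconditional _) (by
      intro ρ hρ
      rw [Finset.mem_subtype, hmb] at hρ
      have : ¬(a < ρ.1.im ∧ ρ.1.im ≤ b) := fun h => hρ ⟨ρ.2, by linarith [h.1], h.2⟩
      simp [this])
  convert! h using 1
  have e1 := Finset.sum_subtype_of_mem (s := Sb) (p := fun ρ => xi ρ = 0)
    (f := fun ρ : ℂ => (analyticOrderNatAt xi ρ : ℝ) *
      if a < ρ.im ∧ ρ.im ≤ b then (1 : ℝ) else 0) (fun ρ hρ => ((hmb ρ).1 hρ).1)
  refine Eq.trans ?_ e1.symm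
  have e2 : Sa = Sb.filter fun ρ => ρ.im ≤ a := by
    ext ρ
    rw [Finset.mem_filter, hma, hmb]
    constructor
    · rintro ⟨h0, h1, h2⟩
      exact ⟨⟨h0, h1, h2.trans hab⟩, h2⟩
    · rintro ⟨⟨h0, h1, _⟩, h2⟩
      exact ⟨h0, h1, h2⟩
  rw [zetaZeroCount, zetaZeroCount, ← hSa, ← hSb, e2, Finset.sum_filter]
  push_cast
  rw [← Finset.sum_sub_distrib]
  refine Finset.sum_congr rfl fun ρ hρ => ?_
  have h3 := (hmb ρ).1 hρ
  rw [hord ρ h3.1]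
  by_cases h4 : ρ.im ≤ a
  · simp [h4, not_lt.2 h4]
  · simp [h4, not_le.1 h4, h3.2.2]

/-- The zero count in an interval is the smoothed count, up to an error measured by the Fejér
kernel at the two end points. -/
theorem abs_count_sub_integral_le (hRH : RiemannHypothesis) {Δ : ℝ} (hΔ : 1 ≤ Δ) {h t : ℝ}
    (hh : 0 ≤ h) (hht : h ≤ t) :
    |(zetaZeroCount (t + h) : ℝ) - zetaZeroCount (t - h) -
        Δ * ∫ u in (-h)..h, zeroSum beurlingWeight Δ (t + u)| ≤
      (zeroSum fejerWeight Δ (t + h) + zeroSum fejerWeight Δ (t - h)) / 2 := by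
  have hΔ0 : 0 < Δ := by linarith
  have s1 := hasSum_zetaZeroCount (a := t - h) (b := t + h) (by linarith) (by linarith)
  have s2 := (hasSum_integral_zeroSum hRH (fun ξ hξ => contDiffAt_beurlingWeight hξ)
    beurlingWeight_one hΔ hh t).mul_left Δ
  have s3 := ((hasSum_zeroSum hRH (fun ξ _ => contDiffAt_fejerWeight ξ) fejerWeight_one hΔ
    (t + h)).add (hasSum_zeroSum hRH (fun ξ _ => contDiffAt_fejerWeight ξ) fejerWeight_one hΔ
    (t - h))).div_const 2
  rw [← Real.norm_eq_abs]
  refine (s1.sub s2).norm_le_of_bounded s3 fun ρ => ?_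
  set v := t - ρ.1.im with hv
  have e1 := integral_cosT_beurlingWeight hΔ0.ne' v h
  have e2 : (if t - h < ρ.1.im ∧ ρ.1.im ≤ t + h then (1 : ℝ) else 0) =
      ((if 0 ≤ Δ * (v + h) then 1 else -1) - (if 0 ≤ Δ * (v - h) then 1 else -1)) / 2 := by
    simp only [mul_nonneg_iff_of_pos_left hΔ0]
    rw [hv]
    split_ifs <;> first | (exfalso; grind) | norm_num
  have b1 := abs_le.1 (abs_sign_sub_beurling_le (Δ * (v + h)))
  have b2 := abs_le.1 (abs_sign_sub_beurling_le (Δ * (v - h)))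
  rw [show t + h - ρ.1.im = v + h by rw [hv]; ring, show t - h - ρ.1.im = v - h by rw [hv]; ring]
  have e3 : mult ρ * (if t - h < ρ.1.im ∧ ρ.1.im ≤ t + h then (1 : ℝ) else 0) -
      Δ * (mult ρ * ∫ u in (-h)..h, cosT beurlingWeight (Δ * (v + u))) =
      mult ρ * (((if 0 ≤ Δ * (v + h) then 1 else -1) - beurling (Δ * (v + h))) / 2 -
        ((if 0 ≤ Δ * (v - h) then 1 else -1) - beurling (Δ * (v - h))) / 2) := by
    rw [e2, mul_left_comm Δ, e1]
    ring
  rw [e3, norm_mul, Real.norm_of_nonneg (mult_nonneg ρ), Real.norm_eq_abs, ← mul_add, mul_div_assoc]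
  refine mul_le_mul_of_nonneg_left ?_ (mult_nonneg ρ)
  rw [abs_le]
  constructor <;> linarith [b1.1, b1.2, b2.1, b2.2]

theorem abs_log_one_add_le {x : ℝ} (hx : |x| ≤ 1 / 2) : |Real.log (1 + x)| ≤ 2 * |x| := by
  have h := abs_le.1 hx
  have h0 : 0 < 1 + x := by linarith [h.1]
  have h1 := Real.log_le_sub_one_of_pos h0
  have h2 := Real.one_sub_inv_le_log_of_pos h0
  have h3 : -(2 * |x|) ≤ 1 - (1 + x)⁻¹ := by
    rw [← one_div, le_sub_iff_add_le, ← le_sub_iff_add_le', div_le_iff₀ h0]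
    rcases abs_cases x with ⟨e, hx⟩ | ⟨e, hx⟩ <;> rw [e] <;> nlinarith
  rw [abs_le]
  constructor
  · linarith
  · have := le_abs_self x
    have := abs_nonneg x
    linarith

/-- The main term. Here `h ≤ √t` enters: over the interval the logarithm varies by
`O((1 + h) / t)`, which changes the integral by `O((h + h²) / t)`. -/
theorem abs_integral_log_sub_le {h t : ℝ} (hh : 0 ≤ h) (ht : 16 ≤ t) (hht : h ≤ √t) :
    |(2 * Real.pi)⁻¹ * (∫ u in (-h)..h, Real.log ((1 + (t + u)) / (2 * Real.pi))) -
      h / Real.pi * Real.log (t / (2 * Real.pi))| ≤ 1 := by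
  have hπ := Real.pi_pos
  have ht0 : 0 < t := by linarith
  have hsq : √t * √t = t := Real.mul_self_sqrt ht0.le
  have h4 : 4 ≤ √t := Real.le_sqrt_of_sq_le (by linarith)
  have hht2 : h ≤ t / 4 := by nlinarith
  have hh2 : h * h ≤ t := by nlinarith
  have hsmall : ∀ u ∈ uIcc (-h) h, |(1 + u) / t| ≤ (1 + h) / t ∧ (1 + h) / t ≤ 1 / 2 := by
    intro u hu
    rw [uIcc_of_le (by linarith)] at hu
    constructor
    · rw [abs_div, abs_of_pos ht0]
      gcongr
      rw [abs_le]
      constructor <;> linarith [hu.1, hu.2]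
    · rw [div_le_iff₀ ht0]
      linarith
  have hlog : ∀ u ∈ uIcc (-h) h, Real.log ((1 + (t + u)) / (2 * Real.pi)) =
      Real.log (t / (2 * Real.pi)) + Real.log (1 + (1 + u) / t) := by
    intro u hu
    have h1 := hsmall u hu
    have h2 := abs_le.1 (h1.1.trans h1.2)
    rw [← Real.log_mul (by positivity) (by linarith [h2.1])]
    congr 1
    field_simp
    ring
  have hcont : ContinuousOn (fun u => Real.log (1 + (1 + u) / t)) (uIcc (-h) h) := by
    refine ContinuousOn.log (by fun_prop) fun u hu => ?_
    have h1 := hsmall u hu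
    have h2 := abs_le.1 (h1.1.trans h1.2)
    linarith [h2.1]
  rw [intervalIntegral.integral_congr hlog, intervalIntegral.integral_add (by simp)
    hcont.intervalIntegrable, intervalIntegral.integral_const, smul_eq_mul]
  have hb := intervalIntegral.norm_integral_le_of_norm_le_const (a := -h) (b := h)
    (C := 2 * ((1 + h) / t)) (f := fun u => Real.log (1 + (1 + u) / t)) (fun u hu => by
      have h1 := hsmall u (uIoc_subset_uIcc hu)
      rw [Real.norm_eq_abs]
      exact (abs_log_one_add_le (h1.1.trans h1.2)).trans (by linarith [h1.1]))
  rw [Real.norm_eq_abs, show h - -h = 2 * h by ring, abs_of_nonneg (show 0 ≤ 2 * h by positivity)]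
    at hb
  set I := ∫ u in (-h)..h, Real.log (1 + (1 + u) / t)
  have e : (2 * Real.pi)⁻¹ * ((h - -h) * Real.log (t / (2 * Real.pi)) + I) -
      h / Real.pi * Real.log (t / (2 * Real.pi)) = (2 * Real.pi)⁻¹ * I := by
    field_simp
    ring
  rw [e, abs_mul, abs_of_pos (show 0 < (2 * Real.pi)⁻¹ by positivity), inv_mul_le_iff₀ (by positivity)]
  refine hb.trans ?_
  have h5 : 2 * ((1 + h) / t) * (2 * h) ≤ 5 := by
    rw [← mul_div_assoc, div_mul_eq_mul_div, div_le_iff₀ ht0]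
    nlinarith
  linarith [Real.pi_gt_three]

open ArithmeticFunction in
theorem integral_primeSum (ψ : ℝ → ℝ) (Δ t h : ℝ) :
    ∫ u in (-h)..h, primeSum ψ Δ (t + u) =
      ∑ n ∈ Finset.range (⌊Real.exp (2 * Real.pi * Δ)⌋₊ + 1), vonMangoldt n / √n *
        ψ (Real.log n / (2 * Real.pi * Δ)) * (2 * Real.sin (h * Real.log n) / Real.log n) *
        Real.cos (t * Real.log n) := by
  unfold primeSum
  rw [intervalIntegral.integral_finsetSum fun n _ => Continuous.intervalIntegrable (by fun_prop) _ _]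
  refine Finset.sum_congr rfl fun n _ => ?_
  rw [intervalIntegral.integral_const_mul, mul_assoc _ _ (Real.cos _)]
  rcases eq_or_ne (Real.log n) 0 with h0 | h0
  · have hn : vonMangoldt n = 0 := by
      rcases Real.log_eq_zero.1 h0 with h | h | h
      · have : n = 0 := by exact_mod_cast h
        simp [this]
      · have : n = 1 := by exact_mod_cast h
        simp [this]
      · have : (0 : ℝ) ≤ n := Nat.cast_nonneg n
        linarith
    simp [hn]
  · congr 1
    have e : ∀ u, Real.cos ((t + u) * Real.log n) =
        Real.cos (Real.log n * u + Real.log n * t) := fun u => by congr 1; ring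
    simp_rw [e]
    rw [intervalIntegral.integral_comp_mul_add (fun x => Real.cos x) h0, integral_cos, smul_eq_mul,
      Real.sin_sub_sin]
    rw [show (Real.log n * h + Real.log n * t - (Real.log n * -h + Real.log n * t)) / 2 =
      h * Real.log n by ring, show (Real.log n * h + Real.log n * t +
      (Real.log n * -h + Real.log n * t)) / 2 = t * Real.log n by ring]
    field_simp

set_option maxHeartbeats 1000000 in
open ArithmeticFunction in
/-- The deviation of the zero count is bounded by two Dirichlet polynomials of length
`exp (2πΔ)`, plus the loss `log t / (2πΔ)` coming from the smoothing. The first polynomial is the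
prime side for Beurling's weight, integrated over the interval; the second one is the prime side
for the Fejér kernel, averaged over the two end points. -/
theorem exists_abs_count_sub_le (hRH : RiemannHypothesis) : ∃ M : ℝ, 0 ≤ M ∧
    ∀ Δ : ℝ, 1 ≤ Δ → ∀ h : ℝ, 0 ≤ h → ∃ α β : ℕ → ℝ,
      (∀ n ∈ Finset.range (⌊Real.exp (2 * Real.pi * Δ)⌋₊ + 1),
        |α n| ≤ M * (vonMangoldt n / (√n * Real.log n)) ∧
        |β n| ≤ M * (vonMangoldt n / (√n * Real.log n))) ∧
      ∀ t : ℝ, 16 ≤ t → h ≤ √t →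
        |(zetaZeroCount (t + h) : ℝ) - zetaZeroCount (t - h) -
          h / Real.pi * Real.log (t / (2 * Real.pi))| ≤
        Real.log t / (2 * Real.pi * Δ) +
        |∑ n ∈ Finset.range (⌊Real.exp (2 * Real.pi * Δ)⌋₊ + 1), α n * Real.cos (t * Real.log n)| +
        |∑ n ∈ Finset.range (⌊Real.exp (2 * Real.pi * Δ)⌋₊ + 1), β n * Real.cos (t * Real.log n)| +
        M * (1 + (1 + 3 * Real.pi * Δ) ^ 3 * Real.exp (3 * Real.pi * Δ) * t ^ (-(1 / 4) : ℝ)) := by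
  have hπ := Real.pi_pos
  have hπ3 := Real.pi_gt_three
  have hJ := fun ξ hξ => contDiffAt_beurlingWeight (ξ := ξ) hξ
  have hK := fun (ξ : ℝ) (_ : ξ ∈ Icc (0 : ℝ) 1) => contDiffAt_fejerWeight ξ
  obtain ⟨C1, hC1, hE1⟩ := explicit_formula hRH hJ beurlingWeight_one
  obtain ⟨C2, hC2, hE2⟩ := explicit_formula hRH hK fejerWeight_one
  obtain ⟨m, hm, hmJ, -, -⟩ := exists_bound_of_contDiffAt hJ
  refine ⟨m + 2 + 4 * C1 + 2 * C2, by positivity, fun Δ hΔ h hh => ?_⟩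
  have hΔ0 : 0 < Δ := by linarith
  have hL : 0 < 2 * Real.pi * Δ := by positivity
  set S := Finset.range (⌊Real.exp (2 * Real.pi * Δ)⌋₊ + 1) with hS
  refine ⟨fun n => Real.pi⁻¹ * (vonMangoldt n / √n *
      beurlingWeight (Real.log n / (2 * Real.pi * Δ)) *
        (2 * Real.sin (h * Real.log n) / Real.log n)),
    fun n => (Real.pi * Δ)⁻¹ * (vonMangoldt n / √n *
      fejerWeight (Real.log n / (2 * Real.pi * Δ)) * Real.cos (h * Real.log n)), ?_, ?_⟩
  · intro n hn
    rcases eq_or_ne (vonMangoldt n) 0 with hv | hv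
    · simp [hv]
    have hn0 : n ≠ 0 := fun h => hv (by simp [h])
    have hn1 : n ≠ 1 := fun h => hv (by simp [h])
    have hn2 : (1 : ℝ) < n := by exact_mod_cast (by omega : 1 < n)
    have hn3 : (0 : ℝ) < n := by linarith
    have hlog0 : 0 < Real.log n := Real.log_pos hn2
    have hle : (n : ℝ) ≤ Real.exp (2 * Real.pi * Δ) :=
      (Nat.le_floor_iff (Real.exp_pos _).le).1 (Nat.lt_succ_iff.1 (Finset.mem_range.1 hn))
    have hlog : Real.log n ≤ 2 * Real.pi * Δ := (Real.log_le_iff_le_exp hn3).2 hle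
    have hmem : Real.log n / (2 * Real.pi * Δ) ∈ Icc (0 : ℝ) 1 :=
      ⟨by positivity, (div_le_one hL).2 hlog⟩
    set w := vonMangoldt n / √n with hw
    have hw0 : 0 ≤ w := div_nonneg vonMangoldt_nonneg (Real.sqrt_nonneg _)
    have hwl : vonMangoldt n / (√n * Real.log n) = w / Real.log n := by rw [hw, div_div]
    rw [hwl]
    constructor
    · have b1 := hmJ _ hmem
      have b2 : |2 * Real.sin (h * Real.log n) / Real.log n| ≤ 2 / Real.log n := by
        rw [abs_div, abs_mul, abs_two, abs_of_pos hlog0]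
        gcongr
        have := Real.abs_sin_le_one (h * Real.log n)
        linarith
      rw [abs_mul, abs_mul, abs_mul w, abs_of_nonneg hw0, abs_of_pos (inv_pos.2 hπ)]
      have b3 : Real.pi⁻¹ ≤ 1 / 2 := by
        rw [inv_le_comm₀ hπ (by norm_num)]
        linarith
      calc _ ≤ (1 / 2 : ℝ) * (w * m * (2 / Real.log n)) := by gcongr
        _ = m * (w / Real.log n) := by ring
        _ ≤ _ := by
          refine mul_le_mul_of_nonneg_right ?_ (by positivity)
          linarith
    · rw [abs_mul, abs_mul, abs_mul w, abs_of_nonneg hw0,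
        abs_of_pos (inv_pos.2 (show 0 < Real.pi * Δ by positivity))]
      have b1 : |fejerWeight (Real.log n / (2 * Real.pi * Δ))| ≤ 1 := by
        rw [fejerWeight, abs_le]
        constructor <;> linarith [hmem.1, hmem.2]
      have b2 := Real.abs_cos_le_one (h * Real.log n)
      have b3 : (Real.pi * Δ)⁻¹ ≤ 2 / Real.log n := by
        rw [← one_div, div_le_div_iff₀ (by positivity) hlog0]
        linarith
      calc _ ≤ 2 / Real.log n * (w * 1 * 1) := by gcongr
        _ = 2 * (w / Real.log n) := by ring
        _ ≤ _ := by
          refine mul_le_mul_of_nonneg_right ?_ (by positivity)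
          linarith
  intro t ht hht
  have ht0 : 0 < t := by linarith
  have hsq : √t * √t = t := Real.mul_self_sqrt ht0.le
  have h4 : 4 ≤ √t := Real.le_sqrt_of_sq_le (by linarith)
  have hht2 : h ≤ t / 4 := by nlinarith
  have hmain := abs_count_sub_integral_le hRH hΔ hh (show h ≤ t by linarith)
  set B := (1 + 3 * Real.pi * Δ) ^ 2 * Real.exp (3 * Real.pi * Δ) with hB
  have hB0 : 0 ≤ B := by positivity
  -- All error terms of the explicit formulas are measured by `q`; since `h ≤ √t`, integration over
  -- the interval multiplies it by at most `2 √t`.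
  set q := t ^ (-(3 / 4) : ℝ) with hq
  have hq0 : 0 ≤ q := by positivity
  have hqb : ∀ u : ℝ, -h ≤ u → (1 + (t + u)) ^ (-(3 / 4) : ℝ) ≤ 2 * q := by
    intro u hu
    have e1 : (1 + (t + u)) ^ (-(3 / 4) : ℝ) ≤ (2⁻¹ * t) ^ (-(3 / 4) : ℝ) :=
      Real.rpow_le_rpow_of_nonpos (by positivity) (by linarith) (by norm_num)
    refine e1.trans ?_
    rw [Real.mul_rpow (by norm_num) ht0.le]
    refine mul_le_mul_of_nonneg_right ?_ hq0
    rw [Real.inv_rpow (by norm_num), ← Real.rpow_neg (by norm_num), neg_neg]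
    calc (2 : ℝ) ^ (3 / 4 : ℝ) ≤ 2 ^ (1 : ℝ) :=
          Real.rpow_le_rpow_of_exponent_le (by norm_num) (by norm_num)
      _ = 2 := Real.rpow_one 2
  set P := ∫ u in (-h)..h, primeSum beurlingWeight Δ (t + u) with hP
  set I := ∫ u in (-h)..h, Real.log ((1 + (t + u)) / (2 * Real.pi)) with hI
  have hzi : IntervalIntegrable (fun u => zeroSum beurlingWeight Δ (t + u)) volume (-h) h := by
    refine ContinuousOn.intervalIntegrable ?_
    rw [uIcc_of_le (by linarith)]
    exact continuousOn_zeroSum hRH hJ beurlingWeight_one hΔ t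
  have hli : IntervalIntegrable (fun u => Real.log ((1 + (t + u)) / (2 * Real.pi))) volume
      (-h) h := by
    refine ContinuousOn.intervalIntegrable (ContinuousOn.log (by fun_prop) fun u hu => ?_)
    rw [uIcc_of_le (by linarith)] at hu
    have : 0 < 1 + (t + u) := by linarith [hu.1]
    positivity
  have hpi : IntervalIntegrable (fun u => primeSum beurlingWeight Δ (t + u)) volume (-h) h := by
    unfold primeSum
    exact Continuous.intervalIntegrable (by fun_prop) _ _
  have hJint : |(∫ u in (-h)..h, zeroSum beurlingWeight Δ (t + u)) -
      (I / (2 * Real.pi * Δ) - (Real.pi * Δ)⁻¹ * P)| ≤ C1 * B * (2 * q) * (2 * h) := by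
    have e1 : (∫ u in (-h)..h, zeroSum beurlingWeight Δ (t + u)) -
        (I / (2 * Real.pi * Δ) - (Real.pi * Δ)⁻¹ * P) =
        ∫ u in (-h)..h, (zeroSum beurlingWeight Δ (t + u) -
          (Real.log ((1 + (t + u)) / (2 * Real.pi)) / (2 * Real.pi * Δ) -
            (Real.pi * Δ)⁻¹ * primeSum beurlingWeight Δ (t + u))) := by
      rw [intervalIntegral.integral_sub hzi ((hli.div_const _).sub (hpi.const_mul _)),
        intervalIntegral.integral_sub (hli.div_const _) (hpi.const_mul _),
        intervalIntegral.integral_div, intervalIntegral.integral_const_mul]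
    rw [e1, ← Real.norm_eq_abs]
    have e2 := intervalIntegral.norm_integral_le_of_norm_le_const (a := -h) (b := h)
      (C := C1 * B * (2 * q)) (f := fun u => zeroSum beurlingWeight Δ (t + u) -
          (Real.log ((1 + (t + u)) / (2 * Real.pi)) / (2 * Real.pi * Δ) -
            (Real.pi * Δ)⁻¹ * primeSum beurlingWeight Δ (t + u))) (fun u hu => by
        rw [uIoc_of_le (by linarith)] at hu
        have e3 := hE1 Δ hΔ (t + u) (by linarith [hu.1])
        rw [beurlingWeight_zero, one_mul] at e3
        rw [Real.norm_eq_abs]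
        refine e3.trans ?_
        exact mul_le_mul_of_nonneg_left (hqb u hu.1.le) (by positivity))
    rwa [show h - -h = 2 * h by ring, abs_of_nonneg (show 0 ≤ 2 * h by positivity)] at e2
  have hlogI := abs_integral_log_sub_le hh ht hht
  rw [← hI] at hlogI
  -- Each Fejér sum has main term at most `log t / (2πΔ)`, and the two are averaged.
  have hF1 := hE2 Δ hΔ (t + h) (by linarith)
  have hF2 := hE2 Δ hΔ (t - h) (by linarith)
  rw [fejerWeight_zero, one_mul] at hF1 hF2
  have hq1 := mul_le_mul_of_nonneg_left (hqb h (by linarith)) (show 0 ≤ C2 * B by positivity)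
  have hq2 := mul_le_mul_of_nonneg_left (hqb (-h) le_rfl) (show 0 ≤ C2 * B by positivity)
  rw [← sub_eq_add_neg] at hq2
  have hlog1 : Real.log ((1 + (t + h)) / (2 * Real.pi)) ≤ Real.log t := by
    refine Real.log_le_log (by positivity) ?_
    rw [div_le_iff₀ (by positivity)]
    nlinarith
  have hlog2 : Real.log ((1 + (t - h)) / (2 * Real.pi)) ≤ Real.log t := by
    have : 0 < 1 + (t - h) := by linarith
    refine Real.log_le_log (by positivity) ?_
    rw [div_le_iff₀ (by positivity)]
    nlinarith
  have hlog1' := div_le_div_of_nonneg_right hlog1 hL.le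
  have hlog2' := div_le_div_of_nonneg_right hlog2 hL.le
  set SA := ∑ n ∈ S, Real.pi⁻¹ * (vonMangoldt n / √n *
      beurlingWeight (Real.log n / (2 * Real.pi * Δ)) *
        (2 * Real.sin (h * Real.log n) / Real.log n)) * Real.cos (t * Real.log n) with hSA
  set SB := ∑ n ∈ S, (Real.pi * Δ)⁻¹ * (vonMangoldt n / √n *
      fejerWeight (Real.log n / (2 * Real.pi * Δ)) * Real.cos (h * Real.log n)) *
      Real.cos (t * Real.log n) with hSB
  have hPA : Real.pi⁻¹ * P = SA := by
    rw [hP, integral_primeSum, hSA, Finset.mul_sum]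
    exact Finset.sum_congr rfl fun n _ => by ring
  have hPB : (Real.pi * Δ)⁻¹ * (primeSum fejerWeight Δ (t + h) + primeSum fejerWeight Δ (t - h)) =
      2 * SB := by
    rw [primeSum, primeSum, ← Finset.sum_add_distrib, hSB, Finset.mul_sum, Finset.mul_sum]
    refine Finset.sum_congr rfl fun n _ => ?_
    rw [add_mul, sub_mul, Real.cos_add, Real.cos_sub]
    ring
  rw [mul_add] at hPB
  have hqh : Δ * (C1 * B * (2 * q) * (2 * h)) + C2 * B * (2 * q) ≤
      (4 * C1 + 2 * C2) *
        ((1 + 3 * Real.pi * Δ) ^ 3 * Real.exp (3 * Real.pi * Δ) * t ^ (-(1 / 4) : ℝ)) := by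
    have e1 : √t * q = t ^ (-(1 / 4) : ℝ) := by
      rw [Real.sqrt_eq_rpow, hq, ← Real.rpow_add ht0]
      norm_num
    set r := t ^ (-(1 / 4) : ℝ) with hr
    have e2 : h * q ≤ r := by
      rw [← e1]
      gcongr
    have e3 : q ≤ r := by
      rw [← e1]
      exact le_mul_of_one_le_left hq0 (by linarith)
    have hr0 : 0 ≤ r := by positivity
    have e4 : (1 + 3 * Real.pi * Δ) ^ 3 * Real.exp (3 * Real.pi * Δ) = (1 + 3 * Real.pi * Δ) * B := by
      rw [hB]
      ring
    rw [e4]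
    have e6 : 1 ≤ 1 + 3 * Real.pi * Δ := le_add_of_nonneg_right (by positivity)
    have e5 : Δ ≤ 1 + 3 * Real.pi * Δ := by
      have e7 : 1 * Δ ≤ 3 * Real.pi * Δ := mul_le_mul_of_nonneg_right (by linarith only [hπ3]) hΔ0.le
      linarith only [e7]
    have f1 : Δ * (C1 * B * (2 * q) * (2 * h)) ≤ 4 * C1 * ((1 + 3 * Real.pi * Δ) * B * r) := by
      calc _ = 4 * C1 * (Δ * B * (h * q)) := by ring
        _ ≤ _ := by gcongr
    have f2 : C2 * B * (2 * q) ≤ 2 * C2 * ((1 + 3 * Real.pi * Δ) * B * r) := by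
      calc _ = 2 * C2 * (1 * B * q) := by ring
        _ ≤ _ := by gcongr
    linarith only [f1, f2]
  have hJ2 : |Δ * (∫ u in (-h)..h, zeroSum beurlingWeight Δ (t + u)) -
      ((2 * Real.pi)⁻¹ * I - SA)| ≤ Δ * (C1 * B * (2 * q) * (2 * h)) := by
    have e : Δ * (∫ u in (-h)..h, zeroSum beurlingWeight Δ (t + u)) -
        ((2 * Real.pi)⁻¹ * I - SA) =
        Δ * ((∫ u in (-h)..h, zeroSum beurlingWeight Δ (t + u)) -
          (I / (2 * Real.pi * Δ) - (Real.pi * Δ)⁻¹ * P)) := by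
      rw [← hPA]
      field_simp
    rw [e, abs_mul, abs_of_pos hΔ0]
    exact mul_le_mul_of_nonneg_left hJint hΔ0.le
  set r := (1 + 3 * Real.pi * Δ) ^ 3 * Real.exp (3 * Real.pi * Δ) * t ^ (-(1 / 4) : ℝ) with hr
  have hr0 : 0 ≤ r := by positivity
  have hA1 := neg_abs_le SA
  have hA2 := le_abs_self SA
  have hB1 := neg_abs_le SB
  have hB2 := le_abs_self SB
  have hmr : 0 ≤ (m + 2) * r := by positivity
  have hcst : 1 ≤ m + 2 + 4 * C1 + 2 * C2 := by linarith
  rw [abs_le] at hmain hJ2 hlogI hF1 hF2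
  have key : (m + 2 + 4 * C1 + 2 * C2) * (1 + r) = (m + 2 + 4 * C1 + 2 * C2) + (m + 2) * r +
      (4 * C1 + 2 * C2) * r := by ring
  have hfej : (zeroSum fejerWeight Δ (t + h) + zeroSum fejerWeight Δ (t - h)) / 2 ≤
      Real.log t / (2 * Real.pi * Δ) + |SB| + C2 * B * (2 * q) := by
    linarith only [hF1.2, hF2.2, hPB, hq1, hq2, hlog1', hlog2', hB1]
  rw [key, abs_le]
  constructor
  · linarith only [hmain.1, hJ2.1, hlogI.1, hfej, hqh, hmr, hcst, hA2]
  · linarith only [hmain.2, hJ2.2, hlogI.2, hfej, hqh, hmr, hcst, hA1]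

end ZetaZeroCount

/-! ### Mean values of Dirichlet polynomials over separated points -/

namespace ZetaZeroCount

open Filter Topology MeasureTheory Set

/-- The squared modulus of the Dirichlet polynomial `∑ c n * n ^ (i t)` over `n ∈ s`. -/
noncomputable def dirSq (c : ℕ → ℝ) (s : Finset ℕ) (t : ℝ) : ℝ :=
  (∑ n ∈ s, c n * Real.cos (t * Real.log n)) ^ 2 + (∑ n ∈ s, c n * Real.sin (t * Real.log n)) ^ 2

theorem dirSq_nonneg (c : ℕ → ℝ) (s : Finset ℕ) (t : ℝ) : 0 ≤ dirSq c s t := by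
  unfold dirSq
  positivity

theorem continuous_dirSq (c : ℕ → ℝ) (s : Finset ℕ) : Continuous (dirSq c s) := by
  unfold dirSq
  fun_prop

theorem dirSq_eq_sum (c : ℕ → ℝ) (s : Finset ℕ) (t : ℝ) : dirSq c s t =
    ∑ m ∈ s, ∑ n ∈ s, c m * c n * Real.cos (t * (Real.log m - Real.log n)) := by
  rw [dirSq, sq, sq, Finset.sum_mul_sum, Finset.sum_mul_sum, ← Finset.sum_add_distrib]
  refine Finset.sum_congr rfl fun m _ => ?_
  rw [← Finset.sum_add_distrib]
  refine Finset.sum_congr rfl fun n _ => ?_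
  rw [mul_sub, Real.cos_sub]
  ring

theorem inv_le_abs_log_sub_log {m n : ℕ} (hm : 1 ≤ m) (hn : 1 ≤ n) (h : m ≠ n) {N : ℝ}
    (hmN : (m : ℝ) ≤ N) (hnN : (n : ℝ) ≤ N) : 1 / N ≤ |Real.log m - Real.log n| := by
  wlog hlt : m < n generalizing m n
  · rw [abs_sub_comm]
    exact this hn hm h.symm hnN hmN (lt_of_le_of_ne (not_lt.1 hlt) h.symm)
  have hm0 : (0 : ℝ) < m := by exact_mod_cast hm
  have hn0 : (0 : ℝ) < n := by exact_mod_cast hn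
  have hmn : (m : ℝ) + 1 ≤ n := by exact_mod_cast hlt
  rw [abs_sub_comm]
  refine le_trans ?_ (le_abs_self _)
  rw [← Real.log_div hn0.ne' hm0.ne']
  refine le_trans ?_ (Real.one_sub_inv_le_log_of_pos (by positivity))
  rw [inv_div, one_sub_div hn0.ne']
  exact div_le_div₀ (by linarith) (by linarith) hn0 hnN

/-- With a Fejér weight of width at least `2πN` all off-diagonal terms vanish. -/
theorem integral_fejer_mul_dirSq {s : Finset ℕ} {N Y : ℝ} (hN : 0 < N)
    (hs : ∀ n ∈ s, 1 ≤ n ∧ (n : ℝ) ≤ N) (hY : 2 * Real.pi * N ≤ Y) (c : ℕ → ℝ) :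
    Integrable (fun u => cosT fejerWeight (Y⁻¹ * u) * dirSq c s u) ∧
    ∫ u, cosT fejerWeight (Y⁻¹ * u) * dirSq c s u = Y * ∑ n ∈ s, c n ^ 2 := by
  have hπ := Real.pi_pos
  have hY0 : 0 < Y := lt_of_lt_of_le (by positivity) hY
  have hK := fun (ξ : ℝ) (_ : ξ ∈ Icc (0 : ℝ) 1) => contDiffAt_fejerWeight ξ
  have hF := integrable_cosT_expW hK fejerWeight_one le_rfl
  rw [expW_zero] at hF
  have hi : ∀ m n : ℕ, Integrable fun u =>
      c m * c n * (cosT fejerWeight (Y⁻¹ * u) * Real.cos (u * (Real.log m - Real.log n))) :=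
    fun m n => ((hF.comp_mul_left' (inv_pos.2 hY0).ne').mul_bdd (c := 1) (by fun_prop)
      (Eventually.of_forall fun v => Real.abs_cos_le_one _)).const_mul _
  have hint : ∀ m n : ℕ,
      ∫ u, c m * c n * (cosT fejerWeight (Y⁻¹ * u) * Real.cos (u * (Real.log m - Real.log n))) =
      c m * c n * (Y * fold fejerWeight (Y * (Real.log m - Real.log n) / (2 * Real.pi))) := by
    intro m n
    have h := integral_cosT_mul_cos_scaled hK fejerWeight_one (inv_pos.2 hY0) le_rfl
      (Real.log m - Real.log n)
    rw [expW_zero, inv_inv] at h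
    rw [integral_const_mul, h]
    congr 3
    field_simp
  have hexp : ∀ u, cosT fejerWeight (Y⁻¹ * u) * dirSq c s u = ∑ m ∈ s, ∑ n ∈ s,
      c m * c n * (cosT fejerWeight (Y⁻¹ * u) * Real.cos (u * (Real.log m - Real.log n))) := by
    intro u
    rw [dirSq_eq_sum, Finset.mul_sum]
    refine Finset.sum_congr rfl fun m _ => ?_
    rw [Finset.mul_sum]
    refine Finset.sum_congr rfl fun n _ => ?_
    ring
  simp_rw [hexp]
  refine ⟨integrable_finsetSum _ fun m _ => integrable_finsetSum _ fun n _ => hi m n, ?_⟩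
  rw [integral_finsetSum _ fun m _ => integrable_finsetSum _ fun n _ => hi m n, Finset.mul_sum]
  refine Finset.sum_congr rfl fun m hm => ?_
  rw [integral_finsetSum _ fun n _ => hi m n, Finset.sum_eq_single m]
  · rw [hint, sub_self, mul_zero, zero_div, fold_of_mem (by simp), fejerWeight_zero]
    ring
  · intro n hn hne
    have h1 := inv_le_abs_log_sub_log (hs m hm).1 (hs n hn).1 hne.symm (hs m hm).2 (hs n hn).2
    rw [hint, fold_of_one_le fejerWeight_one, mul_zero, mul_zero]
    rw [abs_div, abs_mul, abs_of_pos hY0, abs_of_pos (show 0 < 2 * Real.pi by positivity),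
      le_div_iff₀ (by positivity)]
    rw [div_le_iff₀ hN] at h1
    have h2 := mul_le_mul_of_nonneg_right hY (abs_nonneg (Real.log m - Real.log n))
    nlinarith
  · intro h
    exact absurd hm h

/-- Gallagher's lemma: a value is bounded by means of the function and its derivative. -/
theorem le_integral_add_of_abs_deriv_le {f f' g : ℝ → ℝ} (hf : ∀ x, HasDerivAt f (f' x) x)
    (hf' : Continuous f') (hg : Continuous g) (hfg : ∀ x, |f' x| ≤ g x) (x : ℝ) :
    f x ≤ ∫ u in (x - 1 / 2)..(x + 1 / 2), (f u + g u) := by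
  have hfc : Continuous f := continuous_iff_continuousAt.2 fun x => (hf x).continuousAt
  have hg0 : ∀ u, 0 ≤ g u := fun u => (abs_nonneg _).trans (hfg u)
  have hab : x - 1 / 2 ≤ x + 1 / 2 := by linarith
  set G := ∫ u in (x - 1 / 2)..(x + 1 / 2), g u with hG
  have hG0 : 0 ≤ G := intervalIntegral.integral_nonneg hab fun u _ => hg0 u
  have hu : ∀ u ∈ Icc (x - 1 / 2) (x + 1 / 2), f x ≤ f u + G := by
    intro u hu
    have h1 := intervalIntegral.integral_eq_sub_of_hasDerivAt (a := u) (b := x)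
      (fun y _ => hf y) (hf'.intervalIntegrable u x)
    have h2 := intervalIntegral.norm_integral_le_abs_of_norm_le (μ := volume) (f := f') (g := g)
      (a := u) (b := x) (Eventually.of_forall hfg) (hg.intervalIntegrable u x)
    have h3 := intervalIntegral.abs_integral_mono_interval (μ := volume) (f := g) (a := u) (b := x)
      (c := x - 1 / 2) (d := x + 1 / 2) (uIoc_subset_uIoc_of_uIcc_subset_uIcc
        (uIcc_subset_uIcc (by rw [uIcc_of_le hab]; exact hu)
          (by rw [uIcc_of_le hab]; constructor <;> linarith)))
      (Eventually.of_forall hg0) (hg.intervalIntegrable _ _)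
    rw [← hG, abs_of_nonneg hG0] at h3
    rw [h1, Real.norm_eq_abs] at h2
    linarith [le_abs_self (f x - f u)]
  have h4 := intervalIntegral.integral_mono_on (μ := volume) hab (f := fun _ => f x)
    (g := fun u => f u + G) intervalIntegrable_const ((hfc.add continuous_const).intervalIntegrable _ _) hu
  rw [intervalIntegral.integral_const, intervalIntegral.integral_add (hfc.intervalIntegrable _ _)
    intervalIntegrable_const, intervalIntegral.integral_const] at h4
  rw [intervalIntegral.integral_add (hfc.intervalIntegrable _ _) (hg.intervalIntegrable _ _)]
  simp only [smul_eq_mul] at h4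
  rw [show x + 1 / 2 - (x - 1 / 2) = 1 by ring, one_mul, one_mul] at h4
  exact h4

theorem four_div_pi_sq_le_fejer {y : ℝ} (hy : |y| ≤ 1 / 2) :
    4 / Real.pi ^ 2 ≤ cosT fejerWeight y := by
  have hπ := Real.pi_pos
  rcases eq_or_ne y 0 with rfl | h0
  · rw [cosT_fejerWeight_zero, div_le_one (by positivity)]
    nlinarith [Real.pi_gt_three]
  · rw [cosT_fejerWeight h0, ← sq_abs (_ / _), abs_div]
    have h1 : |Real.pi * y| ≤ Real.pi / 2 := by
      rw [abs_mul, abs_of_pos hπ]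
      nlinarith
    have h2 := Real.mul_abs_le_abs_sin h1
    have h3 : 0 < |Real.pi * y| := abs_pos.2 (by positivity)
    have h4 : 2 / Real.pi ≤ |Real.sin (Real.pi * y)| / |Real.pi * y| := by
      rw [le_div_iff₀ h3]
      exact h2
    calc 4 / Real.pi ^ 2 = (2 / Real.pi) ^ 2 := by ring
      _ ≤ _ := by gcongr

/-- The mean square of a Dirichlet polynomial of length at most `T` over points of `[T, 2T]` that
are `1`-separated. -/
theorem sum_dirSq_le {ι : Type*} (J : Finset ι) {t : ι → ℝ} {T : ℝ} (hT : 1 ≤ T)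
    (hmem : ∀ j ∈ J, T ≤ t j ∧ t j ≤ 2 * T)
    (hsep : ∀ i ∈ J, ∀ j ∈ J, i ≠ j → 1 ≤ |t i - t j|) {s : Finset ℕ}
    (hs : ∀ n ∈ s, 1 ≤ n ∧ (n : ℝ) ≤ T) (c : ℕ → ℝ) :
    ∑ j ∈ J, dirSq c s (t j) ≤ 16 * T * (2 + Real.log T ^ 2) * ∑ n ∈ s, c n ^ 2 := by
  have hπ := Real.pi_pos
  have hT0 : 0 < T := by linarith
  -- `c'` are, up to a factor `i`, the coefficients of the derivative.
  set c' : ℕ → ℝ := fun n => c n * Real.log n with hc'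
  set Φ : ℝ → ℝ := fun u => dirSq c s u + (dirSq c s u + dirSq c' s u) with hΦ
  have hΦ0 : ∀ u, 0 ≤ Φ u := fun u =>
    add_nonneg (dirSq_nonneg _ _ _) (add_nonneg (dirSq_nonneg _ _ _) (dirSq_nonneg _ _ _))
  have hcc := continuous_dirSq c s
  have hcc' := continuous_dirSq c' s
  have hΦc : Continuous Φ := hcc.add (hcc.add hcc')
  have hgal : ∀ x, dirSq c s x ≤ ∫ u in (x - 1 / 2)..(x + 1 / 2), Φ u := by
    intro x
    have hA : ∀ u, HasDerivAt (fun u => ∑ n ∈ s, c n * Real.cos (u * Real.log n))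
        (∑ n ∈ s, c n * (-Real.sin (u * Real.log n) * (1 * Real.log n))) u := fun u =>
      HasDerivAt.fun_sum fun n _ => (((hasDerivAt_id u).mul_const (Real.log n)).cos).const_mul (c n)
    have hB : ∀ u, HasDerivAt (fun u => ∑ n ∈ s, c n * Real.sin (u * Real.log n))
        (∑ n ∈ s, c n * (Real.cos (u * Real.log n) * (1 * Real.log n))) u := fun u =>
      HasDerivAt.fun_sum fun n _ => (((hasDerivAt_id u).mul_const (Real.log n)).sin).const_mul (c n)
    have hd : ∀ u, HasDerivAt (dirSq c s) _ u := fun u => ((hA u).pow 2).add ((hB u).pow 2)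
    refine le_integral_add_of_abs_deriv_le hd (by fun_prop) (hcc.add hcc') (fun u => ?_) x
    have e1 : ∑ n ∈ s, c n * (-Real.sin (u * Real.log n) * (1 * Real.log n)) =
        -∑ n ∈ s, c' n * Real.sin (u * Real.log n) := by
      rw [← Finset.sum_neg_distrib]
      exact Finset.sum_congr rfl fun n _ => by rw [hc']; ring
    have e2 : ∑ n ∈ s, c n * (Real.cos (u * Real.log n) * (1 * Real.log n)) =
        ∑ n ∈ s, c' n * Real.cos (u * Real.log n) :=
      Finset.sum_congr rfl fun n _ => by rw [hc']; ring
    rw [e1, e2]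
    unfold dirSq
    set A := ∑ n ∈ s, c n * Real.cos (u * Real.log n)
    set B := ∑ n ∈ s, c n * Real.sin (u * Real.log n)
    set A' := ∑ n ∈ s, c' n * Real.cos (u * Real.log n)
    set B' := ∑ n ∈ s, c' n * Real.sin (u * Real.log n)
    rw [abs_le]
    constructor <;>
      · norm_num
        nlinarith [sq_nonneg (A - B'), sq_nonneg (A + B'), sq_nonneg (B - A'), sq_nonneg (B + A')]
  -- The Fejér weight is bounded below on `[0, π T]`, which contains the intervals of length `1` about
  -- the points of `[T, 2T]`.
  set Y := 2 * Real.pi * T with hY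
  have hY0 : 0 < Y := by positivity
  obtain ⟨i1, v1⟩ := integral_fejer_mul_dirSq hT0 hs le_rfl c
  obtain ⟨i2, v2⟩ := integral_fejer_mul_dirSq hT0 hs le_rfl c'
  rw [← hY] at i1 v1 i2 v2
  set K : ℝ → ℝ := fun u => cosT fejerWeight (Y⁻¹ * u) with hK
  have hKΦi : Integrable fun u => K u * Φ u := by
    have := i1.add (i1.add i2)
    refine this.congr (Eventually.of_forall fun u => ?_)
    simp only [Pi.add_apply, hΦ, hK]
    ring
  have hKΦv : ∫ u, K u * Φ u =
      Y * ∑ n ∈ s, c n ^ 2 + (Y * ∑ n ∈ s, c n ^ 2 + Y * ∑ n ∈ s, c' n ^ 2) := by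
    rw [← v1, ← v2]
    have i12 : Integrable fun u => K u * dirSq c s u + K u * dirSq c' s u := i1.add i2
    rw [← integral_add i1 i2, ← integral_add i1 i12]
    refine integral_congr_ae (Eventually.of_forall fun u => ?_)
    simp only [hΦ, hK]
    ring
  have hloc : ∀ j ∈ J, dirSq c s (t j) ≤
      Real.pi ^ 2 / 4 * ∫ u in Ioc (t j - 1 / 2) (t j + 1 / 2), K u * Φ u := by
    intro j hj
    refine (hgal (t j)).trans ?_
    rw [intervalIntegral.integral_of_le (by linarith), ← integral_const_mul]
    refine setIntegral_mono_on (hΦc.integrableOn_Ioc)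
      (hKΦi.integrableOn.const_mul _) measurableSet_Ioc fun u hu => ?_
    have h1 : |Y⁻¹ * u| ≤ 1 / 2 := by
      have h2 := hmem j hj
      have hu0 : 0 ≤ u := by linarith [hu.1]
      rw [abs_of_nonneg (by positivity), inv_mul_le_iff₀ hY0, hY]
      nlinarith [hu.2, Real.pi_gt_three]
    have h3 := four_div_pi_sq_le_fejer h1
    have h4 : 1 ≤ Real.pi ^ 2 / 4 * K u := by
      calc (1 : ℝ) = Real.pi ^ 2 / 4 * (4 / Real.pi ^ 2) := by field_simp
        _ ≤ _ := by gcongr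
    rw [← mul_assoc]
    exact le_mul_of_one_le_left (hΦ0 u) h4
  have hdisj : Set.Pairwise (↑J) (Function.onFun Disjoint
      fun j => Ioc (t j - 1 / 2) (t j + 1 / 2)) := by
    intro i hi j hj hij
    rw [Function.onFun, Set.disjoint_left]
    intro u hu hu'
    have h1 := hsep i hi j hj hij
    rcases abs_cases (t i - t j) with h2 | h2 <;> linarith [hu.1, hu.2, hu'.1, hu'.2]
  have hlogsum : ∑ n ∈ s, c' n ^ 2 ≤ Real.log T ^ 2 * ∑ n ∈ s, c n ^ 2 := by
    rw [Finset.mul_sum]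
    refine Finset.sum_le_sum fun n hn => ?_
    rw [hc', mul_pow, mul_comm]
    have h1 := hs n hn
    have h2 : (1 : ℝ) ≤ n := by exact_mod_cast h1.1
    have h3 := Real.log_nonneg h2
    have h4 := Real.log_le_log (by linarith) h1.2
    gcongr
  have hS0 : 0 ≤ ∑ n ∈ s, c n ^ 2 := Finset.sum_nonneg fun n _ => sq_nonneg _
  set Q := ∑ n ∈ s, c n ^ 2 with hQ
  calc ∑ j ∈ J, dirSq c s (t j)
      ≤ ∑ j ∈ J, Real.pi ^ 2 / 4 * ∫ u in Ioc (t j - 1 / 2) (t j + 1 / 2), K u * Φ u :=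
        Finset.sum_le_sum hloc
    _ = Real.pi ^ 2 / 4 * ∫ u in ⋃ j ∈ J, Ioc (t j - 1 / 2) (t j + 1 / 2), K u * Φ u := by
        rw [← Finset.mul_sum, integral_biUnion_finset J (fun _ _ => measurableSet_Ioc) hdisj
          fun j _ => hKΦi.integrableOn]
    _ ≤ Real.pi ^ 2 / 4 * ∫ u, K u * Φ u := by
        refine mul_le_mul_of_nonneg_left (setIntegral_le_integral hKΦi
          (Eventually.of_forall fun u => ?_)) (by positivity)
        exact mul_nonneg (cosT_fejerWeight_nonneg _) (hΦ0 u)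
    _ = Real.pi ^ 2 / 4 * (Y * (2 * Q + ∑ n ∈ s, c' n ^ 2)) := by
        rw [hKΦv]
        ring
    _ ≤ Real.pi ^ 2 / 4 * (Y * (2 * Q + Real.log T ^ 2 * Q)) := by gcongr
    _ = Real.pi ^ 3 / 2 * (T * ((2 + Real.log T ^ 2) * Q)) := by
        rw [hY]
        ring
    _ ≤ 16 * (T * ((2 + Real.log T ^ 2) * Q)) := by
        refine mul_le_mul_of_nonneg_right ?_ (by positivity)
        have h1 := Real.pi_lt_d2
        have h2 : Real.pi ^ 3 ≤ 3.15 ^ 3 := by gcongr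
        norm_num at h2 ⊢
        linarith
    _ = _ := by ring

theorem dirSq_eq_norm_sq (c : ℕ → ℝ) (s : Finset ℕ) (t : ℝ) : dirSq c s t =
    ‖∑ n ∈ s, (c n : ℂ) * Complex.exp ((t * Real.log n : ℝ) * Complex.I)‖ ^ 2 := by
  rw [Complex.sq_norm, Complex.normSq_apply, Complex.re_sum, Complex.im_sum, dirSq, sq, sq]
  have h1 : ∀ n, ((c n : ℂ) * Complex.exp ((t * Real.log n : ℝ) * Complex.I)).re =
      c n * Real.cos (t * Real.log n) := fun n => by
    rw [Complex.re_ofReal_mul, Complex.exp_ofReal_mul_I_re]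
  have h2 : ∀ n, ((c n : ℂ) * Complex.exp ((t * Real.log n : ℝ) * Complex.I)).im =
      c n * Real.sin (t * Real.log n) := fun n => by
    rw [Complex.im_ofReal_mul, Complex.exp_ofReal_mul_I_im]
  simp_rw [h1, h2]

/-- A number has at most `k!` representations as an ordered product of `k` primes. -/
theorem card_prime_tuples_le (S : Finset ℕ) (hS : ∀ p ∈ S, p.Prime) (k n : ℕ) :
    ((Fintype.piFinset fun _ : Fin k => S).filter fun f => ∏ i, f i = n).card ≤
      k.factorial := by
  classical
  set A := (Fintype.piFinset fun _ : Fin k => S).filter fun f => ∏ i, f i = n with hA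
  rcases A.eq_empty_or_nonempty with h | ⟨f₀, hf₀⟩
  · rw [h]
    simp
  have hperm : ∀ f ∈ A, (List.ofFn f).Perm n.primeFactorsList := by
    intro f hf
    rw [hA, Finset.mem_filter, Fintype.mem_piFinset] at hf
    refine Nat.primeFactorsList_unique (by rw [List.prod_ofFn]; exact hf.2) fun p hp => ?_
    obtain ⟨i, rfl⟩ := (List.mem_ofFn' f p).1 hp
    exact hS _ (hf.1 i)
  have h1 : A.card ≤ (n.primeFactorsList.permutations.toFinset).card := by
    refine Finset.card_le_card_of_injOn List.ofFn (fun f hf => ?_)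
      (List.ofFn_injective.injOn)
    rw [Finset.mem_coe, List.mem_toFinset, List.mem_permutations]
    exact hperm f hf
  refine h1.trans ((List.toFinset_card_le _).trans ?_)
  rw [List.length_permutations, ← (hperm f₀ hf₀).length_eq, List.length_ofFn]

/-- The moment inequality for a Dirichlet polynomial supported on primes: its `k`-th power is a
Dirichlet polynomial of length at most `x ^ k`, whose coefficients are estimated by the
Cauchy–Schwarz inequality. -/
theorem sum_dirSq_pow_le {ι : Type*} (J : Finset ι) {t : ι → ℝ} {T : ℝ} (hT : 1 ≤ T)
    (hmem : ∀ j ∈ J, T ≤ t j ∧ t j ≤ 2 * T)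
    (hsep : ∀ i ∈ J, ∀ j ∈ J, i ≠ j → 1 ≤ |t i - t j|) {S : Finset ℕ} (hS : ∀ p ∈ S, p.Prime)
    {x : ℝ} (hx : ∀ p ∈ S, (p : ℝ) ≤ x) {k : ℕ} (hk : x ^ k ≤ T) (a : ℕ → ℝ) :
    ∑ j ∈ J, dirSq a S (t j) ^ k ≤
      16 * T * (2 + Real.log T ^ 2) * (k.factorial * (∑ p ∈ S, a p ^ 2) ^ k) := by
  classical
  set Q := Fintype.piFinset fun _ : Fin k => S with hQ
  set D : ℕ → ℝ := fun n => ∑ f ∈ Q with ∏ i, f i = n, ∏ i, a (f i) with hD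
  set s := Q.image fun f => ∏ i, f i with hs
  have hmemQ : ∀ f ∈ Q, ∀ i, f i ∈ S := fun f hf i => Fintype.mem_piFinset.1 hf i
  have hmaps : ∀ f ∈ Q, ∏ i, f i ∈ s := fun f hf =>
    Finset.mem_image_of_mem (fun f : Fin k → ℕ => ∏ i, f i) hf
  have hbound : ∀ n ∈ s, 1 ≤ n ∧ (n : ℝ) ≤ T := by
    intro n hn
    obtain ⟨f, hf, rfl⟩ := Finset.mem_image.1 hn
    refine ⟨Nat.one_le_iff_ne_zero.2 (Finset.prod_ne_zero_iff.2 fun i _ =>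
      (hS _ (hmemQ f hf i)).ne_zero), ?_⟩
    push_cast
    calc ∏ i, (f i : ℝ) ≤ ∏ _i : Fin k, x :=
          Finset.prod_le_prod (fun i _ => Nat.cast_nonneg _) fun i _ => hx _ (hmemQ f hf i)
      _ = x ^ k := by simp
      _ ≤ T := hk
  have hpow : ∀ u, dirSq a S u ^ k = dirSq D s u := by
    intro u
    rw [dirSq_eq_norm_sq, dirSq_eq_norm_sq, ← pow_mul, mul_comm 2 k, pow_mul, ← norm_pow]
    congr 2
    have e1 : (∑ p ∈ S, (a p : ℂ) * Complex.exp ((u * Real.log p : ℝ) * Complex.I)) ^ k =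
        ∑ f ∈ Q, ∏ i, ((a (f i) : ℂ) * Complex.exp ((u * Real.log (f i) : ℝ) * Complex.I)) := by
      have h := Finset.prod_univ_sum (fun _ : Fin k => S) fun _ p =>
        (a p : ℂ) * Complex.exp ((u * Real.log p : ℝ) * Complex.I)
      rw [← h]
      simp
    have e2 : ∀ f ∈ Q, ∏ i, ((a (f i) : ℂ) * Complex.exp ((u * Real.log (f i) : ℝ) * Complex.I)) =
        ((∏ i, a (f i) : ℝ) : ℂ) *
          Complex.exp ((u * Real.log ((∏ i, f i : ℕ) : ℝ) : ℝ) * Complex.I) := by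
      intro f hf
      rw [Finset.prod_mul_distrib, ← Complex.exp_sum]
      congr 1
      · push_cast
        rfl
      · have hlog : Real.log ((∏ i, f i : ℕ) : ℝ) = ∑ i, Real.log (f i) := by
          push_cast
          exact Real.log_prod fun i _ => Nat.cast_ne_zero.2 (hS _ (hmemQ f hf i)).ne_zero
        rw [hlog, ← Finset.sum_mul, Finset.mul_sum, Complex.ofReal_sum]
    rw [e1, Finset.sum_congr rfl e2,
      ← Finset.sum_fiberwise_of_maps_to hmaps]
    refine Finset.sum_congr rfl fun n _ => ?_
    rw [hD, Complex.ofReal_sum, Finset.sum_mul]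
    refine Finset.sum_congr rfl fun f hf => ?_
    rw [(Finset.mem_filter.1 hf).2]
  have hDsq : ∑ n ∈ s, D n ^ 2 ≤ k.factorial * (∑ p ∈ S, a p ^ 2) ^ k := by
    have e1 : (∑ p ∈ S, a p ^ 2) ^ k = ∑ n ∈ s, ∑ f ∈ Q with ∏ i, f i = n, (∏ i, a (f i)) ^ 2 := by
      rw [Finset.sum_fiberwise_of_maps_to hmaps fun f => (∏ i, a (f i)) ^ 2]
      simp_rw [← Finset.prod_pow]
      rw [← Finset.prod_univ_sum (fun _ : Fin k => S) fun _ p => a p ^ 2]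
      simp
    rw [e1, Finset.mul_sum]
    refine Finset.sum_le_sum fun n _ => ?_
    refine sq_sum_le_card_mul_sum_sq.trans ?_
    refine mul_le_mul_of_nonneg_right ?_ (Finset.sum_nonneg fun f _ => sq_nonneg _)
    exact_mod_cast card_prime_tuples_le S hS k n
  simp_rw [hpow]
  refine (sum_dirSq_le J hT hmem hsep hbound D).trans ?_
  exact mul_le_mul_of_nonneg_left hDsq (by positivity)

end ZetaZeroCount

/-! ### Sums over primes and prime powers -/

namespace ZetaZeroCount

open Filter Topology MeasureTheory Set

/-- The sum of `1 / p` over the primes `p ≤ N`. -/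
noncomputable def primeRecip (N : ℕ) : ℝ := ∑ p ∈ (Finset.Ioc 0 N).filter Nat.Prime, 1 / (p : ℝ)

theorem primeRecip_nonneg (N : ℕ) : 0 ≤ primeRecip N :=
  Finset.sum_nonneg fun p _ => by positivity

theorem primeRecip_mono : Monotone primeRecip := fun _ _ h =>
  Finset.sum_le_sum_of_subset_of_nonneg
    (Finset.filter_subset_filter _ (Finset.Ioc_subset_Ioc_right h)) fun p _ _ => by positivity

/-- Each dyadic block of primes contributes at most `4 / j`, by Chebyshev's bound. -/
theorem primeRecip_two_pow_le (J : ℕ) :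
    primeRecip (2 ^ (J + 1)) ≤ 1 / 2 + 4 * ∑ j ∈ Finset.range J, 1 / ((j : ℝ) + 1) := by
  induction J with
  | zero =>
    have : (Finset.Ioc 0 2).filter Nat.Prime = {2} := by decide
    simp [primeRecip, this]
  | succ J ih =>
    have hsplit : primeRecip (2 ^ (J + 1 + 1)) = primeRecip (2 ^ (J + 1)) +
        ∑ p ∈ (Finset.Ioc (2 ^ (J + 1)) (2 ^ (J + 1 + 1))).filter Nat.Prime, 1 / (p : ℝ) := by
      rw [primeRecip, primeRecip, ← Finset.sum_union]
      · rw [← Finset.filter_union, Finset.Ioc_union_Ioc_eq_Ioc (Nat.zero_le _)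
          (Nat.pow_le_pow_right (by norm_num) (Nat.le_succ _))]
      · refine Finset.disjoint_filter_filter ?_
        rw [Finset.disjoint_left]
        intro p hp hp'
        have h1 := (Finset.mem_Ioc.1 hp).2
        have h2 := (Finset.mem_Ioc.1 hp').1
        omega
    have hl2 : 0 < Real.log 2 := Real.log_pos (by norm_num)
    have hblock : ∑ p ∈ (Finset.Ioc (2 ^ (J + 1)) (2 ^ (J + 1 + 1))).filter Nat.Prime,
        1 / (p : ℝ) ≤ 4 / ((J : ℝ) + 1) := by
      have hD : 0 < (2 : ℝ) ^ (J + 1) * ((J + 1) * Real.log 2) := by positivity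
      have hp : ∀ p ∈ (Finset.Ioc (2 ^ (J + 1)) (2 ^ (J + 1 + 1))).filter Nat.Prime,
          1 / (p : ℝ) ≤ Real.log p / ((2 : ℝ) ^ (J + 1) * ((J + 1) * Real.log 2)) := by
        intro p hp
        have h1 := (Finset.mem_Ioc.1 (Finset.mem_filter.1 hp).1).1
        have h2 : (2 : ℝ) ^ (J + 1) ≤ p := by exact_mod_cast h1.le
        have h0 : (0 : ℝ) < p := lt_of_lt_of_le (by positivity) h2
        have h3 : ((J : ℝ) + 1) * Real.log 2 ≤ Real.log p := by
          have := Real.log_le_log (by positivity) h2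
          rw [Real.log_pow] at this
          push_cast at this
          exact this
        rw [div_le_div_iff₀ h0 hD, one_mul, mul_comm (Real.log _)]
        gcongr
      have hθ := Chebyshev.theta_le_log4_mul_x (x := ((2 ^ (J + 1 + 1) : ℕ) : ℝ)) (by positivity)
      rw [Chebyshev.theta, Nat.floor_natCast] at hθ
      have hsub : ∑ p ∈ (Finset.Ioc (2 ^ (J + 1)) (2 ^ (J + 1 + 1))).filter Nat.Prime,
          Real.log p ≤ ∑ p ∈ (Finset.Ioc 0 (2 ^ (J + 1 + 1))).filter Nat.Prime, Real.log p :=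
        Finset.sum_le_sum_of_subset_of_nonneg
          (Finset.filter_subset_filter _ (Finset.Ioc_subset_Ioc_left (Nat.zero_le _)))
          fun p hp _ => Real.log_natCast_nonneg p
      refine (Finset.sum_le_sum hp).trans ?_
      rw [← Finset.sum_div, div_le_div_iff₀ hD (by positivity)]
      have h4 : Real.log 4 = 2 * Real.log 2 := by
        rw [show (4 : ℝ) = 2 ^ 2 by norm_num, Real.log_pow]
        norm_num
      rw [h4] at hθ
      push_cast at hθ
      have hJ : (0 : ℝ) ≤ (J : ℝ) + 1 := by positivity
      calc _ ≤ (2 * Real.log 2 * 2 ^ (J + 1 + 1)) * ((J : ℝ) + 1) :=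
            mul_le_mul_of_nonneg_right (hsub.trans hθ) hJ
        _ = _ := by ring
    rw [hsplit, Finset.sum_range_succ]
    have : 4 * (1 / ((J : ℝ) + 1)) = 4 / ((J : ℝ) + 1) := by ring
    linarith

theorem primeRecip_le {N : ℕ} {y : ℝ} (hy : 1 ≤ y) (hN : (N : ℝ) ≤ Real.exp y) :
    primeRecip N ≤ 9 + 4 * Real.log y := by
  set J := ⌊2 * y⌋₊ with hJ
  have hJ1 : 2 * y < J + 1 := Nat.lt_floor_add_one _
  have hJ2 : (J : ℝ) ≤ 2 * y := Nat.floor_le (by linarith)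
  have hNJ : N ≤ 2 ^ (J + 1) := by
    have h1 : Real.exp y ≤ (2 : ℝ) ^ (J + 1) := by
      rw [← Real.log_le_log_iff (Real.exp_pos _) (by positivity), Real.log_exp, Real.log_pow]
      push_cast
      nlinarith [Real.log_two_gt_d9]
    exact_mod_cast hN.trans h1
  have h2 := harmonic_le_one_add_log J
  have h3 : ((harmonic J : ℚ) : ℝ) = ∑ j ∈ Finset.range J, 1 / ((j : ℝ) + 1) := by
    rw [harmonic]
    push_cast
    exact Finset.sum_congr rfl fun j _ => by rw [one_div]
  have hJ0 : (0 : ℝ) < J := by linarith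
  have h4 : Real.log J ≤ Real.log 2 + Real.log y := by
    rw [← Real.log_mul (by norm_num) (by linarith)]
    exact Real.log_le_log hJ0 hJ2
  have h5 := (primeRecip_mono hNJ).trans (primeRecip_two_pow_le J)
  rw [← h3] at h5
  linarith [Real.log_two_lt_d9]

open ArithmeticFunction in
/-- Proper prime powers contribute no more than the primes themselves do to `∑ 1 / p`. -/
theorem sum_not_prime_le (N : ℕ) :
    ∑ n ∈ (Finset.Ioc 0 N).filter fun n => ¬ n.Prime, vonMangoldt n / (√n * Real.log n) ≤
      4 * primeRecip N := by
  set f : ℕ → ℝ := fun n => if n.Prime then 0 else vonMangoldt n / (√n * Real.log n) with hf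
  have hf0 : ∀ n, 0 ≤ f n := by
    intro n
    rw [hf]
    simp only
    split_ifs
    · exact le_rfl
    · exact div_nonneg vonMangoldt_nonneg (mul_nonneg (Real.sqrt_nonneg _)
        (Real.log_natCast_nonneg n))
  have h := Chebyshev.sum_PrimePow_eq_sum_sum f (x := (N : ℝ)) (Nat.cast_nonneg N)
  rw [Nat.floor_natCast] at h
  have hL : ∑ n ∈ (Finset.Ioc 0 N).filter fun n => ¬ n.Prime,
      vonMangoldt n / (√n * Real.log n) = ∑ n ∈ Finset.Ioc 0 N with IsPrimePow n, f n := by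
    rw [Finset.sum_filter, Finset.sum_filter]
    refine Finset.sum_congr rfl fun n _ => ?_
    by_cases hpp : IsPrimePow n
    · simp [hf, hpp]
    · have hv := vonMangoldt_eq_zero_iff.2 hpp
      simp [hpp, hv]
  rw [hL, h]
  set K := ⌊Real.log N / Real.log 2⌋₊
  have hterm : ∀ p : ℕ, p.Prime → ∀ k ∈ Finset.Icc 1 K,
      f (p ^ k) ≤ if k = 1 then 0 else ((√p)⁻¹) ^ k := by
    intro p hp k hk
    have hk1 := (Finset.mem_Icc.1 hk).1
    have hp0 : (0 : ℝ) < p := by exact_mod_cast hp.pos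
    have hlog : 0 < Real.log p := Real.log_pos (by exact_mod_cast hp.one_lt)
    rcases eq_or_ne k 1 with rfl | hk2
    · simp [hf, hp]
    · have hnp : ¬ (p ^ k).Prime := Nat.Prime.not_prime_pow (by omega)
      rw [hf]
      simp only [hnp, hk2, if_false]
      rw [vonMangoldt_apply_pow (by omega), vonMangoldt_apply_prime hp]
      push_cast
      rw [Real.log_pow, Real.sqrt_eq_rpow, ← Real.rpow_natCast, ← Real.rpow_mul hp0.le,
        mul_comm (k : ℝ), Real.rpow_mul hp0.le, Real.rpow_natCast, ← Real.sqrt_eq_rpow, inv_pow]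
      have hsq : 0 < √(p : ℝ) := Real.sqrt_pos.2 hp0
      rw [← one_div, div_le_div_iff₀ (by positivity) (by positivity)]
      have hk3 : (1 : ℝ) ≤ k := by exact_mod_cast hk1
      nlinarith [mul_pos (pow_pos hsq k) hlog]
  have hgeom : ∀ p : ℕ, p.Prime →
      ∑ k ∈ Finset.Icc 1 K, (if k = 1 then 0 else ((√(p : ℝ))⁻¹) ^ k) ≤ 4 * (1 / (p : ℝ)) := by
    intro p hp
    have hp2 : (2 : ℝ) ≤ p := by exact_mod_cast hp.two_le
    have hp0 : (0 : ℝ) < p := by linarith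
    set r := (√(p : ℝ))⁻¹ with hr
    have hr0 : 0 ≤ r := by positivity
    have hr2 : r ^ 2 = 1 / p := by rw [hr, inv_pow, Real.sq_sqrt hp0.le, one_div]
    have hr3 : r ≤ 3 / 4 := by
      have h1 : r ^ 2 ≤ 1 / 2 := by
        rw [hr2]
        exact one_div_le_one_div_of_le (by norm_num) hp2
      nlinarith
    rw [← Finset.Ico_succ_right_eq_Icc, Finset.sum_Ico_eq_sum_range]
    simp only [Nat.succ_eq_succ, Nat.succ_eq_add_one, Nat.add_sub_cancel]
    rcases K with _ | K
    · simp
    · rw [Finset.sum_range_succ']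
      have h2 : ∀ i ∈ Finset.range K, (if 1 + (i + 1) = 1 then (0 : ℝ) else r ^ (1 + (i + 1))) =
          r ^ 2 * r ^ i := by
        intro i _
        rw [if_neg (by omega), ← pow_add]
        congr 1
        omega
      rw [Finset.sum_congr rfl h2, ← Finset.mul_sum]
      have h3 := sum_le_hasSum (Finset.range K) (fun i _ => pow_nonneg hr0 i)
        (hasSum_geometric_of_lt_one hr0 (by linarith))
      have h4 : (1 - r)⁻¹ ≤ 4 := by
        rw [inv_le_comm₀ (by linarith) (by norm_num)]
        linarith
      simp only [add_zero, if_true, ← hr2]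
      nlinarith [sq_nonneg r]
  calc ∑ k ∈ Finset.Icc 1 K, ∑ p ∈ Finset.Ioc 0 ⌊(N : ℝ) ^ ((1 : ℝ) / k)⌋₊ with p.Prime, f (p ^ k)
      ≤ ∑ k ∈ Finset.Icc 1 K, ∑ p ∈ Finset.Ioc 0 N with p.Prime,
          (if k = 1 then 0 else ((√(p : ℝ))⁻¹) ^ k) := by
        refine Finset.sum_le_sum fun k hk => ?_
        have hk1 : 1 ≤ k := (Finset.mem_Icc.1 hk).1
        have hfl : ⌊(N : ℝ) ^ ((1 : ℝ) / k)⌋₊ ≤ N := by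
          rcases Nat.eq_zero_or_pos N with h0 | h0
          · rw [h0]
            have : (1 : ℝ) / k ≠ 0 := by positivity
            rw [Nat.cast_zero, Real.zero_rpow this]
            simp
          · refine Nat.floor_le_of_le ?_
            refine Real.rpow_le_self_of_one_le (by exact_mod_cast h0) ?_
            rw [div_le_one (by positivity)]
            exact_mod_cast hk1
        calc _ ≤ ∑ p ∈ Finset.Ioc 0 N with p.Prime, f (p ^ k) :=
              Finset.sum_le_sum_of_subset_of_nonneg
                (Finset.filter_subset_filter _ (Finset.Ioc_subset_Ioc_right hfl))
                fun p _ _ => hf0 _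
          _ ≤ _ := Finset.sum_le_sum fun p hp => hterm p (Finset.mem_filter.1 hp).2 k hk
    _ = ∑ p ∈ Finset.Ioc 0 N with p.Prime, ∑ k ∈ Finset.Icc 1 K,
          (if k = 1 then 0 else ((√(p : ℝ))⁻¹) ^ k) := Finset.sum_comm
    _ ≤ ∑ p ∈ Finset.Ioc 0 N with p.Prime, 4 * (1 / (p : ℝ)) :=
        Finset.sum_le_sum fun p hp => hgeom p (Finset.mem_filter.1 hp).2
    _ = _ := by rw [← Finset.mul_sum, primeRecip]

open ArithmeticFunction in
theorem abs_le_of_prime {α : ℕ → ℝ} {M : ℝ} {N : ℕ}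
    (hα : ∀ n ∈ Finset.range (N + 1), |α n| ≤ M * (vonMangoldt n / (√n * Real.log n))) :
    ∀ p ∈ (Finset.Ioc 0 N).filter Nat.Prime, |α p| ≤ M * (√(p : ℝ))⁻¹ := by
  intro p hp
  obtain ⟨h1, h2⟩ := Finset.mem_filter.1 hp
  have h3 := hα p (Finset.mem_range.2 (Nat.lt_succ_iff.2 (Finset.mem_Ioc.1 h1).2))
  have hlog : Real.log p ≠ 0 := (Real.log_pos (by exact_mod_cast h2.one_lt)).ne'
  rw [vonMangoldt_apply_prime h2] at h3
  refine h3.trans (le_of_eq ?_)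
  congr 1
  rw [mul_comm, ← div_div, div_self hlog, one_div]

open ArithmeticFunction in
theorem sum_sq_le_primeRecip {α : ℕ → ℝ} {M : ℝ} {N : ℕ}
    (hα : ∀ n ∈ Finset.range (N + 1), |α n| ≤ M * (vonMangoldt n / (√n * Real.log n))) :
    ∑ p ∈ (Finset.Ioc 0 N).filter Nat.Prime, α p ^ 2 ≤ M ^ 2 * primeRecip N := by
  rw [primeRecip, Finset.mul_sum]
  refine Finset.sum_le_sum fun p hp => ?_
  have h := abs_le_of_prime hα p hp
  have h2 := pow_le_pow_left₀ (abs_nonneg _) h 2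
  rwa [sq_abs, mul_pow, inv_pow, Real.sq_sqrt (Nat.cast_nonneg p), ← one_div] at h2

open ArithmeticFunction in
/-- A Dirichlet polynomial over prime powers is, up to the contribution of the proper prime
powers, one over primes. -/
theorem abs_sum_cos_le {α : ℕ → ℝ} {M : ℝ} (hM : 0 ≤ M) {N : ℕ}
    (hα : ∀ n ∈ Finset.range (N + 1), |α n| ≤ M * (vonMangoldt n / (√n * Real.log n))) (t : ℝ) :
    |∑ n ∈ Finset.range (N + 1), α n * Real.cos (t * Real.log n)| ≤
      √(dirSq α ((Finset.Ioc 0 N).filter Nat.Prime) t) + 4 * M * primeRecip N := by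
  have h0 : α 0 = 0 := by
    have := hα 0 (by simp)
    simpa using this
  have e1 : ∑ n ∈ Finset.range (N + 1), α n * Real.cos (t * Real.log n) =
      ∑ n ∈ Finset.Ioc 0 N, α n * Real.cos (t * Real.log n) := by
    symm
    refine Finset.sum_subset (fun n hn => ?_) fun n hn hn' => ?_
    · exact Finset.mem_range.2 (Nat.lt_succ_iff.2 (Finset.mem_Ioc.1 hn).2)
    · have hn1 := Finset.mem_range.1 hn
      obtain rfl : n = 0 := by
        by_contra hne
        exact hn' (Finset.mem_Ioc.2 ⟨Nat.pos_of_ne_zero hne, by omega⟩)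
      rw [h0, zero_mul]
  rw [e1, ← Finset.sum_filter_add_sum_filter_not _ Nat.Prime]
  refine (abs_add_le _ _).trans (add_le_add ?_ ?_)
  · refine Real.abs_le_sqrt ?_
    unfold dirSq
    have := sq_nonneg (∑ n ∈ (Finset.Ioc 0 N).filter Nat.Prime, α n * Real.sin (t * Real.log n))
    linarith
  · refine (Finset.abs_sum_le_sum_abs _ _).trans ?_
    have h2 := mul_le_mul_of_nonneg_left (sum_not_prime_le N) hM
    rw [Finset.mul_sum] at h2
    refine le_trans (Finset.sum_le_sum fun n hn => ?_) (h2.trans (le_of_eq (by ring)))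
    have hn1 := (Finset.mem_Ioc.1 (Finset.mem_filter.1 hn).1).2
    rw [abs_mul]
    calc |α n| * |Real.cos (t * Real.log n)| ≤ |α n| * 1 := by
          gcongr
          exact Real.abs_cos_le_one _
      _ = |α n| := mul_one _
      _ ≤ _ := hα n (Finset.mem_range.2 (Nat.lt_succ_iff.2 hn1))

end ZetaZeroCount

/-! ### The large value estimate -/

namespace ZetaZeroCount

open Filter Topology MeasureTheory Set

/-- Chebyshev's inequality for the `2k`-th moment: points at which one of two Dirichlet
polynomials over primes is large are rare. -/
theorem card_mul_pow_le {R : ℕ} {t : Fin R → ℝ} {T : ℝ} (hT : 1 ≤ T)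
    (hmem : ∀ j, T ≤ t j ∧ t j ≤ 2 * T) (hsep : ∀ i j, i ≠ j → 1 ≤ |t i - t j|)
    {N k : ℕ} (hk : (N : ℝ) ^ k ≤ T) {α β : ℕ → ℝ} {Q : ℝ}
    (hα : ∑ p ∈ (Finset.Ioc 0 N).filter Nat.Prime, α p ^ 2 ≤ Q)
    (hβ : ∑ p ∈ (Finset.Ioc 0 N).filter Nat.Prime, β p ^ 2 ≤ Q) {Y : ℝ} (hY : 0 ≤ Y)
    (h : ∀ j, Y ≤ √(dirSq α ((Finset.Ioc 0 N).filter Nat.Prime) (t j)) +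
      √(dirSq β ((Finset.Ioc 0 N).filter Nat.Prime) (t j))) :
    (R : ℝ) * (Y ^ 2) ^ k ≤ 32 * T * (2 + Real.log T ^ 2) * (k.factorial * (4 * Q) ^ k) := by
  set S := (Finset.Ioc 0 N).filter Nat.Prime with hS
  have hSp : ∀ p ∈ S, p.Prime := fun p hp => (Finset.mem_filter.1 hp).2
  have hSx : ∀ p ∈ S, (p : ℝ) ≤ N := fun p hp => by
    exact_mod_cast (Finset.mem_Ioc.1 (Finset.mem_filter.1 hp).1).2
  have hmom : ∀ c : ℕ → ℝ, ∑ p ∈ S, c p ^ 2 ≤ Q →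
      ∑ j : Fin R, dirSq c S (t j) ^ k ≤ 16 * T * (2 + Real.log T ^ 2) * (k.factorial * Q ^ k) := by
    intro c hc
    refine (sum_dirSq_pow_le Finset.univ hT (fun j _ => hmem j) (fun i _ j _ => hsep i j)
      hSp hSx hk c).trans ?_
    have : (∑ p ∈ S, c p ^ 2) ^ k ≤ Q ^ k :=
      pow_le_pow_left₀ (Finset.sum_nonneg fun p _ => sq_nonneg _) hc k
    gcongr
  have hpt : ∀ j, (Y ^ 2) ^ k ≤ 4 ^ k * (dirSq α S (t j) ^ k + dirSq β S (t j) ^ k) := by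
    intro j
    have ha := dirSq_nonneg α S (t j)
    have hb := dirSq_nonneg β S (t j)
    have h1 : Y ^ 2 ≤ 2 * (dirSq α S (t j) + dirSq β S (t j)) := by
      have h2 := pow_le_pow_left₀ hY (h j) 2
      have h3 := sq_nonneg (√(dirSq α S (t j)) - √(dirSq β S (t j)))
      nlinarith [Real.sq_sqrt ha, Real.sq_sqrt hb]
    have h4 : (dirSq α S (t j) + dirSq β S (t j)) ^ k ≤
        2 ^ k * (dirSq α S (t j) ^ k + dirSq β S (t j) ^ k) := by
      refine (add_pow_le ha hb k).trans ?_
      gcongr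
      · norm_num
      · omega
    calc (Y ^ 2) ^ k ≤ (2 * (dirSq α S (t j) + dirSq β S (t j))) ^ k :=
          pow_le_pow_left₀ (sq_nonneg _) h1 k
      _ = 2 ^ k * (dirSq α S (t j) + dirSq β S (t j)) ^ k := mul_pow _ _ _
      _ ≤ 2 ^ k * (2 ^ k * (dirSq α S (t j) ^ k + dirSq β S (t j) ^ k)) := by gcongr
      _ = _ := by rw [← mul_assoc, ← mul_pow]; norm_num
  have hsum := Finset.sum_le_sum fun (j : Fin R) (_ : j ∈ Finset.univ) => hpt j
  rw [Finset.sum_const, Finset.card_univ, Fintype.card_fin, nsmul_eq_mul, ← Finset.mul_sum,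
    Finset.sum_add_distrib] at hsum
  refine hsum.trans ((mul_le_mul_of_nonneg_left (add_le_add (hmom α hα) (hmom β hβ))
    (by positivity)).trans (le_of_eq ?_))
  rw [mul_pow]
  ring

theorem one_le_abs_sub_of_strictMono {R : ℕ} {t : Fin R → ℝ} (ht : StrictMono t)
    (hgap : ∀ i j : Fin R, (j : ℕ) = (i : ℕ) + 1 → 1 ≤ t j - t i) (i j : Fin R) (hij : i ≠ j) :
    1 ≤ |t i - t j| := by
  have key : ∀ i j : Fin R, i < j → 1 ≤ t j - t i := by
    intro i j h
    have h1 : (i : ℕ) + 1 < R := lt_of_le_of_lt (Nat.succ_le_of_lt h) j.2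
    have h2 := hgap i ⟨i + 1, h1⟩ rfl
    have h3 : t ⟨i + 1, h1⟩ ≤ t j := ht.monotone (Nat.succ_le_of_lt h)
    linarith
  rcases lt_or_gt_of_ne hij with h | h
  · rw [abs_sub_comm]
    exact (key i j h).trans (le_abs_self _)
  · exact (key j i h).trans (le_abs_self _)

theorem factorial_mul_pow_le {k : ℕ} {V A B : ℝ} (hkV : (k : ℝ) ≤ V) (hA : 0 ≤ A) (hAB : A ≤ B) :
    (k.factorial : ℝ) * A ^ k ≤ (V * B) ^ k := by
  have h1 : (k.factorial : ℝ) ≤ (k : ℝ) ^ k := by exact_mod_cast Nat.factorial_le_pow k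
  rw [mul_pow]
  have hV := (Nat.cast_nonneg k).trans hkV
  exact mul_le_mul (h1.trans (pow_le_pow_left₀ (Nat.cast_nonneg k) hkV k))
    (pow_le_pow_left₀ hA hAB k) (by positivity) (by positivity)

theorem mul_pow_eq_exp_mul {ℓ V D : ℝ} (hV : 0 < V) (hlV : 0 < Real.log V) (hD : 0 < D)
    (hℓ : 0 < ℓ) (k : ℕ) :
    (V * (D * ℓ)) ^ k = Real.exp (k * (Real.log D + 2 * Real.log (Real.log V) -
      Real.log (V / ℓ))) * ((V / Real.log V) ^ 2) ^ k := by
  rw [Real.exp_nat_mul, ← mul_pow]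
  congr 1
  rw [Real.exp_sub, Real.exp_add, two_mul, Real.exp_add, Real.exp_log hD, Real.exp_log hlV,
    Real.exp_log (div_pos hV hℓ)]
  field_simp

/-- The exponent that comes out of the `2k`-th moment with `k` slightly below `V`. -/
theorem moment_factor_le {ℓ V D k : ℝ} (hD : 1 ≤ D)
    (hℓ : 3 ≤ ℓ) (hℓD : Real.exp (Real.exp (Real.log D + 6)) ≤ ℓ) (hV : ℓ ^ 2 ≤ V)
    (hk1 : k ≤ V) (hk2 : (1 - 2 / Real.log V) * V - 1 ≤ k) :
    (2 + Real.exp ℓ ^ 2) * Real.exp (k * (Real.log D + 2 * Real.log (Real.log V) -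
      Real.log (V / ℓ))) ≤
    Real.exp (-V * Real.log (V / ℓ) + 3 * V * Real.log (Real.log V)) := by
  have hVℓ : ℓ ≤ V := by nlinarith
  have hV0 : 0 < V := by linarith
  have hℓ0 : 0 < ℓ := by linarith
  have hlD : 0 ≤ Real.log D := Real.log_nonneg hD
  have hlℓ : Real.exp (Real.log D + 6) ≤ Real.log ℓ := (Real.le_log_iff_exp_le hℓ0).2 hℓD
  have hlV : Real.log ℓ ≤ Real.log V := Real.log_le_log hℓ0 hVℓ
  have hlV0 : 0 < Real.log V := (Real.exp_pos _).trans_le (hlℓ.trans hlV)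
  have hllV : Real.log D + 6 ≤ Real.log (Real.log V) :=
    (Real.le_log_iff_exp_le hlV0).2 (hlℓ.trans hlV)
  have hW : Real.log (V / ℓ) = Real.log V - Real.log ℓ := Real.log_div hV0.ne' hℓ0.ne'
  have hlℓ0 : 0 < Real.log ℓ := (Real.exp_pos _).trans_le hlℓ
  set W := Real.log (V / ℓ) with hWdef
  have hW0 : 0 ≤ W := by linarith
  have hWV : W ≤ Real.log V := by linarith
  have hlVV : Real.log V ≤ V := (Real.log_le_sub_one_of_pos hV0).trans (by linarith)
  have h1 : 2 + Real.exp ℓ ^ 2 ≤ Real.exp (3 * ℓ) := by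
    have h2 : 4 ≤ Real.exp ℓ := by linarith [Real.add_one_le_exp ℓ]
    have h3 : Real.exp (3 * ℓ) = Real.exp ℓ ^ 3 := by rw [← Real.exp_nat_mul]; norm_num
    rw [h3]
    nlinarith [pow_le_pow_left₀ (by norm_num) h2 2]
  refine (mul_le_mul_of_nonneg_right h1 (Real.exp_pos _).le).trans ?_
  rw [← Real.exp_add, Real.exp_le_exp]
  have h4 : k * (Real.log D + 2 * Real.log (Real.log V)) ≤
      V * (Real.log D + 2 * Real.log (Real.log V)) :=
    mul_le_mul_of_nonneg_right hk1 (by linarith)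
  have h5 : ((1 - 2 / Real.log V) * V - 1) * W ≤ k * W := mul_le_mul_of_nonneg_right hk2 hW0
  have h6 : 2 / Real.log V * V * W ≤ 2 * V := by
    have : 2 / Real.log V * V * W = 2 * V * (W / Real.log V) := by ring
    rw [this]
    have h7 : W / Real.log V ≤ 1 := (div_le_one hlV0).2 hWV
    nlinarith
  have h8 : V * (Real.log D + 6) ≤ V * Real.log (Real.log V) :=
    mul_le_mul_of_nonneg_left hllV hV0.le
  nlinarith

/-- With `V ≥ ℓ²` and `ℓ` large, `V / log V` beats any multiple of `ℓ`. -/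
theorem mul_le_div_log {ℓ V K : ℝ} (hK : 0 ≤ K) (hℓ : 3 ≤ ℓ) (hKℓ : (4 * K) ^ 2 ≤ ℓ)
    (hV : ℓ ^ 2 ≤ V) : K * ℓ ≤ V / Real.log V := by
  have hV1 : 1 < V := by nlinarith
  have hlV : 0 < Real.log V := Real.log_pos hV1
  set v := √(√V) with hv
  have hv0 : 0 < v := Real.sqrt_pos.2 (Real.sqrt_pos.2 (by linarith))
  have hv2 : v ^ 2 = √V := Real.sq_sqrt (Real.sqrt_nonneg V)
  have hv4 : v ^ 4 = V := by
    rw [show v ^ 4 = (v ^ 2) ^ 2 by ring, hv2, Real.sq_sqrt (by linarith)]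
  have hℓv : ℓ ≤ v ^ 2 := by
    rw [hv2]
    exact Real.le_sqrt_of_sq_le hV
  have hKv : 4 * K ≤ v := by
    refine le_of_sq_le_sq ?_ hv0.le
    linarith
  have hlog : Real.log V ≤ 4 * v := by
    rw [← hv4, Real.log_pow]
    push_cast
    linarith [Real.log_le_sub_one_of_pos hv0]
  rw [le_div_iff₀ hlV]
  calc K * ℓ * Real.log V ≤ K * v ^ 2 * (4 * v) := by gcongr
    _ = 4 * K * v ^ 3 := by ring
    _ ≤ v * v ^ 3 := by gcongr
    _ = V := by rw [← hv4]; ring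

theorem cube_mul_exp_mul_rpow_le_one {L T s : ℝ} (hL : 0 ≤ L) (hLT : 6 * L ≤ 1 / 4 * Real.log T)
    (hT : 0 < T) (hs : T ≤ s) :
    (1 + 3 / 2 * L) ^ 3 * Real.exp (3 / 2 * L) * s ^ (-(1 / 4) : ℝ) ≤ 1 := by
  have hs0 : 0 < s := hT.trans_le hs
  have h2 : (1 + 3 / 2 * L) ^ 3 ≤ Real.exp (3 / 2 * L) ^ 3 :=
    pow_le_pow_left₀ (by positivity) (by linarith [Real.add_one_le_exp (3 / 2 * L)]) 3
  have h3 : s ^ (-(1 / 4) : ℝ) ≤ Real.exp (-(1 / 4) * Real.log T) := by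
    rw [Real.rpow_def_of_pos hs0, Real.exp_le_exp]
    linarith [Real.log_le_log hT hs]
  calc _ ≤ Real.exp (3 / 2 * L) ^ 3 * Real.exp (3 / 2 * L) *
        Real.exp (-(1 / 4) * Real.log T) := by gcongr
    _ = Real.exp (6 * L - 1 / 4 * Real.log T) := by
      rw [← Real.exp_nat_mul, ← Real.exp_add, ← Real.exp_add]
      congr 1
      push_cast
      ring
    _ ≤ 1 := by
      rw [Real.exp_le_one_iff]
      linarith

end ZetaZeroCount

open ZetaZeroCount in
theorem theorem2 (hRH : RiemannHypothesis) :
    ∃ C : ℝ, 0 < C ∧ ∃ T₀ : ℝ, ∀ T : ℝ, T₀ ≤ T →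
      ∀ h : ℝ, 0 ≤ h → h ≤ Real.sqrt T →
      ∀ V : ℝ, (Real.log (Real.log T)) ^ 2 ≤ V → V ≤ Real.log T / Real.log (Real.log T) →
      ∀ (R : ℕ) (t : Fin R → ℝ), StrictMono t →
        (∀ j, T ≤ t j ∧ t j ≤ 2 * T) →
        (∀ i j : Fin R, (j : ℕ) = (i : ℕ) + 1 → 1 ≤ t j - t i) →
        (∀ j, V < |(zetaZeroCount (t j + h) : ℝ) - (zetaZeroCount (t j - h) : ℝ)
          - h / Real.pi * Real.log (t j / (2 * Real.pi))|) →
        (R : ℝ) ≤ C * (T * Real.exp (-V * Real.log (V / Real.log (Real.log T))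
          + 3 * V * Real.log (Real.log V))) := by
  obtain ⟨M, hM, hmain⟩ := exists_abs_count_sub_le hRH
  set D : ℝ := 52 * M ^ 2 + 1 with hD
  have hD1 : 1 ≤ D := by nlinarith [sq_nonneg M]
  set K : ℝ := 1 + 106 * M with hK
  -- A lower bound for `log log T`.
  set Λ : ℝ := max 8 (max (Real.exp (Real.exp (Real.log D + 6))) ((4 * K) ^ 2)) with hΛ
  refine ⟨32, by norm_num, Real.exp (Real.exp Λ), ?_⟩
  intro T hT h hh0 hhT V hV1 hV2 R t ht hmem hgap hlarge
  have hT0 : 0 < T := (Real.exp_pos _).trans_le hT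
  have hlogT : Real.exp Λ ≤ Real.log T := (Real.le_log_iff_exp_le hT0).2 hT
  have hlogT0 : 0 < Real.log T := (Real.exp_pos _).trans_le hlogT
  set ℓ := Real.log (Real.log T) with hℓ
  have hΛℓ : Λ ≤ ℓ := (Real.le_log_iff_exp_le hlogT0).2 hlogT
  have hexpℓ : Real.exp ℓ = Real.log T := Real.exp_log hlogT0
  have hℓ8 : 8 ≤ ℓ := (le_max_left _ _).trans hΛℓ
  have hℓD : Real.exp (Real.exp (Real.log D + 6)) ≤ ℓ :=
    (le_max_left _ _).trans ((le_max_right _ _).trans hΛℓ)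
  have hℓK : (4 * K) ^ 2 ≤ ℓ := (le_max_right _ _).trans ((le_max_right _ _).trans hΛℓ)
  have hT1 : 16 ≤ T := by
    have h1 : Λ + 1 ≤ Real.exp Λ := Real.add_one_le_exp Λ
    have h2 : 8 ≤ Λ := le_max_left _ _
    have h3 : (Real.exp 4) ≤ T := by
      refine le_trans (Real.exp_le_exp.2 ?_) hT
      linarith
    have h4 : Real.exp 4 = Real.exp 1 ^ 4 := by rw [← Real.exp_nat_mul]; norm_num
    have h5 : (2 : ℝ) ^ 4 ≤ Real.exp 1 ^ 4 :=
      pow_le_pow_left₀ (by norm_num) (by linarith [Real.exp_one_gt_d9]) 4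
    linarith
  have hV64 : 64 ≤ V := by nlinarith only [hV1, hℓ8]
  have hlV : 4 ≤ Real.log V := by
    have h1 : Real.log 64 ≤ Real.log V := Real.log_le_log (by norm_num) hV64
    have h2 : Real.log 64 = 6 * Real.log 2 := by
      rw [show (64 : ℝ) = 2 ^ 6 by norm_num, Real.log_pow]
      norm_num
    linarith [Real.log_two_gt_d9]
  have hη : 2 / Real.log V ≤ 1 / 2 := by
    rw [div_le_div_iff₀ (by linarith) (by norm_num)]
    linarith
  have hη0 : 0 ≤ 2 / Real.log V := by positivity
  -- With Dirichlet polynomials of length `T ^ (1 / k)` the error term `log t / (2πΔ)` is about `k`,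
  -- so this `k` is the largest moment that leaves the proportion `2 / log V` of `V` to them.
  set k := ⌊(1 - 2 / Real.log V) * V⌋₊ with hk
  have hk1 : (k : ℝ) ≤ (1 - 2 / Real.log V) * V :=
    Nat.floor_le (mul_nonneg (by linarith) (by linarith))
  have hk2 : (1 - 2 / Real.log V) * V - 1 ≤ k := (Nat.sub_one_lt_floor _).le
  have hk24 : (24 : ℝ) ≤ k := by nlinarith only [hk2, hη, hV64]
  have hkV : (k : ℝ) ≤ V := by nlinarith only [hk1, hη0, hV64]
  have hk0 : (0 : ℝ) < k := by linarith
  set L := Real.log T / k with hL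
  have hkL : k * L = Real.log T := mul_div_cancel₀ _ hk0.ne'
  have hℓ0 : 0 < ℓ := by linarith
  have hLℓ : ℓ ≤ L := by
    rw [hL, le_div_iff₀ hk0]
    rw [le_div_iff₀ hℓ0] at hV2
    nlinarith only [hV2, hkV, hℓ0]
  have hL1 : 8 ≤ L := hℓ8.trans hLℓ
  have hLT : L ≤ Real.log T := by nlinarith only [hkL, hk24, hL1]
  have hpi := Real.pi_pos
  set Δ := L / (2 * Real.pi) with hΔ
  have hΔL : 2 * Real.pi * Δ = L := mul_div_cancel₀ _ (by positivity)
  have hΔ1 : 1 ≤ Δ := by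
    rw [hΔ, le_div_iff₀ (by positivity)]
    linarith [Real.pi_lt_d2]
  obtain ⟨α, β, hαβ, hcount⟩ := hmain Δ hΔ1 h hh0
  rw [hΔL] at hαβ
  simp only [hΔL] at hcount
  set N := ⌊Real.exp L⌋₊ with hN
  have hNL : (N : ℝ) ≤ Real.exp L := Nat.floor_le (Real.exp_pos _).le
  have hNT : (N : ℝ) ^ k ≤ T := by
    refine (pow_le_pow_left₀ (Nat.cast_nonneg _) hNL k).trans (le_of_eq ?_)
    rw [← Real.exp_nat_mul, hkL, Real.exp_log hT0]
  set E := primeRecip N with hE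
  have hE0 : 0 ≤ E := primeRecip_nonneg N
  have hEℓ : E ≤ 13 * ℓ := by
    have h1 := primeRecip_le (by linarith : (1 : ℝ) ≤ L) hNL
    have h2 : Real.log L ≤ ℓ := Real.log_le_log (by linarith) hLT
    linarith
  have hα : ∀ n ∈ Finset.range (N + 1),
      |α n| ≤ M * (ArithmeticFunction.vonMangoldt n / (√n * Real.log n)) :=
    fun n hn => (hαβ n hn).1
  have hβ : ∀ n ∈ Finset.range (N + 1),
      |β n| ≤ M * (ArithmeticFunction.vonMangoldt n / (√n * Real.log n)) :=
    fun n hn => (hαβ n hn).2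
  have h6L : 6 * L ≤ 1 / 4 * Real.log T := by
    rw [← hkL]
    nlinarith only [hk24, hL1]
  have hrem : ∀ s, T ≤ s →
      (1 + 3 * Real.pi * Δ) ^ 3 * Real.exp (3 * Real.pi * Δ) * s ^ (-(1 / 4) : ℝ) ≤ 1 := by
    intro s hs
    rw [show 3 * Real.pi * Δ = 3 / 2 * L by rw [← hΔL]; ring]
    exact cube_mul_exp_mul_rpow_le_one (by linarith only [hL1]) h6L hT0 hs
  set Y := V / Real.log V with hY
  have hY0 : 0 < Y := div_pos (by linarith) (by linarith)
  have hYK : K * ℓ ≤ Y := mul_le_div_log (by positivity) (by linarith) hℓK hV1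
  have hYV : 2 / Real.log V * V = 2 * Y := by rw [hY]; ring
  have hpoint : ∀ j, Y ≤ √(dirSq α ((Finset.Ioc 0 N).filter Nat.Prime) (t j)) +
      √(dirSq β ((Finset.Ioc 0 N).filter Nat.Prime) (t j)) := by
    intro j
    obtain ⟨hj1, hj2⟩ := hmem j
    have h1 := hcount (t j) (by linarith) (hhT.trans (Real.sqrt_le_sqrt hj1))
    have h2 := abs_sum_cos_le hM hα (t j)
    have h3 := abs_sum_cos_le hM hβ (t j)
    have h4 := mul_le_mul_of_nonneg_left (hrem (t j) hj1) hM
    have h5 : Real.log (t j) / L ≤ k + 1 := by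
      rw [div_le_iff₀ (by linarith), add_mul, hkL]
      have := Real.log_le_log (hT0.trans_le hj1) hj2
      rw [Real.log_mul (by norm_num) hT0.ne'] at this
      linarith [Real.log_two_lt_d9]
    have h6 : 1 + 2 * M + 8 * M * E ≤ Y := by
      refine le_trans ?_ hYK
      have h7 : M * E ≤ M * (13 * ℓ) := mul_le_mul_of_nonneg_left hEℓ hM
      have h8 : M ≤ M * ℓ := le_mul_of_one_le_right hM (by linarith)
      rw [hK, add_mul, mul_assoc]
      linarith only [h7, h8, hℓ8]
    have h9 := hlarge j
    rw [one_sub_mul, hYV] at hk1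
    linarith only [h1, h2, h3, h4, h5, h6, h9, hk1]
  have hcard := card_mul_pow_le (by linarith) hmem (one_le_abs_sub_of_strictMono ht hgap) hNT
    (sum_sq_le_primeRecip hα) (sum_sq_le_primeRecip hβ) hY0.le hpoint
  have hfac : (k.factorial : ℝ) * (4 * (M ^ 2 * E)) ^ k ≤ (V * (D * ℓ)) ^ k := by
    refine factorial_mul_pow_le hkV (by positivity) ?_
    have := mul_le_mul_of_nonneg_left hEℓ (sq_nonneg M)
    rw [hD, add_mul]
    linarith only [this, hℓ0]
  -- The moment bound divided by `(Y ^ 2) ^ k`, with `Y = V / log V`.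
  have hratio := mul_pow_eq_exp_mul (by linarith : 0 < V) (by linarith : 0 < Real.log V)
    (by linarith : 0 < D) hℓ0 k
  rw [← hY] at hratio
  have hYk : 0 < (Y ^ 2) ^ k := by positivity
  refine le_of_mul_le_mul_right (hcard.trans ?_) hYk
  have hexp := moment_factor_le hD1 (by linarith) hℓD hV1 hkV hk2
  rw [hexpℓ] at hexp
  calc 32 * T * (2 + Real.log T ^ 2) * (k.factorial * (4 * (M ^ 2 * E)) ^ k)
      ≤ 32 * T * (2 + Real.log T ^ 2) * (V * (D * ℓ)) ^ k := by gcongr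
    _ = 32 * T * ((2 + Real.log T ^ 2) * Real.exp (k * (Real.log D +
          2 * Real.log (Real.log V) - Real.log (V / ℓ)))) * (Y ^ 2) ^ k := by rw [hratio]; ring
    _ ≤ 32 * T * Real.exp (-V * Real.log (V / ℓ) + 3 * V * Real.log (Real.log V)) *
          (Y ^ 2) ^ k := by gcongr
    _ = _ := by ring
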